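/- Let $J\subseteq\mathbb R^5$ be open and let $F,G:J\to\mathbb R$ be $C^\infty$ with $F\neq 0$ everywhere on $J$. Consider the evolution equation $$u_t=F(t,x,u,u_x,u_{xx})\,u_{xxx}+G(t,x,u,u_x,u_{xx}),\qquad (t,x,u,u_x,u_{xx})\in J. \tag{E}$$ Let $\Omega\subseteq\mathbb R^3$ be the image of $J$ under $(t,x,u,u_x,u_{xx})\mapsto(t,x,u)$, and let $\mathsf A$ be a real Lie algebra of $C^\infty$ vector fields $\tau\partial_t+\xi\partial_x+\eta\partial_u$ on $\Omega$ (with $\tau,\xi,\eta$ functions of $(t,x,u)$) such that no nonzero element of $\mathsf A$ vanishes identically on a nonempty open subset of $\Omega$ (i.e. linearly independent elements remain linearly independent on every nonempty open subset). Suppose that every element of $\mathsf A$ is a Lie point symmetry of (E): its third prolongation applied to $u_t-Fu_{xxx}-G$ vanishes wherever $u_t=Fu_{xxx}+G$. Suppose moreover that one of the following holds: 1. $\mathsf A$ is solvable, $\dim\mathsf A=3$, and $\mathsf A$ has rank one, i.e. at each point of $\Omega$ the values of the elements of $\mathsf A$ span a space of dimension at most one; 2. $\mathsf A$ is abelian and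 $\dim\mathsf A\ge 4$ (possibly infinite). Then (E) is linearizable at generic points by an admissible equivalence transformation: there is an open dense subset $J_0$ of $J$ such that every point $j\in J_0$ has an open neighbourhood $N\subseteq J$, lying over an open set $W\subseteq\mathbb R^3$ of points $(t,x,u)$, for which there exist - a smooth injective transformation $t'=T(t)$, $x'=X(t,x,u)$, $u'=U(t,x,u)$ on $W$ with $T'\neq0$ and $X_xU_u-X_uU_x\neq0$ on $W$, and with $X_x+u_xX_u\neq0$ on $N$, and - smooth functions $f_1,\dots,f_5$ of $(t',x')$, with $f_1\ne0$, on the set of values $(t',x')$ taken on $W$, such that the transformation takes (E) on $N$ to the linear equation $$u'_{t'}=f_1u'_{x'x'x'}+f_2u'_{x'x'}+f_3u'_{x'}+f_4u'+f_5 .$$ That is: whenever $(t,x,u,u_x,u_{xx})$ computed from a smooth function $u(t,x)$ at a point lies in $N$, and $u'(t',x')$ is a smooth function whose graph is locally the image of the graph of $u$, the function $u$ satisfies (E) at that point if and only if $u'$ satisfies the linear equation at the image point. -/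

import Mathlib

open scoped ContDiff Topology

namespace EvolEq

/-- The independent variables `(t, x)`. -/
abbrev Base := ℝ × ℝ

/-- The space of independent and dependent variables `(t, x, u)`. -/
abbrev Total := ℝ × ℝ × ℝ

/-- The space of the arguments `(t, x, u, u_x, u_xx)` of the coefficients of the equation. -/
abbrev Jet := ℝ × ℝ × ℝ × ℝ × ℝ

/-- The projection `(t, x, u, u_x, u_xx) ↦ (t, x, u)`. -/
def toTotal (j : Jet) : Total := (j.1, j.2.1, j.2.2.1)

/-- The partial derivative with respect to `t` of a function of `(t, x)`. -/
noncomputable def Dt (f : Base → ℝ) : Base → ℝ := fun p => deriv (fun s => f (s, p.2)) p.1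

/-- The partial derivative with respect to `x` of a function of `(t, x)`. -/
noncomputable def Dx (f : Base → ℝ) : Base → ℝ := fun p => deriv (fun y => f (p.1, y)) p.2

/-- The point `(t, x, u(t, x))` of the graph of `u`. -/
def graphPt (u : Base → ℝ) (p : Base) : Total := (p.1, p.2, u p)

/-- The point `(t, x, u, u_x, u_xx)` determined by the function `u` at `p = (t, x)`. -/
noncomputable def jet (u : Base → ℝ) (p : Base) : Jet :=
  (p.1, p.2, u p, Dx u p, Dx (Dx u) p)

/-- The function `u` satisfies `u_t = F(t,x,u,u_x,u_xx) u_xxx + G(t,x,u,u_x,u_xx)` at the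
point `p`. -/
def SolvesAt (F G : Jet → ℝ) (u : Base → ℝ) (p : Base) : Prop :=
  Dt u p = F (jet u p) * Dx (Dx (Dx u)) p + G (jet u p)

/-- The characteristic `Q = η - τ u_t - ξ u_x`, evaluated along `u`, of the vector field
`V = τ ∂_t + ξ ∂_x + η ∂_u`. -/
noncomputable def characteristic (V : Total → Total) (u : Base → ℝ) : Base → ℝ := fun p =>
  (V (graphPt u p)).2.2 - (V (graphPt u p)).1 * Dt u p - (V (graphPt u p)).2.1 * Dx u p

/-- The coefficient of `∂_{u_t}` in the prolongation of `V`, evaluated along `u`: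
`D_t Q + τ u_tt + ξ u_xt`. -/
noncomputable def prolongT (V : Total → Total) (u : Base → ℝ) (p : Base) : ℝ :=
  Dt (characteristic V u) p + (V (graphPt u p)).1 * Dt (Dt u) p
    + (V (graphPt u p)).2.1 * Dx (Dt u) p

/-- The coefficient of `∂_{u_{x…x}}` (`k` times `x`) in the prolongation of `V`, evaluated
along `u`: `D_x^k Q + τ D_t D_x^k u + ξ D_x^{k+1} u`. -/
noncomputable def prolongX (k : ℕ) (V : Total → Total) (u : Base → ℝ) (p : Base) : ℝ :=
  Dx^[k] (characteristic V u) p + (V (graphPt u p)).1 * Dt (Dx^[k] u) p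
    + (V (graphPt u p)).2.1 * Dx^[k + 1] u p

/-- The components of the prolonged vector field in the directions `t, x, u, u_x, u_xx`,
evaluated along `u`. -/
noncomputable def prolongJet (V : Total → Total) (u : Base → ℝ) (p : Base) : Jet :=
  ((V (graphPt u p)).1, (V (graphPt u p)).2.1, (V (graphPt u p)).2.2,
    prolongX 1 V u p, prolongX 2 V u p)

/-- `V` is (the generator of) a Lie point symmetry of `u_t = F u_xxx + G`, where `F`, `G` are
defined on `J`: the third prolongation of `V` applied to `u_t - F u_xxx - G` vanishes at all
points of the third-order jet space that satisfy the equation.  Every point of the jet space is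
the jet of some smooth function `u` at some point `p`. -/
def IsPointSymmetry (J : Set Jet) (F G : Jet → ℝ) (V : Total → Total) : Prop :=
  ∀ (u : Base → ℝ) (p : Base), ContDiff ℝ ∞ u → jet u p ∈ J → SolvesAt F G u p →
    prolongT V u p - F (jet u p) * prolongX 3 V u p
      - fderiv ℝ F (jet u p) (prolongJet V u p) * Dx (Dx (Dx u)) p
      - fderiv ℝ G (jet u p) (prolongJet V u p) = 0

/-- `ρ` realizes the Lie algebra `L` by smooth vector fields on the open set `Ω`.  The
realization is required to be faithful on every nonempty open subset of `Ω`: vector fields that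
are linearly independent stay so under restriction. -/
structure IsRealization {L : Type*} [LieRing L] [LieAlgebra ℝ L] (Ω : Set Total)
    (ρ : L →ₗ[ℝ] (Total → Total)) : Prop where
  smooth : ∀ e, ContDiffOn ℝ ∞ (ρ e) Ω
  bracket : ∀ e f, ∀ q ∈ Ω, ρ ⁅e, f⁆ q = VectorField.lieBracket ℝ (ρ e) (ρ f) q
  faithful : ∀ W ⊆ Ω, IsOpen W → W.Nonempty → ∀ e, (∀ q ∈ W, ρ e q = 0) → e = 0

/-- The rank at the point `q` of a linear family of vector fields: the dimension of the space of
its values at `q`. -/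
noncomputable def rankAt {L : Type*} [LieRing L] [LieAlgebra ℝ L]
    (ρ : L →ₗ[ℝ] (Total → Total)) (q : Total) : ℕ :=
  Module.finrank ℝ (Submodule.span ℝ (Set.range fun e => ρ e q))

/-- The family has rank one on `Ω`: its values span a line at every point where they do not all
vanish. -/
def IsRankOne {L : Type*} [LieRing L] [LieAlgebra ℝ L] (Ω : Set Total)
    (ρ : L →ₗ[ℝ] (Total → Total)) : Prop :=
  ∀ q ∈ Ω, rankAt ρ q ≤ 1

/-- The Jacobian `X_x U_u - X_u U_x`. -/
noncomputable def jacobian (X U : Total → ℝ) (q : Total) : ℝ :=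
  fderiv ℝ X q (0, 1, 0) * fderiv ℝ U q (0, 0, 1)
    - fderiv ℝ X q (0, 0, 1) * fderiv ℝ U q (0, 1, 0)

/-- `(t, x, u) ↦ (T(t), X(t,x,u), U(t,x,u))` is an admissible equivalence transformation on the
open set `W`: it is smooth and one-to-one there, and `T'` and `X_x U_u - X_u U_x` have no
zeros. -/
structure IsEquivalence (W : Set Total) (T : ℝ → ℝ) (X U : Total → ℝ) : Prop where
  isOpen : IsOpen W
  smoothT : ContDiffOn ℝ ∞ T (Prod.fst '' W)
  smoothX : ContDiffOn ℝ ∞ X W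
  smoothU : ContDiffOn ℝ ∞ U W
  derivT : ∀ q ∈ W, deriv T q.1 ≠ 0
  jac : ∀ q ∈ W, jacobian X U q ≠ 0
  inj : Set.InjOn (fun q : Total => (T q.1, X q, U q)) W

/-- The transformation maps the graph of `u`, near the point of the graph over `p`, into the
graph of `v`. -/
def MapsGraph (T : ℝ → ℝ) (X U : Total → ℝ) (u v : Base → ℝ) (p : Base) : Prop :=
  ∀ᶠ q in 𝓝 p, v (T q.1, X (graphPt u q)) = U (graphPt u q)

/-- The function `v` satisfies the linear equation
`v_t = f₁ v_xxx + f₂ v_xx + f₃ v_x + f₄ v + f₅`, with coefficients depending on `(t, x)`, at the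
point `p`. -/
def SolvesLinearAt (f₁ f₂ f₃ f₄ f₅ : Base → ℝ) (v : Base → ℝ) (p : Base) : Prop :=
  Dt v p = f₁ p * Dx (Dx (Dx v)) p + f₂ p * Dx (Dx v) p + f₃ p * Dx v p + f₄ p * v p + f₅ p

/-- The equation `u_t = F u_xxx + G` on `J` is linearizable near the point `j` of `J`: there are
an admissible equivalence transformation `(T, X, U)` on an open set `W` and an open neighbourhood
`N ⊆ J` of `j` lying over `W`, on which `X_x + u_x X_u ≠ 0` (so that graphs with jets in `N` are
mapped to graphs), and a linear equation with smooth coefficients, such that the equation holds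
for `u` at `p` if and only if the linear equation holds for the transformed function `v` at the
transformed point, for all smooth `u` with jet in `N`. -/
def LinearizableAt (J : Set Jet) (F G : Jet → ℝ) (j : Jet) : Prop :=
  ∃ (W : Set Total) (T : ℝ → ℝ) (X U : Total → ℝ) (N : Set Jet) (f₁ f₂ f₃ f₄ f₅ : Base → ℝ)
    (D : Set Base),
    IsEquivalence W T X U ∧
    IsOpen N ∧ j ∈ N ∧ N ⊆ J ∧ Set.MapsTo toTotal N W ∧
    (∀ i ∈ N, fderiv ℝ X (toTotal i) (0, 1, 0)
      + i.2.2.2.1 * fderiv ℝ X (toTotal i) (0, 0, 1) ≠ 0) ∧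
    D = (fun q : Total => (T q.1, X q)) '' W ∧
    ContDiffOn ℝ ∞ f₁ D ∧ ContDiffOn ℝ ∞ f₂ D ∧ ContDiffOn ℝ ∞ f₃ D ∧ ContDiffOn ℝ ∞ f₄ D ∧
    ContDiffOn ℝ ∞ f₅ D ∧ (∀ q ∈ D, f₁ q ≠ 0) ∧
    ∀ (u v : Base → ℝ) (p : Base), jet u p ∈ N → ContDiffAt ℝ ∞ u p →
      ContDiffAt ℝ ∞ v (T p.1, X (graphPt u p)) → MapsGraph T X U u v p →
      (SolvesAt F G u p ↔ SolvesLinearAt f₁ f₂ f₃ f₄ f₅ v (T p.1, X (graphPt u p)))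

end EvolEq

/-! Everything comes down to finding three linearly independent vertical symmetries (no `∂_t` part)
that are pointwise proportional, `e₂ = h e₁` and `e₃ = f e₁`, with `[e₁, e₂] = 0` and `[e₁, e₃] = a
e₁`. Then `e₁ h = 0` and `e₁ f = a`. Taking `X = h` and a function `U` with `e₁ U = 1` as new
coordinates turns the three fields into `∂_U`, `X ∂_U` and `(a U + k(t, X)) ∂_U`
(`exists_straightening`).

For an equation with these symmetries (`linear_of_isAffineSymmetry`), the first two make `F` and `G`
independent of `U` and `U_X`. Write `q = U_XX` and `M = a q + k_XX`. The third symmetry says `F_q M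
= 0` and `G_q M = a G + k_t - F k_XXX`. Where `M ≠ 0`, this gives `F_q = 0`, and differentiating the
second relation gives `G_qq = 0`, so the equation is linear. If `M` vanishes identically, then `a =
0`, `k_XX = 0` and `k_t = 0`, so `k = β X + γ` and `e₃ = β e₂ + γ e₁`, against independence.

Two facts about symmetries make such a triple available. The `t`-component depends on `t` only
(`fderiv_fst_eq_zero_of_isPointSymmetry`). A symmetry that is a combination of other symmetries,
pointwise independent, with coefficients depending on `t` only has constant coefficients
(`deriv_coeff_eq_zero_of_isPointSymmetry`). Thus independence over the constants upgrades to
independence over functions of `t`; in particular `h` above is not a function of `t` alone, so it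
can serve as the new `x`.

In the solvable rank-one case all fields are therefore vertical, and the last nonzero derived ideal
supplies the commutators up to one structure constant, which `structure_constant_eq_zero` removes.
In the abelian case the `t`-components are locally constant multiples of one of them, which leaves
at least three independent vertical fields. If two of these were pointwise independent somewhere,
any other vertical field would be a combination of them whose coefficients are invariant under both,
hence functions of `t`, hence constants, which contradicts the dimension; so vertical fields are
proportional.

These arguments find one linearizable point in any nonempty open part of `J`. Since linearizability
is an open condition, this gives a dense open set. -/

open scoped ContDiff Topology

namespace EvolEq

/-! ### Partial derivatives of functions of `(t, x)` -/

section PartialDerivatives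

variable {f g : Base → ℝ} {p : Base}

theorem hasDerivAt_slice_snd {E : Type*} [NormedAddCommGroup E] [NormedSpace ℝ E] {f : Base → E}
    (hf : DifferentiableAt ℝ f p) :
    HasDerivAt (fun y => f (p.1, y)) (fderiv ℝ f p (0, 1)) p.2 := by
  have h : HasDerivAt (fun y : ℝ => ((p.1, y) : Base)) (0, 1) p.2 :=
    (hasDerivAt_const _ _).prodMk (hasDerivAt_id _)
  exact HasFDerivAt.comp_hasDerivAt (x := p.2) (f := fun y : ℝ => ((p.1, y) : Base))
    (l := f) hf.hasFDerivAt h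

theorem hasDerivAt_slice_fst {E : Type*} [NormedAddCommGroup E] [NormedSpace ℝ E] {f : Base → E}
    (hf : DifferentiableAt ℝ f p) :
    HasDerivAt (fun s => f (s, p.2)) (fderiv ℝ f p (1, 0)) p.1 := by
  have h : HasDerivAt (fun s : ℝ => ((s, p.2) : Base)) (1, 0) p.1 :=
    (hasDerivAt_id _).prodMk (hasDerivAt_const _ _)
  exact HasFDerivAt.comp_hasDerivAt (x := p.1) (f := fun s : ℝ => ((s, p.2) : Base))
    (l := f) hf.hasFDerivAt h

theorem Dx_eq_fderiv (hf : DifferentiableAt ℝ f p) : Dx f p = fderiv ℝ f p (0, 1) :=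
  (hasDerivAt_slice_snd hf).deriv

theorem Dt_eq_fderiv (hf : DifferentiableAt ℝ f p) : Dt f p = fderiv ℝ f p (1, 0) :=
  (hasDerivAt_slice_fst hf).deriv

theorem _root_.ContDiffAt.diff {E E' : Type*} [NormedAddCommGroup E] [NormedSpace ℝ E]
    [NormedAddCommGroup E'] [NormedSpace ℝ E'] {f : E → E'} {p : E} (hf : ContDiffAt ℝ ∞ f p) :
    DifferentiableAt ℝ f p :=
  hf.differentiableAt (by simp)

theorem _root_.ContDiffAt.eventually_diff {E E' : Type*} [NormedAddCommGroup E]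
    [NormedSpace ℝ E] [NormedAddCommGroup E'] [NormedSpace ℝ E'] {f : E → E'} {p : E}
    (hf : ContDiffAt ℝ ∞ f p) : ∀ᶠ q in 𝓝 p, DifferentiableAt ℝ f q := by
  have h1 : ContDiffAt ℝ 1 f p := hf.of_le (by exact_mod_cast le_top)
  filter_upwards [h1.eventually (by simp)] with q hq using hq.differentiableAt (by simp)

theorem _root_.ContDiffAt.fderiv_infty {E E' : Type*} [NormedAddCommGroup E]
    [NormedSpace ℝ E] [NormedAddCommGroup E'] [NormedSpace ℝ E'] {f : E → E'} {p : E}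
    (hf : ContDiffAt ℝ ∞ f p) : ContDiffAt ℝ ∞ (fderiv ℝ f) p :=
  hf.fderiv_right (by simp)

theorem Dx_eventuallyEq (hf : ContDiffAt ℝ ∞ f p) :
    Dx f =ᶠ[𝓝 p] fun q => fderiv ℝ f q (0, 1) := by
  filter_upwards [hf.eventually_diff] with q hq using Dx_eq_fderiv hq

theorem Dt_eventuallyEq (hf : ContDiffAt ℝ ∞ f p) :
    Dt f =ᶠ[𝓝 p] fun q => fderiv ℝ f q (1, 0) := by
  filter_upwards [hf.eventually_diff] with q hq using Dt_eq_fderiv hq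

theorem _root_.ContDiffAt.Dx (hf : ContDiffAt ℝ ∞ f p) : ContDiffAt ℝ ∞ (Dx f) p :=
  (hf.fderiv_infty.clm_apply contDiffAt_const).congr_of_eventuallyEq (Dx_eventuallyEq hf)

theorem _root_.ContDiffAt.Dt (hf : ContDiffAt ℝ ∞ f p) : ContDiffAt ℝ ∞ (Dt f) p :=
  (hf.fderiv_infty.clm_apply contDiffAt_const).congr_of_eventuallyEq (Dt_eventuallyEq hf)

theorem hasDerivAt_Dx (hf : ContDiffAt ℝ ∞ f p) :
    HasDerivAt (fun y => f (p.1, y)) (Dx f p) p.2 := by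
  rw [Dx_eq_fderiv hf.diff]; exact hasDerivAt_slice_snd hf.diff

theorem hasDerivAt_Dt (hf : ContDiffAt ℝ ∞ f p) :
    HasDerivAt (fun s => f (s, p.2)) (Dt f p) p.1 := by
  rw [Dt_eq_fderiv hf.diff]; exact hasDerivAt_slice_fst hf.diff

theorem Dx_congr (h : f =ᶠ[𝓝 p] g) : Dx f p = Dx g p := by
  refine Filter.EventuallyEq.deriv_eq ?_
  have : Filter.Tendsto (fun y : ℝ => ((p.1, y) : Base)) (𝓝 p.2) (𝓝 p) := by
    have : Continuous (fun y : ℝ => ((p.1, y) : Base)) := by fun_prop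
    exact this.tendsto p.2
  exact this.eventually h

theorem Dt_congr (h : f =ᶠ[𝓝 p] g) : Dt f p = Dt g p := by
  refine Filter.EventuallyEq.deriv_eq ?_
  have : Filter.Tendsto (fun s : ℝ => ((s, p.2) : Base)) (𝓝 p.1) (𝓝 p) := by
    have : Continuous (fun s : ℝ => ((s, p.2) : Base)) := by fun_prop
    exact this.tendsto p.1
  exact this.eventually h

theorem Dx_congr_nhds (h : f =ᶠ[𝓝 p] g) : Dx f =ᶠ[𝓝 p] Dx g := by
  filter_upwards [h.eventuallyEq_nhds] with q hq using Dx_congr hq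

theorem iterate_Dx_congr_nhds (h : f =ᶠ[𝓝 p] g) (k : ℕ) : Dx^[k] f =ᶠ[𝓝 p] Dx^[k] g := by
  induction k with
  | zero => exact h
  | succ k ih =>
    simp only [Function.iterate_succ_apply']
    exact Dx_congr_nhds ih

theorem _root_.ContDiffAt.iterate_Dx (hf : ContDiffAt ℝ ∞ f p) (k : ℕ) :
    ContDiffAt ℝ ∞ (EvolEq.Dx^[k] f) p := by
  induction k with
  | zero => exact hf
  | succ k ih =>
    simp only [Function.iterate_succ_apply']
    exact ih.Dx

theorem fderiv_clm_apply_const {E : Type*} [NormedAddCommGroup E] [NormedSpace ℝ E]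
    {f : E → ℝ} {p : E} (hf : ContDiffAt ℝ ∞ f p) (v w : E) :
    fderiv ℝ (fun q => fderiv ℝ f q v) p w = fderiv ℝ (fderiv ℝ f) p w v := by
  rw [fderiv_clm_apply hf.fderiv_infty.diff (differentiableAt_const _)]
  simp

theorem fderiv_fderiv_symm {E : Type*} [NormedAddCommGroup E] [NormedSpace ℝ E]
    {f : E → ℝ} {p : E} (hf : ContDiffAt ℝ ∞ f p) (v w : E) :
    fderiv ℝ (fderiv ℝ f) p v w = fderiv ℝ (fderiv ℝ f) p w v :=
  (hf.isSymmSndFDerivAt (by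
    simp only [minSmoothness_of_isRCLikeNormedField]
    exact WithTop.coe_le_coe.2 le_top)).eq v w

theorem Dt_Dx_comm (hf : ContDiffAt ℝ ∞ f p) : Dt (Dx f) p = Dx (Dt f) p := by
  rw [Dt_congr (Dx_eventuallyEq hf), Dx_congr (Dt_eventuallyEq hf), Dt_eq_fderiv, Dx_eq_fderiv,
    fderiv_clm_apply_const hf, fderiv_clm_apply_const hf, fderiv_fderiv_symm hf]
  · exact (hf.fderiv_infty.clm_apply contDiffAt_const).diff
  · exact (hf.fderiv_infty.clm_apply contDiffAt_const).diff

end PartialDerivatives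

/-! ### Local calculus in normed spaces -/

/-- The restriction to the segment from `z` to `z'` has zero derivative. Only the direction `z' - z`
matters, so the lemma also serves to show that a function does not depend on some of its variables.
-/
theorem eq_of_fderiv_sub_eq_zero {E : Type*} [NormedAddCommGroup E] [NormedSpace ℝ E]
    {g : E → ℝ} {B : Set E} (hB : Convex ℝ B) (hg : ∀ y ∈ B, DifferentiableAt ℝ g y) {z z' : E}
    (hz : z ∈ B) (hz' : z' ∈ B) (h : ∀ y ∈ B, fderiv ℝ g y (z' - z) = 0) : g z' = g z := by
  have hmem : ∀ s ∈ Set.Icc (0 : ℝ) 1, z + s • (z' - z) ∈ B := fun s hs =>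
    hB.add_smul_sub_mem hz hz' hs
  have hd : ∀ s ∈ Set.Icc (0 : ℝ) 1,
      HasDerivAt (fun s : ℝ => g (z + s • (z' - z))) 0 s := by
    intro s hs
    have h1 : HasDerivAt (fun s : ℝ => z + s • (z' - z)) (z' - z) s := by
      simpa using ((hasDerivAt_id s).smul_const (z' - z)).const_add z
    have h2 := HasFDerivAt.comp_hasDerivAt (f := fun s : ℝ => z + s • (z' - z)) (l := g) s
      (hg _ (hmem s hs)).hasFDerivAt h1
    rwa [h _ (hmem s hs)] at h2
  have := constant_of_has_deriv_right_zero (f := fun s : ℝ => g (z + s • (z' - z)))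
    (a := 0) (b := 1) (fun s hs => (hd s hs).continuousAt.continuousWithinAt)
    (fun s hs => (hd s ⟨hs.1, hs.2.le⟩).hasDerivWithinAt) 1 (by simp)
  simpa using this

/-- This is the inverse function theorem. In finite dimension an injective derivative is invertible,
and as injectivity is assumed on all of `s`, the inverse is smooth on the whole target and not just
at the image of `a`. -/
theorem exists_smooth_local_inverse {E : Type*} [NormedAddCommGroup E] [NormedSpace ℝ E]
    [FiniteDimensional ℝ E] {f : E → E} {s : Set E} (hs : IsOpen s) (hf : ContDiffOn ℝ ∞ f s)
    (hinj : ∀ x ∈ s, ∀ v, fderiv ℝ f x v = 0 → v = 0) {a : E} (ha : a ∈ s) :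
    ∃ e : OpenPartialHomeomorph E E, a ∈ e.source ∧ e.source ⊆ s ∧ (∀ x, e x = f x) ∧
      ContDiffOn ℝ ∞ e.symm e.target := by
  have : CompleteSpace E := FiniteDimensional.complete ℝ E
  have hfa : ∀ x ∈ s, ContDiffAt ℝ ∞ f x := fun x hx => hf.contDiffAt (hs.mem_nhds hx)
  have key : ∀ x ∈ s, ∃ f' : E ≃L[ℝ] E, HasFDerivAt f (f' : E →L[ℝ] E) x := by
    intro x hx
    have hi : Function.Injective (fderiv ℝ f x) :=
      (injective_iff_map_eq_zero _).2 (hinj x hx)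
    let l : E ≃ₗ[ℝ] E := LinearEquiv.ofInjectiveEndo (fderiv ℝ f x : E →ₗ[ℝ] E) hi
    refine ⟨l.toContinuousLinearEquiv, ?_⟩
    have : (l.toContinuousLinearEquiv : E →L[ℝ] E) = fderiv ℝ f x := by
      ext v; rfl
    rw [this]
    exact (hfa x hx).diff.hasFDerivAt
  obtain ⟨f', hf'⟩ := key a ha
  let e := (hfa a ha).toOpenPartialHomeomorph f hf' (by simp)
  have hae : a ∈ e.source := (hfa a ha).mem_toOpenPartialHomeomorph_source hf' (by simp)
  have he : ∀ x, e x = f x := fun x => rfl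
  refine ⟨e.restrOpen s hs, ⟨hae, ha⟩, fun x hx => hx.2, fun x => rfl, ?_⟩
  intro y hy
  have hy1 : y ∈ e.target := hy.1
  have hy2 : e.symm y ∈ s := by simpa using hy.2
  obtain ⟨g', hg'⟩ := key _ hy2
  have h1 : ContDiffAt ℝ ∞ e (e.symm y) := hfa _ hy2
  have h2 : HasFDerivAt e (g' : E →L[ℝ] E) (e.symm y) := hg'
  exact (e.contDiffAt_symm hy1 h2 h1).contDiffWithinAt

/-- Near `e.symm z` one has `A = (A ∘ e.symm) ∘ f`, so the chain rule rewrites derivatives of `A` as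
derivatives of its expression in the coordinates `f`. -/
theorem fderiv_comp_symm {E : Type*} [NormedAddCommGroup E] [NormedSpace ℝ E]
    {e : OpenPartialHomeomorph E E} {f : E → E} (hef : ∀ x, e x = f x)
    (hes : ContDiffOn ℝ ∞ e.symm e.target) {A : E → ℝ} {z : E} (hz : z ∈ e.target)
    (hf : DifferentiableAt ℝ f (e.symm z)) (hA : DifferentiableAt ℝ A (e.symm z)) (w : E) :
    fderiv ℝ (fun z => A (e.symm z)) z (fderiv ℝ f (e.symm z) w) = fderiv ℝ A (e.symm z) w := by
  have hfz : f (e.symm z) = z := by rw [← hef, e.right_inv hz]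
  have h1 : A =ᶠ[𝓝 (e.symm z)] (fun z => A (e.symm z)) ∘ f := by
    filter_upwards [e.open_source.mem_nhds (e.map_target hz)] with i hi
    simp only [Function.comp_apply]
    rw [← hef, e.left_inv hi]
  have hs : DifferentiableAt ℝ e.symm z := (hes.contDiffAt (e.open_target.mem_nhds hz)).diff
  have hd : DifferentiableAt ℝ (fun z => A (e.symm z)) (f (e.symm z)) := by
    rw [hfz]
    exact DifferentiableAt.comp (g := A) (f := e.symm) z hA hs
  rw [h1.fderiv_eq, fderiv_comp _ hd hf, hfz]
  rfl

end EvolEq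
-- Smooth primitives with respect to one coordinate.
namespace EvolEq

/-- A smooth function of `(t, x, y)` has, locally, a smooth primitive with respect to `y`. -/
theorem exists_smooth_primitive {b : ℝ × ℝ × ℝ → ℝ} {s : Set (ℝ × ℝ × ℝ)} (hs : IsOpen s)
    (hb : ContDiffOn ℝ ∞ b s) {z₀ : ℝ × ℝ × ℝ} (hz₀ : z₀ ∈ s) :
    ∃ (P : ℝ × ℝ × ℝ → ℝ) (s' : Set (ℝ × ℝ × ℝ)), IsOpen s' ∧ z₀ ∈ s' ∧ s' ⊆ s ∧
      ContDiff ℝ ∞ P ∧ ∀ z ∈ s', fderiv ℝ P z (0, 0, 1) = b z := by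
  obtain ⟨r, hr, hrs⟩ := Metric.nhds_basis_closedBall.mem_iff.1 (hs.mem_nhds hz₀)
  -- Cutting off `b` makes it smooth on the whole space with compact support in the last variable,
  -- so that it can be integrated from `-∞`.
  let χ : ContDiffBump z₀ := ⟨r / 2, r, by positivity, by linarith⟩
  let g : ℝ × ℝ × ℝ → ℝ := fun z => χ z * b z
  have hg : ContDiff ℝ ∞ g := by
    rw [contDiff_iff_contDiffAt]
    intro z
    by_cases hz : z ∈ Metric.closedBall z₀ r
    · exact (χ.contDiff.contDiffAt).mul (hb.contDiffAt (hs.mem_nhds (hrs hz)))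
    · have : g =ᶠ[𝓝 z] fun _ => 0 := by
        filter_upwards [Metric.isClosed_closedBall.isOpen_compl.mem_nhds hz] with y hy
        have : χ y = 0 := χ.zero_of_le_dist (by
          have hy' : ¬ dist y z₀ ≤ r := hy
          show r ≤ dist y z₀
          linarith)
        simp [g, this]
      exact contDiffAt_const.congr_of_eventuallyEq this
  have hsupp : ∀ (p : ℝ × ℝ) (y : ℝ), y ∉ Metric.closedBall z₀.2.2 r → g (p.1, p.2, y) = 0 := by
    intro p y hy
    have : χ (p.1, p.2, y) = 0 := χ.zero_of_le_dist (by
      have hy' : ¬ dist y z₀.2.2 ≤ r := hy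
      have : dist y z₀.2.2 ≤ dist (p.1, p.2, y) z₀ := by
        rw [Prod.dist_eq, Prod.dist_eq]
        exact le_trans (le_max_right _ _) (le_max_right _ _)
      show r ≤ _
      linarith)
    simp [g, this]
  -- The primitive from `-∞` is the convolution with the Heaviside function `f`; its joint
  -- smoothness, parameters included, then follows from smoothness of convolutions with compactly
  -- supported smooth families.
  let f : ℝ → ℝ := Set.indicator (Set.Ici 0) 1
  let g' : ℝ × ℝ → ℝ → ℝ := fun p y => g (p.1, p.2, y)
  have hfl : MeasureTheory.LocallyIntegrable f MeasureTheory.volume :=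
    (MeasureTheory.locallyIntegrable_const (1 : ℝ)).indicator measurableSet_Ici
  have hconv := MeasureTheory.contDiffOn_convolution_left_with_param (𝕜 := ℝ) (μ := MeasureTheory.volume)
    (n := ⊤) (g := g')
    (ContinuousLinearMap.lsmul ℝ ℝ) (s := Set.univ) (k := Metric.closedBall z₀.2.2 r)
    isOpen_univ (isCompact_closedBall _ _) (fun p y _ hy => hsupp p y hy) hfl
    (by
      refine ContDiff.contDiffOn ?_
      have : ContDiff ℝ ∞ fun q : (ℝ × ℝ) × ℝ => g (q.1.1, q.1.2, q.2) := hg.comp (by fun_prop)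
      exact this)
  rw [Set.univ_prod_univ, contDiffOn_univ] at hconv
  let P : ℝ × ℝ × ℝ → ℝ := fun z => ∫ y in Set.Iic z.2.2, g (z.1, z.2.1, y)
  have hP : ContDiff ℝ ∞ P := by
    have h1 : ContDiff ℝ ∞ fun z : ℝ × ℝ × ℝ => (((z.1, z.2.1), z.2.2) : (ℝ × ℝ) × ℝ) := by
      fun_prop
    refine (congrArg (ContDiff ℝ ∞) (funext fun z => ?_)).mp (hconv.comp h1)
    simp only [P, Function.comp, MeasureTheory.convolution]
    rw [← MeasureTheory.integral_indicator measurableSet_Iic]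
    congr 1
    ext y
    by_cases hy : y ≤ z.2.2 <;> simp [f, g', Set.indicator, hy]
  have hcont : ∀ p : ℝ × ℝ, Continuous fun y => g (p.1, p.2, y) := fun p =>
    hg.continuous.comp (by fun_prop)
  have hint : ∀ p : ℝ × ℝ, MeasureTheory.Integrable fun y => g (p.1, p.2, y) := fun p =>
    (hcont p).integrable_of_hasCompactSupport
      (HasCompactSupport.of_support_subset_isCompact (isCompact_closedBall z₀.2.2 r) (by
        intro y hy
        by_contra h
        exact hy (hsupp p y h)))
  have hPd : ∀ z, fderiv ℝ P z (0, 0, 1) = g z := by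
    intro z
    have h1 : HasDerivAt (fun y : ℝ => ((z.1, z.2.1, y) : ℝ × ℝ × ℝ)) (0, 0, 1) z.2.2 :=
      (hasDerivAt_const _ _).prodMk ((hasDerivAt_const _ _).prodMk (hasDerivAt_id _))
    have h2 := HasFDerivAt.comp_hasDerivAt (f := fun y : ℝ => ((z.1, z.2.1, y) : ℝ × ℝ × ℝ))
      (l := P) z.2.2 (hP.contDiffAt (x := z)).diff.hasFDerivAt h1
    have h3 : HasDerivAt (fun y : ℝ => P (z.1, z.2.1, y)) (g z) z.2.2 := by
      have h4 : HasDerivAt (fun y : ℝ => P (z.1, z.2.1, 0) + ∫ y in (0 : ℝ)..y, g (z.1, z.2.1, y))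
          (g z) z.2.2 :=
        (intervalIntegral.integral_hasDerivAt_right
          ((hcont (z.1, z.2.1)).intervalIntegrable _ _)
          ((hcont (z.1, z.2.1)).stronglyMeasurableAtFilter _ _)
          (hcont (z.1, z.2.1)).continuousAt).const_add _
      refine h4.congr_of_eventuallyEq (Filter.Eventually.of_forall fun y => ?_)
      simp only [P]
      rw [← intervalIntegral.integral_Iic_sub_Iic (hint (z.1, z.2.1)).integrableOn
        (hint (z.1, z.2.1)).integrableOn]
      ring
    exact h2.unique h3
  refine ⟨P, Metric.ball z₀ (r / 2), Metric.isOpen_ball, Metric.mem_ball_self (by positivity),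
    fun z hz => hrs (Metric.ball_subset_closedBall (Metric.ball_subset_ball (by linarith) hz)),
    hP, fun z hz => ?_⟩
  rw [hPd]
  have : χ z = 1 := χ.one_of_mem_closedBall (Metric.ball_subset_closedBall hz)
  simp [g, this]

/-! ### Functions with prescribed jets -/

theorem Dx_eq_of_hasDerivAt {f g : Base → ℝ}
    (h : ∀ t x, HasDerivAt (fun y => f (t, y)) (g (t, x)) x) : Dx f = g := by
  ext p
  exact (h p.1 p.2).deriv

theorem Dt_eq_of_hasDerivAt {f g : Base → ℝ}
    (h : ∀ t x, HasDerivAt (fun s => f (s, x)) (g (t, x)) t) : Dt f = g := by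
  ext p
  exact (h p.1 p.2).deriv

/-- A cubic polynomial in `x` plus a linear term in `t` suffices. Identities valid along all
functions thus become identities on the jet space in which `u_xxx` and `u_t` are free. -/
theorem exists_jet_eq (j : Jet) (s r : ℝ) : ∃ (u : Base → ℝ) (p : Base), ContDiff ℝ ∞ u ∧
    jet u p = j ∧ Dx (Dx (Dx u)) p = s ∧ Dt u p = r := by
  obtain ⟨t₀, x₀, u₀, p₀, q₀⟩ := j
  let u : Base → ℝ := fun z => u₀ + p₀ * (z.2 - x₀) + q₀ / 2 * (z.2 - x₀) ^ 2
    + s / 6 * (z.2 - x₀) ^ 3 + r * (z.1 - t₀)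
  have hlin : ∀ x : ℝ, HasDerivAt (fun y : ℝ => y - x₀) 1 x := fun x =>
    (hasDerivAt_id x).sub_const x₀
  have h1 : Dx u = fun z => p₀ + q₀ * (z.2 - x₀) + s / 2 * (z.2 - x₀) ^ 2 := by
    refine Dx_eq_of_hasDerivAt fun t x => ?_
    have := (((((hlin x).const_mul p₀).const_add u₀).add
      (((hlin x).pow 2).const_mul (q₀ / 2))).add (((hlin x).pow 3).const_mul (s / 6))).add_const
      (r * (t - t₀))
    exact this.congr_deriv (by push_cast; ring)
  have h2 : Dx (Dx u) = fun z => q₀ + s * (z.2 - x₀) := by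
    rw [h1]
    refine Dx_eq_of_hasDerivAt fun t x => ?_
    have := (((hlin x).const_mul q₀).const_add p₀).add (((hlin x).pow 2).const_mul (s / 2))
    exact this.congr_deriv (by push_cast; ring)
  have h3 : Dx (Dx (Dx u)) = fun _ => s := by
    rw [h2]
    refine Dx_eq_of_hasDerivAt fun t x => ?_
    have := ((hlin x).const_mul s).const_add q₀
    exact this.congr_deriv (by ring)
  have h4 : Dt u = fun _ => r := by
    refine Dt_eq_of_hasDerivAt fun t x => ?_
    have := (((hasDerivAt_id t).sub_const t₀).const_mul r).const_add
      (u₀ + p₀ * (x - x₀) + q₀ / 2 * (x - x₀) ^ 2 + s / 6 * (x - x₀) ^ 3)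
    exact this.congr_deriv (by ring)
  refine ⟨u, (t₀, x₀), by fun_prop, ?_, by rw [h3], by rw [h4]⟩
  rw [jet, h2, h1]
  simp [u]

end EvolEq
namespace EvolEq

/-! ### Rules for the operators `Dx` and `Dt` -/

section Rules

variable {f g : Base → ℝ} {p : Base}

theorem Dx_add (hf : ContDiffAt ℝ ∞ f p) (hg : ContDiffAt ℝ ∞ g p) :
    Dx (fun q => f q + g q) p = Dx f p + Dx g p :=
  ((hasDerivAt_Dx hf).add (hasDerivAt_Dx hg)).deriv

theorem Dx_sub (hf : ContDiffAt ℝ ∞ f p) (hg : ContDiffAt ℝ ∞ g p) :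
    Dx (fun q => f q - g q) p = Dx f p - Dx g p :=
  ((hasDerivAt_Dx hf).sub (hasDerivAt_Dx hg)).deriv

theorem Dx_mul (hf : ContDiffAt ℝ ∞ f p) (hg : ContDiffAt ℝ ∞ g p) :
    Dx (fun q => f q * g q) p = Dx f p * g p + f p * Dx g p :=
  ((hasDerivAt_Dx hf).mul (hasDerivAt_Dx hg)).deriv

theorem Dt_add (hf : ContDiffAt ℝ ∞ f p) (hg : ContDiffAt ℝ ∞ g p) :
    Dt (fun q => f q + g q) p = Dt f p + Dt g p :=
  ((hasDerivAt_Dt hf).add (hasDerivAt_Dt hg)).deriv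

theorem Dt_sub (hf : ContDiffAt ℝ ∞ f p) (hg : ContDiffAt ℝ ∞ g p) :
    Dt (fun q => f q - g q) p = Dt f p - Dt g p :=
  ((hasDerivAt_Dt hf).sub (hasDerivAt_Dt hg)).deriv

theorem Dt_mul (hf : ContDiffAt ℝ ∞ f p) (hg : ContDiffAt ℝ ∞ g p) :
    Dt (fun q => f q * g q) p = Dt f p * g p + f p * Dt g p :=
  ((hasDerivAt_Dt hf).mul (hasDerivAt_Dt hg)).deriv

/-- A function smooth at `p` is, for every finite order, as smooth near `p`; this is the form
in which the rules above are used for higher derivatives. -/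
theorem Dx_comp {E : Type*} [NormedAddCommGroup E] [NormedSpace ℝ E] {A : E → ℝ} {γ : Base → E}
    {γ' : E} (hA : DifferentiableAt ℝ A (γ p)) (hγ : HasDerivAt (fun y => γ (p.1, y)) γ' p.2) :
    Dx (fun q => A (γ q)) p = fderiv ℝ A (γ p) γ' :=
  (HasFDerivAt.comp_hasDerivAt (x := p.2) (f := fun y => γ (p.1, y)) (l := A)
    hA.hasFDerivAt hγ).deriv

theorem Dt_comp {E : Type*} [NormedAddCommGroup E] [NormedSpace ℝ E] {A : E → ℝ} {γ : Base → E}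
    {γ' : E} (hA : DifferentiableAt ℝ A (γ p)) (hγ : HasDerivAt (fun s => γ (s, p.2)) γ' p.1) :
    Dt (fun q => A (γ q)) p = fderiv ℝ A (γ p) γ' :=
  (HasFDerivAt.comp_hasDerivAt (x := p.1) (f := fun s => γ (s, p.2)) (l := A)
    hA.hasFDerivAt hγ).deriv

theorem eventually_Dx_add (hf : ContDiffAt ℝ ∞ f p) (hg : ContDiffAt ℝ ∞ g p) :
    Dx (fun q => f q + g q) =ᶠ[𝓝 p] fun q => Dx f q + Dx g q := by
  filter_upwards [hf.eventually_diff, hg.eventually_diff] with q h1 h2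
  rw [Dx_eq_fderiv h1, Dx_eq_fderiv h2]
  exact ((hasDerivAt_slice_snd h1).add (hasDerivAt_slice_snd h2)).deriv

theorem eventually_Dx_sub (hf : ContDiffAt ℝ ∞ f p) (hg : ContDiffAt ℝ ∞ g p) :
    Dx (fun q => f q - g q) =ᶠ[𝓝 p] fun q => Dx f q - Dx g q := by
  filter_upwards [hf.eventually_diff, hg.eventually_diff] with q h1 h2
  rw [Dx_eq_fderiv h1, Dx_eq_fderiv h2]
  exact ((hasDerivAt_slice_snd h1).sub (hasDerivAt_slice_snd h2)).deriv

theorem eventually_Dx_mul (hf : ContDiffAt ℝ ∞ f p) (hg : ContDiffAt ℝ ∞ g p) :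
    Dx (fun q => f q * g q) =ᶠ[𝓝 p] fun q => Dx f q * g q + f q * Dx g q := by
  filter_upwards [hf.eventually_diff, hg.eventually_diff] with q h1 h2
  rw [Dx_eq_fderiv h1, Dx_eq_fderiv h2]
  exact ((hasDerivAt_slice_snd h1).mul (hasDerivAt_slice_snd h2)).deriv

theorem iterate_Dx_add (hf : ContDiffAt ℝ ∞ f p) (hg : ContDiffAt ℝ ∞ g p) (k : ℕ) :
    Dx^[k] (fun q => f q + g q) =ᶠ[𝓝 p] fun q => Dx^[k] f q + Dx^[k] g q := by
  induction k with
  | zero => exact Filter.EventuallyEq.rfl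
  | succ k ih =>
    simp only [Function.iterate_succ_apply']
    exact (Dx_congr_nhds ih).trans (eventually_Dx_add (hf.iterate_Dx k) (hg.iterate_Dx k))

theorem iterate_Dx_sub (hf : ContDiffAt ℝ ∞ f p) (hg : ContDiffAt ℝ ∞ g p) (k : ℕ) :
    Dx^[k] (fun q => f q - g q) =ᶠ[𝓝 p] fun q => Dx^[k] f q - Dx^[k] g q := by
  induction k with
  | zero => exact Filter.EventuallyEq.rfl
  | succ k ih =>
    simp only [Function.iterate_succ_apply']
    exact (Dx_congr_nhds ih).trans (eventually_Dx_sub (hf.iterate_Dx k) (hg.iterate_Dx k))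

/-- A factor that does not depend on `x` commutes with `Dx`. -/
theorem iterate_Dx_mul_of_Dx_eq_zero (hf : ContDiffAt ℝ ∞ f p) (hg : ContDiffAt ℝ ∞ g p)
    (h : ∀ᶠ q in 𝓝 p, Dx f q = 0) (k : ℕ) :
    Dx^[k] (fun q => f q * g q) =ᶠ[𝓝 p] fun q => f q * Dx^[k] g q := by
  induction k with
  | zero => exact Filter.EventuallyEq.rfl
  | succ k ih =>
    simp only [Function.iterate_succ_apply']
    refine (Dx_congr_nhds ih).trans ((eventually_Dx_mul hf (hg.iterate_Dx k)).trans ?_)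
    filter_upwards [h] with q hq
    rw [hq]
    ring

end Rules

/-! ### Graphs, jets and characteristics -/

section Jets

variable {u : Base → ℝ} {p : Base} {V : Total → Total}

theorem _root_.ContDiffAt.graphPt (hu : ContDiffAt ℝ ∞ u p) :
    ContDiffAt ℝ ∞ (EvolEq.graphPt u) p :=
  contDiffAt_fst.prodMk (contDiffAt_snd.prodMk hu)

theorem _root_.ContDiffAt.jet (hu : ContDiffAt ℝ ∞ u p) : ContDiffAt ℝ ∞ (EvolEq.jet u) p :=
  contDiffAt_fst.prodMk (contDiffAt_snd.prodMk (hu.prodMk (hu.Dx.prodMk hu.Dx.Dx)))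

theorem hasDerivAt_graphPt_snd (hu : ContDiffAt ℝ ∞ u p) :
    HasDerivAt (fun y => graphPt u (p.1, y)) (0, 1, Dx u p) p.2 :=
  (hasDerivAt_const _ _).prodMk ((hasDerivAt_id _).prodMk (hasDerivAt_Dx hu))

theorem hasDerivAt_graphPt_fst (hu : ContDiffAt ℝ ∞ u p) :
    HasDerivAt (fun s => graphPt u (s, p.2)) (1, 0, Dt u p) p.1 :=
  (hasDerivAt_id _).prodMk ((hasDerivAt_const _ _).prodMk (hasDerivAt_Dt hu))

theorem hasDerivAt_jet_snd (hu : ContDiffAt ℝ ∞ u p) :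
    HasDerivAt (fun y => jet u (p.1, y)) (0, 1, Dx u p, Dx (Dx u) p, Dx (Dx (Dx u)) p) p.2 :=
  (hasDerivAt_const _ _).prodMk ((hasDerivAt_id _).prodMk ((hasDerivAt_Dx hu).prodMk
    ((hasDerivAt_Dx hu.Dx).prodMk (hasDerivAt_Dx hu.Dx.Dx))))

theorem toTotal_jet (u : Base → ℝ) (p : Base) : toTotal (jet u p) = graphPt u p := rfl

theorem contDiffAt_comps (hu : ContDiffAt ℝ ∞ u p) (hV : ContDiffAt ℝ ∞ V (graphPt u p)) :
    ContDiffAt ℝ ∞ (fun q => (V (graphPt u q)).1) p ∧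
    ContDiffAt ℝ ∞ (fun q => (V (graphPt u q)).2.1) p ∧
    ContDiffAt ℝ ∞ (fun q => (V (graphPt u q)).2.2) p := by
  have h : ContDiffAt ℝ ∞ (fun q => V (graphPt u q)) p := hV.comp p hu.graphPt
  exact ⟨h.fst, h.snd.fst, h.snd.snd⟩

theorem contDiffAt_characteristic (hu : ContDiffAt ℝ ∞ u p)
    (hV : ContDiffAt ℝ ∞ V (graphPt u p)) : ContDiffAt ℝ ∞ (characteristic V u) p := by
  obtain ⟨h1, h2, h3⟩ := contDiffAt_comps hu hV
  exact (h3.sub (h1.mul hu.Dt)).sub (h2.mul hu.Dx)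

theorem isOpen_image_toTotal {J : Set Jet} (hJ : IsOpen J) : IsOpen (toTotal '' J) := by
  let l : Jet →L[ℝ] Total := (ContinuousLinearMap.fst ℝ ℝ _).prod
    (((ContinuousLinearMap.fst ℝ ℝ _).comp (ContinuousLinearMap.snd ℝ ℝ _)).prod
      ((ContinuousLinearMap.fst ℝ ℝ _).comp
        ((ContinuousLinearMap.snd ℝ ℝ _).comp (ContinuousLinearMap.snd ℝ ℝ _))))
  have hl : Function.Surjective l := fun q => ⟨(q.1, q.2.1, q.2.2, 0, 0), rfl⟩
  exact l.isOpenMap hl J hJ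

theorem contDiff_toTotal : ContDiff ℝ ∞ toTotal := by
  unfold toTotal
  fun_prop

/-- Linear independence of `1, u_t, u_x` on the fibres of an open subset of the jet space. -/
theorem eq_zero_of_characteristic_eq_zero {J : Set Jet} (hJ : IsOpen J) {j : Jet} (hj : j ∈ J)
    {w : Total}
    (h : ∀ i ∈ J, toTotal i = toTotal j → ∀ r : ℝ, w.2.2 - w.1 * r - w.2.1 * i.2.2.2.1 = 0) :
    w = 0 := by
  obtain ⟨t, x, y, a, b⟩ := j
  have h0 := h _ hj rfl 0
  have h1 := h _ hj rfl 1
  have hopen : ∀ᶠ c in 𝓝 a, ((t, x, y, c, b) : Jet) ∈ J := by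
    have : Continuous fun c : ℝ => ((t, x, y, c, b) : Jet) := by fun_prop
    exact this.continuousAt.eventually (hJ.mem_nhds hj)
  obtain ⟨c, hc, hca⟩ := ((hopen.filter_mono nhdsWithin_le_nhds).and
    (self_mem_nhdsWithin : {a}ᶜ ∈ 𝓝[≠] a)).exists
  have h2 := h _ hc rfl 0
  simp only at h0 h1 h2
  have hca' : c - a ≠ 0 := sub_ne_zero.2 hca
  have e1 : w.1 = 0 := by linarith
  have e2 : w.2.1 = 0 := by
    have : w.2.1 * (c - a) = 0 := by linarith
    exact (mul_eq_zero.1 this).resolve_right hca'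
  have e3 : w.2.2 = 0 := by
    rw [e2] at h0
    linarith
  exact Prod.ext e1 (Prod.ext e2 e3)

/-- The solutions of an equation with `F ≠ 0` can have arbitrary values of `u_t`. -/
theorem exists_solution {F G : Jet → ℝ} {j : Jet} (hF : F j ≠ 0) (r : ℝ) :
    ∃ (u : Base → ℝ) (p : Base), ContDiff ℝ ∞ u ∧ jet u p = j ∧ SolvesAt F G u p ∧
      Dt u p = r := by
  obtain ⟨u, p, hu, h1, h2, h3⟩ := exists_jet_eq j ((r - G j) / F j) r
  refine ⟨u, p, hu, h1, ?_, h3⟩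
  rw [SolvesAt, h1, h2, h3]
  field_simp
  ring

end Jets

/-! ### First consequences of the symmetry condition -/

/-- Coefficients depending on `t` only commute with `D_x`, so the symmetry condition of `V₀` is the
same combination of those of `V₁` and `V₂`, except that `D_t` also hits the coefficients. What is
left over is `α_t Q₁ + β_t Q₂`, the characteristic of the field in the conclusion. It vanishes on
solutions, whose `u_t` is arbitrary because `F ≠ 0`, so the field itself vanishes. -/
theorem deriv_coeff_eq_zero_of_isPointSymmetry {J : Set Jet} (hJ : IsOpen J) {F G : Jet → ℝ}
    (hF0 : ∀ j ∈ J, F j ≠ 0) {V₀ V₁ V₂ : Total → Total} {α β : Total → ℝ}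
    (hV₁ : ContDiffOn ℝ ∞ V₁ (toTotal '' J)) (hV₂ : ContDiffOn ℝ ∞ V₂ (toTotal '' J))
    (hα : ContDiffOn ℝ ∞ α (toTotal '' J)) (hβ : ContDiffOn ℝ ∞ β (toTotal '' J))
    (h₀ : IsPointSymmetry J F G V₀) (h₁ : IsPointSymmetry J F G V₁)
    (h₂ : IsPointSymmetry J F G V₂)
    (hV : ∀ q ∈ toTotal '' J, V₀ q = α q • V₁ q + β q • V₂ q)
    (hαx : ∀ q ∈ toTotal '' J, ∀ a b, fderiv ℝ α q (0, a, b) = 0)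
    (hβx : ∀ q ∈ toTotal '' J, ∀ a b, fderiv ℝ β q (0, a, b) = 0) :
    ∀ q ∈ toTotal '' J,
      fderiv ℝ α q (1, 0, 0) • V₁ q + fderiv ℝ β q (1, 0, 0) • V₂ q = 0 := by
  have hΩ := isOpen_image_toTotal hJ
  rintro _ ⟨j, hj, rfl⟩
  refine eq_zero_of_characteristic_eq_zero hJ hj fun i hi hij r => ?_
  obtain ⟨u, p, hu, hjet, hsol, hut⟩ := exists_solution (G := G) (hF0 i hi) r
  have hup : ContDiffAt ℝ ∞ u p := hu.contDiffAt
  have hg : graphPt u p = toTotal j := by rw [← toTotal_jet, hjet, hij]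
  have hmem : graphPt u p ∈ toTotal '' J := hg ▸ ⟨j, hj, rfl⟩
  have hnear : ∀ᶠ q in 𝓝 p, graphPt u q ∈ toTotal '' J :=
    hup.graphPt.continuousAt.eventually (hΩ.mem_nhds hmem)
  have hN := hΩ.mem_nhds hmem
  have S1 := contDiffAt_characteristic hup (hV₁.contDiffAt hN)
  have S2 := contDiffAt_characteristic hup (hV₂.contDiffAt hN)
  have diffcomp : ∀ {γ : Total → ℝ}, ContDiffOn ℝ ∞ γ (toTotal '' J) →
      (∀ q ∈ toTotal '' J, ∀ a b, fderiv ℝ γ q (0, a, b) = 0) →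
      ContDiffAt ℝ ∞ (fun q => γ (graphPt u q)) p ∧
      (∀ᶠ q in 𝓝 p, Dx (fun q => γ (graphPt u q)) q = 0) ∧
      Dt (fun q => γ (graphPt u q)) p = fderiv ℝ γ (toTotal j) (1, 0, 0) := by
    intro γ hγ hγx
    refine ⟨(hγ.contDiffAt hN).comp p hup.graphPt, ?_, ?_⟩
    · filter_upwards [hnear] with q hq
      rw [Dx_comp (hγ.contDiffAt (hΩ.mem_nhds hq)).diff (hasDerivAt_graphPt_snd hu.contDiffAt)]
      exact hγx _ hq _ _
    · rw [Dt_comp (hγ.contDiffAt hN).diff (hasDerivAt_graphPt_fst hup)]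
      have : ((1, 0, Dt u p) : Total) = (1, 0, 0) + (0, 0, Dt u p) := by simp
      rw [this, map_add, hγx _ hmem, add_zero, hg]
  obtain ⟨A1, A2, A3⟩ := diffcomp hα hαx
  obtain ⟨B1, B2, B3⟩ := diffcomp hβ hβx
  have hchar : characteristic V₀ u =ᶠ[𝓝 p] fun q => α (graphPt u q) * characteristic V₁ u q
      + β (graphPt u q) * characteristic V₂ u q := by
    filter_upwards [hnear] with q hq
    simp only [characteristic, hV _ hq]
    simp
    ring
  have hk : ∀ k : ℕ, Dx^[k] (characteristic V₀ u) p
      = α (graphPt u p) * Dx^[k] (characteristic V₁ u) p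
      + β (graphPt u p) * Dx^[k] (characteristic V₂ u) p := by
    intro k
    rw [(iterate_Dx_congr_nhds hchar k).eq_of_nhds,
      (iterate_Dx_add (A1.mul S1) (B1.mul S2) k).eq_of_nhds,
      (iterate_Dx_mul_of_Dx_eq_zero A1 S1 A2 k).eq_of_nhds,
      (iterate_Dx_mul_of_Dx_eq_zero B1 S2 B2 k).eq_of_nhds]
  have ht : Dt (characteristic V₀ u) p
      = α (graphPt u p) * Dt (characteristic V₁ u) p
      + β (graphPt u p) * Dt (characteristic V₂ u) p
      + (fderiv ℝ α (toTotal j) (1, 0, 0) * characteristic V₁ u p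
      + fderiv ℝ β (toTotal j) (1, 0, 0) * characteristic V₂ u p) := by
    rw [Dt_congr hchar, Dt_add (A1.mul S1) (B1.mul S2), Dt_mul A1 S1, Dt_mul B1 S2, A3, B3]
    ring
  have hX : ∀ k : ℕ, prolongX k V₀ u p
      = α (graphPt u p) * prolongX k V₁ u p + β (graphPt u p) * prolongX k V₂ u p := by
    intro k
    simp only [prolongX, hk, hV _ hmem]
    simp
    ring
  have hJet : prolongJet V₀ u p
      = α (graphPt u p) • prolongJet V₁ u p + β (graphPt u p) • prolongJet V₂ u p := by
    simp [prolongJet, hX, hV _ hmem]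
  have hT : prolongT V₀ u p
      = α (graphPt u p) * prolongT V₁ u p + β (graphPt u p) * prolongT V₂ u p
      + (fderiv ℝ α (toTotal j) (1, 0, 0) * characteristic V₁ u p
      + fderiv ℝ β (toTotal j) (1, 0, 0) * characteristic V₂ u p) := by
    simp only [prolongT, ht, hV _ hmem]
    simp
    ring
  have hiJ : jet u p ∈ J := hjet ▸ hi
  have E0 := h₀ u p hu hiJ hsol
  have E1 := h₁ u p hu hiJ hsol
  have E2 := h₂ u p hu hiJ hsol
  rw [hT, hX, hJet, map_add, map_add, map_smul, map_smul, map_smul, map_smul] at E0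
  simp only [smul_eq_mul] at E0
  have hfin : fderiv ℝ α (toTotal j) (1, 0, 0) * characteristic V₁ u p
      + fderiv ℝ β (toTotal j) (1, 0, 0) * characteristic V₂ u p = 0 := by
    linear_combination E0 - α (graphPt u p) * E1 - β (graphPt u p) * E2
  have hux : Dx u p = i.2.2.2.1 := by rw [← hjet]; rfl
  simp only [characteristic, hg, hut, hux] at hfin
  simp only [Prod.fst_add, Prod.snd_add, Prod.smul_fst, Prod.smul_snd, smul_eq_mul]
  linear_combination hfin

theorem Dx_slice_congr {f g : Base → ℝ} {t : ℝ} (h : ∀ y, f (t, y) = g (t, y)) (y : ℝ) :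
    Dx f (t, y) = Dx g (t, y) := by
  simp only [Dx, h]

/-- Agreement on the single line `t = const` is enough for `x`-derivatives; this allows comparing
functions that differ off that line. -/
theorem iterate_Dx_slice_congr {f g : Base → ℝ} {t : ℝ} (h : ∀ y, f (t, y) = g (t, y)) (k : ℕ) :
    ∀ y, Dx^[k] f (t, y) = Dx^[k] g (t, y) := by
  induction k with
  | zero => exact h
  | succ k ih =>
    intro y
    simp only [Function.iterate_succ_apply']
    exact Dx_slice_congr ih y

/-- The coefficient of `∂_t` in a point symmetry depends on `t` only. -/
theorem fderiv_fst_eq_zero_of_isPointSymmetry {J : Set Jet} (hJ : IsOpen J) {F G : Jet → ℝ}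
    (hF0 : ∀ j ∈ J, F j ≠ 0) {V : Total → Total} (hV : ContDiffOn ℝ ∞ V (toTotal '' J))
    (h : IsPointSymmetry J F G V) :
    ∀ q ∈ toTotal '' J, ∀ a b, fderiv ℝ (fun q => (V q).1) q (0, a, b) = 0 := by
  have hΩ := isOpen_image_toTotal hJ
  rintro _ ⟨j, hj, rfl⟩
  have hτ : ContDiffAt ℝ ∞ (fun q => (V q).1) (toTotal j) :=
    (hV.contDiffAt (hΩ.mem_nhds ⟨j, hj, rfl⟩)).fst
  have key : ∀ i ∈ J, toTotal i = toTotal j →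
      fderiv ℝ (fun q => (V q).1) (toTotal j) (0, 1, i.2.2.2.1) = 0 := by
    intro i hi hij
    obtain ⟨u, p, hu, hjet, hsol, -⟩ := exists_solution (G := G) (hF0 i hi) 0
    obtain ⟨t₀, x₀⟩ := p
    have hg : graphPt u (t₀, x₀) = toTotal j := by rw [← toTotal_jet, hjet, hij]
    have hux : Dx u (t₀, x₀) = i.2.2.2.1 := by rw [← hjet]; rfl
    have hmem : graphPt u (t₀, x₀) ∈ toTotal '' J := hg ▸ ⟨j, hj, rfl⟩
    have hup : ∀ {q}, ContDiffAt ℝ ∞ u q := hu.contDiffAt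
    have hVp : ContDiffAt ℝ ∞ V (graphPt u (t₀, x₀)) := hV.contDiffAt (hΩ.mem_nhds hmem)
    -- At `(t₀, x₀)` this perturbation keeps `u_t` and all derivatives that occur in the equation,
    -- and changes `u_txx` by `1`. In the symmetry condition `u_txx` occurs only through the third
    -- prolongation, with coefficient `-3 D_x τ`. Comparing the conditions for `u` and `w` forces `F
    -- · 3 D_x τ = 0`.
    let w : Base → ℝ := fun z => u z + (z.1 - t₀) * (z.2 - x₀) ^ 2 / 2
    have hw : ContDiff ℝ ∞ w := hu.add (by fun_prop)
    have hlin : ∀ x c : ℝ, HasDerivAt (fun y : ℝ => y - c) 1 x := fun x c =>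
      (hasDerivAt_id x).sub_const c
    have wx : Dx w = fun z => Dx u z + (z.1 - t₀) * (z.2 - x₀) :=
      Dx_eq_of_hasDerivAt fun t x => ((hasDerivAt_Dx (p := (t, x)) hup).add
        ((((hlin x x₀).pow 2).const_mul (t - t₀)).div_const 2)).congr_deriv
          (by push_cast; ring)
    have wxx : Dx (Dx w) = fun z => Dx (Dx u) z + (z.1 - t₀) := by
      rw [wx]
      exact Dx_eq_of_hasDerivAt fun t x => ((hasDerivAt_Dx (p := (t, x)) hup.Dx).add
        ((hlin x x₀).const_mul (t - t₀))).congr_deriv (by ring)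
    have wxxx : Dx (Dx (Dx w)) = Dx (Dx (Dx u)) := by
      rw [wxx]
      exact Dx_eq_of_hasDerivAt fun t x => (hasDerivAt_Dx (p := (t, x)) hup.Dx.Dx).add_const (t - t₀)
    have wt : Dt w = fun z => Dt u z + (z.2 - x₀) ^ 2 / 2 :=
      Dt_eq_of_hasDerivAt fun t x => ((hasDerivAt_Dt (p := (t, x)) hup).add
        (((hlin t t₀).mul_const ((x - x₀) ^ 2)).div_const 2)).congr_deriv (by ring)
    have wtt : Dt (Dt w) = Dt (Dt u) := by
      rw [wt]
      exact Dt_eq_of_hasDerivAt fun t x => (hasDerivAt_Dt (p := (t, x)) hup.Dt).add_const ((x - x₀) ^ 2 / 2)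
    have wtx : Dx (Dt w) = fun z => Dx (Dt u) z + (z.2 - x₀) := by
      rw [wt]
      exact Dx_eq_of_hasDerivAt fun t x => ((hasDerivAt_Dx (p := (t, x)) hup.Dt).add
        (((hlin x x₀).pow 2).div_const 2)).congr_deriv (by push_cast; ring)
    have wxt : Dt (Dx w) = fun z => Dt (Dx u) z + (z.2 - x₀) := by
      rw [wx]
      exact Dt_eq_of_hasDerivAt fun t x => ((hasDerivAt_Dt (p := (t, x)) hup.Dx).add
        ((hlin t t₀).mul_const (x - x₀))).congr_deriv (by ring)
    have wxxt : Dt (Dx (Dx w)) = fun z => Dt (Dx (Dx u)) z + 1 := by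
      rw [wxx]
      exact Dt_eq_of_hasDerivAt fun t x => ((hasDerivAt_Dt (p := (t, x)) hup.Dx.Dx).add
        (hlin t t₀)).congr_deriv (by ring)
    have hgw : ∀ y, graphPt w (t₀, y) = graphPt u (t₀, y) := fun y => by simp [graphPt, w]
    have hgw' : ∀ s, graphPt w (s, x₀) = graphPt u (s, x₀) := fun y => by simp [graphPt, w]
    have hjw : jet w (t₀, x₀) = jet u (t₀, x₀) := by
      rw [jet, wxx, wx]
      simp [jet, w]
    let g : Base → ℝ := fun q => (V (graphPt u q)).1
    have hgs : ContDiffAt ℝ ∞ g (t₀, x₀) := (contDiffAt_comps hup hVp).1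
    let m : Base → ℝ := fun q => (q.2 - x₀) ^ 2 / 2
    have hm : ContDiff ℝ ∞ m := by fun_prop
    have hmx : Dx m = fun q => q.2 - x₀ :=
      Dx_eq_of_hasDerivAt fun t x => (((hlin x x₀).pow 2).div_const 2).congr_deriv
        (by push_cast; ring)
    have hmxx : Dx (Dx m) = fun q => 1 := by
      rw [hmx]
      exact Dx_eq_of_hasDerivAt fun t x => hlin x x₀
    have hmxxx : Dx (Dx (Dx m)) = fun q => 0 := by
      rw [hmxx]
      exact Dx_eq_of_hasDerivAt fun t x => hasDerivAt_const _ _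
    have hmp : ∀ {q}, ContDiffAt ℝ ∞ m q := hm.contDiffAt
    -- On the line `t = t₀` the functions and their `x`-derivatives agree, and only `u_t` changes,
    -- by `m`.
    have hcw : ∀ y, characteristic V w (t₀, y)
        = (fun q => characteristic V u q - g q * m q) (t₀, y) := by
      intro y
      simp only [characteristic, hgw, wx, wt, g, m]
      ring
    have hcs := contDiffAt_characteristic hup hVp
    have hgm : ContDiffAt ℝ ∞ (fun q => g q * m q) (t₀, x₀) := hgs.mul hmp
    have hck : ∀ k : ℕ, Dx^[k] (characteristic V w) (t₀, x₀)
        = Dx^[k] (characteristic V u) (t₀, x₀) - Dx^[k] (fun q => g q * m q) (t₀, x₀) := by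
      intro k
      rw [iterate_Dx_slice_congr (g := fun q => characteristic V u q - g q * m q) hcw k x₀, (iterate_Dx_sub hcs hgm k).eq_of_nhds]
    have k1 : Dx (fun q => g q * m q) =ᶠ[𝓝 (t₀, x₀)] fun q => Dx g q * m q + g q * Dx m q :=
      eventually_Dx_mul hgs hmp
    have k2 : Dx (Dx (fun q => g q * m q)) =ᶠ[𝓝 (t₀, x₀)] fun q =>
        (Dx (Dx g) q * m q + Dx g q * Dx m q) + (Dx g q * Dx m q + g q * Dx (Dx m) q) := by
      refine (Dx_congr_nhds k1).trans
        ((eventually_Dx_add (hgs.Dx.mul hmp) (hgs.mul hmp.Dx)).trans ?_)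
      filter_upwards [eventually_Dx_mul hgs.Dx hmp, eventually_Dx_mul hgs hmp.Dx] with q h1 h2
      rw [h1, h2]
    have k3 : Dx (Dx (Dx (fun q => g q * m q))) (t₀, x₀) = 3 * Dx g (t₀, x₀) := by
      rw [Dx_congr k2, Dx_add ((hgs.Dx.Dx.mul hmp).add (hgs.Dx.mul hmp.Dx))
        ((hgs.Dx.mul hmp.Dx).add (hgs.mul hmp.Dx.Dx)),
        Dx_add (hgs.Dx.Dx.mul hmp) (hgs.Dx.mul hmp.Dx),
        Dx_add (hgs.Dx.mul hmp.Dx) (hgs.mul hmp.Dx.Dx),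
        Dx_mul hgs.Dx.Dx hmp, Dx_mul hgs.Dx hmp.Dx, Dx_mul hgs hmp.Dx.Dx, hmxxx, hmxx, hmx]
      simp only [m]
      ring
    have X1 : prolongX 1 V w (t₀, x₀) = prolongX 1 V u (t₀, x₀) := by
      simp only [prolongX, hck, hgw]
      simp only [Function.iterate_succ_apply', Function.iterate_zero_apply, wxx, wxt,
        k1.eq_of_nhds, hmx, m]
      ring
    have X2 : prolongX 2 V w (t₀, x₀) = prolongX 2 V u (t₀, x₀) := by
      simp only [prolongX, hck, hgw]
      simp only [Function.iterate_succ_apply', Function.iterate_zero_apply, wxxx, wxxt,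
        k2.eq_of_nhds, hmxx]
      simp only [hmx, m, g]
      ring
    have X3 : prolongX 3 V w (t₀, x₀) = prolongX 3 V u (t₀, x₀) - 3 * Dx g (t₀, x₀) := by
      simp only [prolongX, hck, hgw]
      simp only [Function.iterate_succ_apply', Function.iterate_zero_apply, wxxx, k3]
      ring
    have T1 : prolongT V w (t₀, x₀) = prolongT V u (t₀, x₀) := by
      have : Dt (characteristic V w) (t₀, x₀) = Dt (characteristic V u) (t₀, x₀) := by
        have : ∀ s, characteristic V w (s, x₀) = characteristic V u (s, x₀) := by
          intro s
          simp only [characteristic, hgw', wx, wt]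
          ring
        simp only [Dt, this]
      simp only [prolongT, hgw, wtt, wtx, this]
      ring
    have hJet : prolongJet V w (t₀, x₀) = prolongJet V u (t₀, x₀) := by
      simp only [prolongJet, hgw, X1, X2]
    have hsolw : SolvesAt F G w (t₀, x₀) := by
      rw [SolvesAt, hjw, wxxx, wt]
      rw [SolvesAt] at hsol
      simp [hsol]
    have E1 := h u _ hu (hjet ▸ hi) hsol
    have E2 := h w _ hw (hjw ▸ hjet ▸ hi) hsolw
    rw [hjw, hJet, X3, T1, wxxx] at E2
    have hFne : F (jet u (t₀, x₀)) ≠ 0 := by rw [hjet]; exact hF0 i hi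
    have hzero : Dx g (t₀, x₀) = 0 := by
      have : F (jet u (t₀, x₀)) * (3 * Dx g (t₀, x₀)) = 0 := by linear_combination E2 - E1
      simpa [hFne] using this
    have hfin : Dx g (t₀, x₀) = fderiv ℝ (fun q => (V q).1) (graphPt u (t₀, x₀))
        (0, 1, Dx u (t₀, x₀)) :=
      Dx_comp (A := fun q => (V q).1) (by rw [hg]; exact hτ.diff) (hasDerivAt_graphPt_snd hup)
    rw [← hux, ← hg, ← hfin, hzero]
  -- The relation `τ_x + u_x τ_u = 0` is read as the vanishing of the characteristic of `-τ_u ∂_x +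
  -- τ_x ∂_u`, so that both derivatives vanish by varying `u_x`.
  have hz : ((0, - fderiv ℝ (fun q => (V q).1) (toTotal j) (0, 0, 1),
      fderiv ℝ (fun q => (V q).1) (toTotal j) (0, 1, 0)) : Total) = 0 := by
    refine eq_zero_of_characteristic_eq_zero hJ hj fun i hi hij r => ?_
    have := key i hi hij
    have e : ((0, 1, i.2.2.2.1) : Total) = (0, 1, 0) + i.2.2.2.1 • (0, 0, 1) := by simp
    rw [e, map_add, map_smul, smul_eq_mul] at this
    simp only
    linear_combination this
  intro a b
  have e : ((0, a, b) : Total) = a • (0, 1, 0) + b • (0, 0, 1) := by simp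
  simp only [Prod.mk_eq_zero, neg_eq_zero] at hz
  rw [e, map_add, map_smul, map_smul, hz.2.1, hz.2.2]
  simp

end EvolEq
namespace EvolEq

/-! ### Total derivatives on the jet space -/

/-- The part of the total `x`-derivative of a function on the jet space that does not involve
`u_xxx`. -/
noncomputable def totalDx (A : Jet → ℝ) (j : Jet) : ℝ :=
  fderiv ℝ A j (0, 1, j.2.2.2.1, j.2.2.2.2, 0)

/-- The partial derivative with respect to `u_xx`. -/
noncomputable def partialQ (A : Jet → ℝ) (j : Jet) : ℝ := fderiv ℝ A j (0, 0, 0, 0, 1)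

section TotalDerivative

variable {A B : Jet → ℝ} {j : Jet} {J : Set Jet}

theorem fderiv_jet_split (A : Jet → ℝ) (j : Jet) (s : ℝ) :
    fderiv ℝ A j (0, 1, j.2.2.2.1, j.2.2.2.2, s) = totalDx A j + s * partialQ A j := by
  have : ((0, 1, j.2.2.2.1, j.2.2.2.2, s) : Jet)
      = (0, 1, j.2.2.2.1, j.2.2.2.2, 0) + s • (0, 0, 0, 0, 1) := by simp
  rw [this, map_add, map_smul]
  rfl

theorem _root_.ContDiffAt.totalDx (hA : ContDiffAt ℝ ∞ A j) :
    ContDiffAt ℝ ∞ (EvolEq.totalDx A) j :=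
  hA.fderiv_infty.clm_apply (ContDiff.contDiffAt (by fun_prop))

theorem _root_.ContDiffAt.partialQ (hA : ContDiffAt ℝ ∞ A j) :
    ContDiffAt ℝ ∞ (EvolEq.partialQ A) j :=
  hA.fderiv_infty.clm_apply contDiffAt_const

theorem fderiv_totalDx (hA : ContDiffAt ℝ ∞ A j) (w : Jet) :
    fderiv ℝ (totalDx A) j w
      = fderiv ℝ (fderiv ℝ A) j w (0, 1, j.2.2.2.1, j.2.2.2.2, 0)
        + fderiv ℝ A j (0, 0, w.2.2.2.1, w.2.2.2.2, 0) := by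
  -- The vector along which `totalDx` differentiates depends on the point in an affine way; `l` is
  -- its linear part and produces the second term of the product rule.
  let l : Jet →ₗ[ℝ] Jet :=
    { toFun := fun i => (0, 0, i.2.2.2.1, i.2.2.2.2, 0)
      map_add' := fun _ _ => by simp
      map_smul' := fun _ _ => by simp }
  have hl : HasFDerivAt (fun i : Jet => (0, 1, 0, 0, 0) + l.toContinuousLinearMap i)
      l.toContinuousLinearMap j := l.toContinuousLinearMap.hasFDerivAt.const_add _
  have heq : totalDx A = fun i => fderiv ℝ A i ((0, 1, 0, 0, 0) + l.toContinuousLinearMap i) := by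
    funext i
    simp [totalDx, l]
  rw [heq, (hA.fderiv_infty.diff.hasFDerivAt.clm_apply hl).fderiv]
  simp only [add_apply, ContinuousLinearMap.comp_apply, ContinuousLinearMap.flip_apply]
  simp [l, add_comm]

theorem fderiv_partialQ (hA : ContDiffAt ℝ ∞ A j) (w : Jet) :
    fderiv ℝ (partialQ A) j w = fderiv ℝ (fderiv ℝ A) j w (0, 0, 0, 0, 1) :=
  fderiv_clm_apply_const hA _ _

theorem fderiv_eq_zero_of_eqOn_zero (hJ : IsOpen J) (h : ∀ i ∈ J, A i = 0) (hj : j ∈ J) :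
    fderiv ℝ A j = 0 := by
  have : A =ᶠ[𝓝 j] fun _ => 0 := by
    filter_upwards [hJ.mem_nhds hj] with i hi using h i hi
  rw [this.fderiv_eq]
  simp

/-- This is the commutator `[∂_q, D_x] = ∂_p` (with `p = u_x`, `q = u_xx`) applied to a function
with `A_q = 0`. It explains how each new derivative depends on the highest one. -/
theorem partialQ_totalDx (hJ : IsOpen J) (hA : ContDiffAt ℝ ∞ A j)
    (h : ∀ i ∈ J, partialQ A i = 0) (hj : j ∈ J) :
    partialQ (totalDx A) j = fderiv ℝ A j (0, 0, 0, 1, 0) := by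
  rw [partialQ, fderiv_totalDx hA, fderiv_fderiv_symm hA, ← fderiv_partialQ hA,
    fderiv_eq_zero_of_eqOn_zero hJ h hj]
  simp

end TotalDerivative

/-! ### Commutation of prolongations with total derivatives -/

section Commutation

variable {u : Base → ℝ} {p : Base} {V : Total → Total}

theorem prolongX_zero (V : Total → Total) (u : Base → ℝ) (p : Base) :
    prolongX 0 V u p = (V (graphPt u p)).2.2 := by
  simp only [prolongX, characteristic, Function.iterate_zero_apply, Function.iterate_succ_apply']
  ring

theorem prolongX_eventuallyEq (hτ : ∀ᶠ q in 𝓝 p, (V (graphPt u q)).1 = 0) (k : ℕ) :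
    prolongX k V u =ᶠ[𝓝 p] fun q => Dx^[k] (characteristic V u) q
      + (V (graphPt u q)).2.1 * Dx^[k + 1] u q := by
  filter_upwards [hτ] with q hq
  simp [prolongX, hq]

theorem contDiffAt_prolongX (hu : ContDiffAt ℝ ∞ u p) (hV : ContDiffAt ℝ ∞ V (graphPt u p))
    (hτ : ∀ᶠ q in 𝓝 p, (V (graphPt u q)).1 = 0) (k : ℕ) :
    ContDiffAt ℝ ∞ (prolongX k V u) p :=
  (((contDiffAt_characteristic hu hV).iterate_Dx k).add
    ((contDiffAt_comps hu hV).2.1.mul (hu.iterate_Dx (k + 1)))).congr_of_eventuallyEq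
      (prolongX_eventuallyEq hτ k)

/-- The usual recursion for prolongation coefficients, specialized to `τ = 0`: differentiating
`D_x^k Q + ξ D_x^{k+1} u` yields the next coefficient and the extra term from `D_x ξ`. -/
theorem Dx_prolongX (hu : ContDiffAt ℝ ∞ u p) (hV : ContDiffAt ℝ ∞ V (graphPt u p))
    (hτ : ∀ᶠ q in 𝓝 p, (V (graphPt u q)).1 = 0) (k : ℕ) :
    Dx (prolongX k V u) p = prolongX (k + 1) V u p
      + Dx (fun q => (V (graphPt u q)).2.1) p * Dx^[k + 1] u p := by
  have h2 := (contDiffAt_comps hu hV).2.1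
  have hk := hu.iterate_Dx (k + 1)
  rw [Dx_congr (prolongX_eventuallyEq hτ k),
    Dx_add ((contDiffAt_characteristic hu hV).iterate_Dx k) (h2.mul hk), Dx_mul h2 hk, prolongX,
    hτ.self_of_nhds]
  simp only [Function.iterate_succ_apply']
  ring

theorem Dt_prolongX_zero (hu : ContDiffAt ℝ ∞ u p) (hV : ContDiffAt ℝ ∞ V (graphPt u p))
    (hτ : ∀ᶠ q in 𝓝 p, (V (graphPt u q)).1 = 0) :
    Dt (fun q => (V (graphPt u q)).2.2) p = prolongT V u p
      + Dt (fun q => (V (graphPt u q)).2.1) p * Dx u p := by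
  have h2 := (contDiffAt_comps hu hV).2.1
  have h : (fun q => (V (graphPt u q)).2.2) =ᶠ[𝓝 p] fun q => characteristic V u q
      + (V (graphPt u q)).2.1 * Dx u q := by
    filter_upwards [hτ] with q hq
    simp only [characteristic, hq]
    ring
  rw [Dt_congr h, Dt_add (contDiffAt_characteristic hu hV) (h2.mul hu.Dx), Dt_mul h2 hu.Dx,
    prolongT, hτ.self_of_nhds, Dt_Dx_comm hu]
  ring

/-- The prolongation of a vertical vector field commutes with the total `x`-derivative up to a
multiple of the latter. -/
theorem prolong_totalDx (hu : ContDiffAt ℝ ∞ u p) (hV : ContDiffAt ℝ ∞ V (graphPt u p))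
    (hτ : ∀ᶠ q in 𝓝 p, (V (graphPt u q)).1 = 0) {A : Jet → ℝ}
    (hA : ContDiffAt ℝ ∞ A (jet u p)) {C : Base → ℝ}
    (hC : ∀ᶠ q in 𝓝 p, fderiv ℝ A (jet u q) (prolongJet V u q) = C q) :
    fderiv ℝ (totalDx A) (jet u p) (prolongJet V u p)
      + Dx (Dx (Dx u)) p * fderiv ℝ (partialQ A) (jet u p) (prolongJet V u p)
      + partialQ A (jet u p) * prolongX 3 V u p
      = Dx C p - Dx (fun q => (V (graphPt u q)).2.1) p *
        (totalDx A (jet u p) + Dx (Dx (Dx u)) p * partialQ A (jet u p)) := by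
  set ξ' := Dx (fun q => (V (graphPt u q)).2.1) p with hξ'
  have hw : HasDerivAt (fun y => prolongJet V u (p.1, y))
      (0, ξ', prolongX 1 V u p + ξ' * Dx u p, prolongX 2 V u p + ξ' * Dx (Dx u) p,
        prolongX 3 V u p + ξ' * Dx (Dx (Dx u)) p) p.2 := by
    have h1 : HasDerivAt (fun y => (V (graphPt u (p.1, y))).1) 0 p.2 := by
      have := hasDerivAt_Dx (contDiffAt_comps hu hV).1
      rwa [show Dx (fun q => (V (graphPt u q)).1) p = 0 by
        rw [Dx_congr (g := fun _ => 0) hτ]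
        exact deriv_const _ _] at this
    have hX : ∀ k : ℕ, HasDerivAt (fun y => prolongX k V u (p.1, y))
        (prolongX (k + 1) V u p + ξ' * Dx^[k + 1] u p) p.2 := fun k => by
      have := hasDerivAt_Dx (contDiffAt_prolongX hu hV hτ k)
      rwa [Dx_prolongX hu hV hτ k] at this
    have h3 : HasDerivAt (fun y => (V (graphPt u (p.1, y))).2.2)
        (prolongX 1 V u p + ξ' * Dx u p) p.2 := by
      have := hX 0
      simp only [prolongX_zero] at this
      exact this
    exact h1.prodMk ((hasDerivAt_Dx (contDiffAt_comps hu hV).2.1).prodMk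
      (h3.prodMk ((hX 1).prodMk (hX 2))))
  have hγ := hasDerivAt_jet_snd hu
  have hd := HasFDerivAt.comp_hasDerivAt (x := p.2) (f := fun y => jet u (p.1, y))
    (l := fderiv ℝ A) hA.fderiv_infty.diff.hasFDerivAt hγ
  have hprod := (hd.clm_apply hw).deriv
  have hDxC : Dx C p = Dx (fun q => fderiv ℝ A (jet u q) (prolongJet V u q)) p :=
    (Dx_congr hC).symm
  have hDx : Dx (fun q => fderiv ℝ A (jet u q) (prolongJet V u q)) p = _ := hprod
  rw [hDxC, hDx, fderiv_totalDx hA, fderiv_partialQ hA]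
  have e1 : ((0, 1, Dx u p, Dx (Dx u) p, Dx (Dx (Dx u)) p) : Jet)
      = (0, 1, (jet u p).2.2.2.1, (jet u p).2.2.2.2, 0) + Dx (Dx (Dx u)) p • (0, 0, 0, 0, 1) := by
    simp [jet]
  -- The `x`-derivative of the prolonged field along `u` splits into the change of the coefficients
  -- of `D_x`, the motion of `u_xxx`, and `D_x ξ` times the total derivative itself.
  have e2 : ((0, ξ', prolongX 1 V u p + ξ' * Dx u p, prolongX 2 V u p + ξ' * Dx (Dx u) p,
        prolongX 3 V u p + ξ' * Dx (Dx (Dx u)) p) : Jet)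
      = (0, 0, (prolongJet V u p).2.2.2.1, (prolongJet V u p).2.2.2.2, 0)
        + prolongX 3 V u p • (0, 0, 0, 0, 1)
        + ξ' • ((0, 1, (jet u p).2.2.2.1, (jet u p).2.2.2.2, 0)
          + Dx (Dx (Dx u)) p • (0, 0, 0, 0, 1)) := by
    simp [jet, prolongJet]
  rw [fderiv_fderiv_symm hA (0, 1, Dx u p, Dx (Dx u) p, Dx (Dx (Dx u)) p), e1, e2]
  simp only [map_add, map_smul, smul_eq_mul, totalDx, partialQ, Function.comp_apply,
    Prod.mk.eta]
  ring

/-- The analogue for `D_t` of the commutation with `D_x`. Functions of `(t, x, u)` suffice here,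
since only the new variables themselves are differentiated in `t`. -/
theorem prolong_totalDt (hu : ContDiffAt ℝ ∞ u p) (hV : ContDiffAt ℝ ∞ V (graphPt u p))
    (hτ : ∀ᶠ q in 𝓝 p, (V (graphPt u q)).1 = 0) {Z : Total → ℝ}
    (hZ : ContDiffAt ℝ ∞ Z (graphPt u p)) {C : Base → ℝ}
    (hC : ∀ᶠ q in 𝓝 p, fderiv ℝ Z (graphPt u q) (V (graphPt u q)) = C q) :
    fderiv ℝ (fderiv ℝ Z) (graphPt u p) (V (graphPt u p)) (1, 0, Dt u p)
      + prolongT V u p * fderiv ℝ Z (graphPt u p) (0, 0, 1)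
      = Dt C p - Dt (fun q => (V (graphPt u q)).2.1) p *
        fderiv ℝ Z (graphPt u p) (0, 1, Dx u p) := by
  set ξ' := Dt (fun q => (V (graphPt u q)).2.1) p with hξ'
  have hw : HasDerivAt (fun s => V (graphPt u (s, p.2)))
      (0, ξ', prolongT V u p + ξ' * Dx u p) p.1 := by
    have h1 : HasDerivAt (fun s => (V (graphPt u (s, p.2))).1) 0 p.1 := by
      have := hasDerivAt_Dt (contDiffAt_comps hu hV).1
      rwa [show Dt (fun q => (V (graphPt u q)).1) p = 0 by
        rw [Dt_congr (g := fun _ => 0) hτ]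
        exact deriv_const _ _] at this
    have h3 := hasDerivAt_Dt (contDiffAt_comps hu hV).2.2
    rw [Dt_prolongX_zero hu hV hτ] at h3
    exact h1.prodMk ((hasDerivAt_Dt (contDiffAt_comps hu hV).2.1).prodMk h3)
  have hd := HasFDerivAt.comp_hasDerivAt (x := p.1) (f := fun s => graphPt u (s, p.2))
    (l := fderiv ℝ Z) hZ.fderiv_infty.diff.hasFDerivAt (hasDerivAt_graphPt_fst hu)
  have hprod := (hd.clm_apply hw).deriv
  have hDtC : Dt C p = Dt (fun q => fderiv ℝ Z (graphPt u q) (V (graphPt u q))) p :=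
    (Dt_congr hC).symm
  have hDt : Dt (fun q => fderiv ℝ Z (graphPt u q) (V (graphPt u q))) p = _ := hprod
  rw [hDtC, hDt, fderiv_fderiv_symm hZ (1, 0, Dt u p)]
  have e2 : ((0, ξ', prolongT V u p + ξ' * Dx u p) : Total)
      = prolongT V u p • (0, 0, 1) + ξ' • (0, 1, Dx u p) := by simp
  rw [e2]
  simp only [map_add, map_smul, smul_eq_mul, Function.comp_apply, Prod.mk.eta]
  ring

end Commutation

end EvolEq
namespace EvolEq

/-! ### Point transformations and the induced coordinates on the jet space -/

/-- The projection `toTotal` as a continuous linear map. -/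
noncomputable def toTotalL : Jet →L[ℝ] Total :=
  LinearMap.toContinuousLinearMap
    { toFun := toTotal
      map_add' := fun _ _ => rfl
      map_smul' := fun _ _ => rfl }

theorem fderiv_comp_toTotal {Z : Total → ℝ} {j : Jet} (hZ : DifferentiableAt ℝ Z (toTotal j))
    (w : Jet) : fderiv ℝ (Z ∘ toTotal) j w = fderiv ℝ Z (toTotal j) (toTotal w) := by
  have h : HasFDerivAt (Z ∘ toTotal) ((fderiv ℝ Z (toTotal j)).comp toTotalL) j :=
    HasFDerivAt.comp (g := Z) (f := toTotal) j hZ.hasFDerivAt toTotalL.hasFDerivAt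
  rw [h.fderiv]
  rfl

/-- The new derivatives are quotients by `D_x X`; this Leibniz rule is applied to the relations with
cleared denominators, such as `D_x U = newP · D_x X`, in place of the quotient rule. -/
theorem fderiv_of_eqOn_mul {E : Type*} [NormedAddCommGroup E] [NormedSpace ℝ E] {J : Set E}
    (hJ : IsOpen J) {A B D : E → ℝ} {j : E} (hj : j ∈ J)
    (hB : DifferentiableAt ℝ B j) (hD : DifferentiableAt ℝ D j) (h : ∀ i ∈ J, A i = B i * D i)
    (w : E) : fderiv ℝ A j w = fderiv ℝ B j w * D j + B j * fderiv ℝ D j w := by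
  have : A =ᶠ[𝓝 j] fun i => B i * D i := by
    filter_upwards [hJ.mem_nhds hj] with i hi using h i hi
  rw [this.fderiv_eq, fderiv_fun_mul hB hD]
  simp
  ring

/-- `(t, x, u) ↦ (t, X, U)` is a local diffeomorphism below `J`, and `X_x + u_x X_u` has no zeros
on `J`. -/
structure IsAdapted (J : Set Jet) (X U : Total → ℝ) : Prop where
  isOpen : IsOpen J
  smoothX : ContDiffOn ℝ ∞ X (toTotal '' J)
  smoothU : ContDiffOn ℝ ∞ U (toTotal '' J)
  Dx_ne : ∀ j ∈ J, totalDx (X ∘ toTotal) j ≠ 0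
  jac : ∀ q ∈ toTotal '' J, jacobian X U q ≠ 0

/-- The derivative of the new dependent variable with respect to the new `x`. -/
noncomputable def newP (X U : Total → ℝ) (j : Jet) : ℝ :=
  totalDx (U ∘ toTotal) j / totalDx (X ∘ toTotal) j

/-- The second derivative of the new dependent variable with respect to the new `x`. -/
noncomputable def newQ (X U : Total → ℝ) (j : Jet) : ℝ :=
  totalDx (newP X U) j / totalDx (X ∘ toTotal) j

/-- The third `x`-derivative in the new variables is `thirdA + thirdB * u_xxx`. -/
noncomputable def thirdA (X U : Total → ℝ) (j : Jet) : ℝ :=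
  totalDx (newQ X U) j / totalDx (X ∘ toTotal) j

/-- The third `x`-derivative in the new variables is `thirdA + thirdB * u_xxx`. -/
noncomputable def thirdB (X U : Total → ℝ) (j : Jet) : ℝ :=
  partialQ (newQ X U) j / totalDx (X ∘ toTotal) j

/-- The `t`-derivative in the new variables is `timeA + timeB * u_t`. -/
noncomputable def timeA (X U : Total → ℝ) (j : Jet) : ℝ :=
  fderiv ℝ U (toTotal j) (1, 0, 0) - newP X U j * fderiv ℝ X (toTotal j) (1, 0, 0)

/-- The `t`-derivative in the new variables is `timeA + timeB * u_t`. -/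
noncomputable def timeB (X U : Total → ℝ) (j : Jet) : ℝ :=
  fderiv ℝ U (toTotal j) (0, 0, 1) - newP X U j * fderiv ℝ X (toTotal j) (0, 0, 1)

/-- The coefficient `F` of the equation in the new variables. -/
noncomputable def newF (F : Jet → ℝ) (X U : Total → ℝ) (j : Jet) : ℝ :=
  F j * timeB X U j / thirdB X U j

/-- The coefficient `G` of the equation in the new variables. -/
noncomputable def newG (F G : Jet → ℝ) (X U : Total → ℝ) (j : Jet) : ℝ :=
  timeA X U j + timeB X U j * G j - newF F X U j * thirdA X U j

namespace IsAdapted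

variable {J : Set Jet} {X U : Total → ℝ} {j : Jet}

theorem contDiffAt_X (h : IsAdapted J X U) (hj : j ∈ J) : ContDiffAt ℝ ∞ X (toTotal j) :=
  h.smoothX.contDiffAt ((isOpen_image_toTotal h.isOpen).mem_nhds ⟨j, hj, rfl⟩)

theorem contDiffAt_U (h : IsAdapted J X U) (hj : j ∈ J) : ContDiffAt ℝ ∞ U (toTotal j) :=
  h.smoothU.contDiffAt ((isOpen_image_toTotal h.isOpen).mem_nhds ⟨j, hj, rfl⟩)

theorem contDiffAt_liftX (h : IsAdapted J X U) (hj : j ∈ J) : ContDiffAt ℝ ∞ (X ∘ toTotal) j :=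
  (h.contDiffAt_X hj).comp j contDiff_toTotal.contDiffAt

theorem contDiffAt_liftU (h : IsAdapted J X U) (hj : j ∈ J) : ContDiffAt ℝ ∞ (U ∘ toTotal) j :=
  (h.contDiffAt_U hj).comp j contDiff_toTotal.contDiffAt

theorem contDiffAt_newP (h : IsAdapted J X U) (hj : j ∈ J) : ContDiffAt ℝ ∞ (newP X U) j :=
  (h.contDiffAt_liftU hj).totalDx.div (h.contDiffAt_liftX hj).totalDx (h.Dx_ne j hj)

theorem contDiffAt_newQ (h : IsAdapted J X U) (hj : j ∈ J) : ContDiffAt ℝ ∞ (newQ X U) j :=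
  (h.contDiffAt_newP hj).totalDx.div (h.contDiffAt_liftX hj).totalDx (h.Dx_ne j hj)

theorem contDiffAt_thirdA (h : IsAdapted J X U) (hj : j ∈ J) : ContDiffAt ℝ ∞ (thirdA X U) j :=
  (h.contDiffAt_newQ hj).totalDx.div (h.contDiffAt_liftX hj).totalDx (h.Dx_ne j hj)

theorem contDiffAt_thirdB (h : IsAdapted J X U) (hj : j ∈ J) : ContDiffAt ℝ ∞ (thirdB X U) j :=
  (h.contDiffAt_newQ hj).partialQ.div (h.contDiffAt_liftX hj).totalDx (h.Dx_ne j hj)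

theorem contDiffAt_fderiv_X (h : IsAdapted J X U) (hj : j ∈ J) (v : Total) :
    ContDiffAt ℝ ∞ (fun i => fderiv ℝ X (toTotal i) v) j :=
  ((h.contDiffAt_X hj).fderiv_infty.comp j contDiff_toTotal.contDiffAt).clm_apply
    contDiffAt_const

theorem contDiffAt_fderiv_U (h : IsAdapted J X U) (hj : j ∈ J) (v : Total) :
    ContDiffAt ℝ ∞ (fun i => fderiv ℝ U (toTotal i) v) j :=
  ((h.contDiffAt_U hj).fderiv_infty.comp j contDiff_toTotal.contDiffAt).clm_apply
    contDiffAt_const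

theorem contDiffAt_timeA (h : IsAdapted J X U) (hj : j ∈ J) : ContDiffAt ℝ ∞ (timeA X U) j :=
  (h.contDiffAt_fderiv_U hj _).sub ((h.contDiffAt_newP hj).mul (h.contDiffAt_fderiv_X hj _))

theorem contDiffAt_timeB (h : IsAdapted J X U) (hj : j ∈ J) : ContDiffAt ℝ ∞ (timeB X U) j :=
  (h.contDiffAt_fderiv_U hj _).sub ((h.contDiffAt_newP hj).mul (h.contDiffAt_fderiv_X hj _))

theorem totalDx_U (h : IsAdapted J X U) (hj : j ∈ J) :
    totalDx (U ∘ toTotal) j = newP X U j * totalDx (X ∘ toTotal) j :=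
  (div_mul_cancel₀ _ (h.Dx_ne j hj)).symm

theorem totalDx_newP (h : IsAdapted J X U) (hj : j ∈ J) :
    totalDx (newP X U) j = newQ X U j * totalDx (X ∘ toTotal) j :=
  (div_mul_cancel₀ _ (h.Dx_ne j hj)).symm

theorem totalDx_newQ (h : IsAdapted J X U) (hj : j ∈ J) :
    totalDx (newQ X U) j = thirdA X U j * totalDx (X ∘ toTotal) j :=
  (div_mul_cancel₀ _ (h.Dx_ne j hj)).symm

theorem partialQ_newQ (h : IsAdapted J X U) (hj : j ∈ J) :
    partialQ (newQ X U) j = thirdB X U j * totalDx (X ∘ toTotal) j :=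
  (div_mul_cancel₀ _ (h.Dx_ne j hj)).symm

theorem totalDx_lift {Z : Total → ℝ} (hZ : DifferentiableAt ℝ Z (toTotal j)) :
    totalDx (Z ∘ toTotal) j = fderiv ℝ Z (toTotal j) (0, 1, j.2.2.2.1) := by
  rw [totalDx, fderiv_comp_toTotal hZ]
  rfl

theorem partialQ_lift {Z : Total → ℝ} (hZ : DifferentiableAt ℝ Z (toTotal j)) :
    partialQ (Z ∘ toTotal) j = 0 := by
  rw [partialQ, fderiv_comp_toTotal hZ]
  exact map_zero _

theorem partialQ_X (h : IsAdapted J X U) (hj : j ∈ J) : partialQ (X ∘ toTotal) j = 0 :=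
  partialQ_lift (h.contDiffAt_X hj).diff

theorem partialQ_U (h : IsAdapted J X U) (hj : j ∈ J) : partialQ (U ∘ toTotal) j = 0 :=
  partialQ_lift (h.contDiffAt_U hj).diff

theorem partialQ_totalDx_lift (hJ : IsOpen J) {Z : Total → ℝ}
    (hZ : ∀ i ∈ J, ContDiffAt ℝ ∞ Z (toTotal i)) (hj : j ∈ J) :
    partialQ (totalDx (Z ∘ toTotal)) j = 0 := by
  rw [partialQ_totalDx hJ ((hZ j hj).comp j contDiff_toTotal.contDiffAt)
    (fun i hi => partialQ_lift (hZ i hi).diff) hj, fderiv_comp_toTotal (hZ j hj).diff]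
  exact map_zero _

/-- On functions of `(t, x, u)` one has `D_x Z = Z_x + u_x Z_u`, whose `u_x`-derivative is `Z_u`. -/
theorem partialP_totalDx_lift (hJ : IsOpen J) {Z : Total → ℝ}
    (hZ : ∀ i ∈ J, ContDiffAt ℝ ∞ Z (toTotal i)) (hj : j ∈ J) :
    fderiv ℝ (totalDx (Z ∘ toTotal)) j (0, 0, 0, 1, 0)
      = fderiv ℝ Z (toTotal j) (0, 0, 1) := by
  have hZ' : ContDiffAt ℝ ∞ (Z ∘ toTotal) j := (hZ j hj).comp j contDiff_toTotal.contDiffAt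
  have h0 : ∀ i ∈ J, fderiv ℝ (Z ∘ toTotal) i (0, 0, 0, 1, 0) = 0 := fun i hi => by
    rw [fderiv_comp_toTotal (hZ i hi).diff]
    exact map_zero _
  rw [fderiv_totalDx hZ', fderiv_fderiv_symm hZ', ← fderiv_clm_apply_const hZ',
    fderiv_eq_zero_of_eqOn_zero hJ h0 hj, fderiv_comp_toTotal (hZ j hj).diff]
  simp [toTotal]

theorem partialQ_newP (h : IsAdapted J X U) (hj : j ∈ J) : partialQ (newP X U) j = 0 := by
  have h1 := fderiv_of_eqOn_mul h.isOpen hj (h.contDiffAt_newP hj).diff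
    (h.contDiffAt_liftX hj).totalDx.diff (fun i hi => h.totalDx_U hi) (0, 0, 0, 0, 1)
  have h2 := partialQ_totalDx_lift h.isOpen (fun i hi => h.contDiffAt_U hi) hj
  have h3 := partialQ_totalDx_lift h.isOpen (fun i hi => h.contDiffAt_X hi) hj
  rw [partialQ] at h2 h3
  rw [h2, h3, mul_zero, add_zero] at h1
  exact (mul_eq_zero.1 h1.symm).resolve_right (h.Dx_ne j hj)

theorem partialP_newP (h : IsAdapted J X U) (hj : j ∈ J) :
    fderiv ℝ (newP X U) j (0, 0, 0, 1, 0) * totalDx (X ∘ toTotal) j = timeB X U j := by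
  have h1 := fderiv_of_eqOn_mul h.isOpen hj (h.contDiffAt_newP hj).diff
    (h.contDiffAt_liftX hj).totalDx.diff (fun i hi => h.totalDx_U hi) (0, 0, 0, 1, 0)
  rw [partialP_totalDx_lift h.isOpen (fun i hi => h.contDiffAt_U hi) hj,
    partialP_totalDx_lift h.isOpen (fun i hi => h.contDiffAt_X hi) hj] at h1
  rw [timeB]
  linear_combination -h1

/-- Multiplied by `D_x X`, this coefficient becomes the Jacobian `X_x U_u - X_u U_x`. -/
theorem timeB_ne (h : IsAdapted J X U) (hj : j ∈ J) : timeB X U j ≠ 0 := by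
  have e : timeB X U j * totalDx (X ∘ toTotal) j = jacobian X U (toTotal j) := by
    have h1 := h.totalDx_U hj
    have hX : ∀ {Z : Total → ℝ}, fderiv ℝ Z (toTotal j) (0, 1, j.2.2.2.1)
        = fderiv ℝ Z (toTotal j) (0, 1, 0)
          + j.2.2.2.1 * fderiv ℝ Z (toTotal j) (0, 0, 1) := by
      intro Z
      have : ((0, 1, j.2.2.2.1) : Total) = (0, 1, 0) + j.2.2.2.1 • (0, 0, 1) := by simp
      rw [this, map_add, map_smul, smul_eq_mul]
    rw [totalDx_lift (h.contDiffAt_X hj).diff, totalDx_lift (h.contDiffAt_U hj).diff,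
      hX, hX] at h1
    rw [timeB, jacobian, totalDx_lift (h.contDiffAt_X hj).diff, hX]
    linear_combination fderiv ℝ X (toTotal j) (0, 0, 1) * h1
  intro h0
  rw [h0, zero_mul] at e
  exact h.jac _ ⟨j, hj, rfl⟩ e.symm

theorem partialP_newP_ne (h : IsAdapted J X U) (hj : j ∈ J) : fderiv ℝ (newP X U) j (0, 0, 0, 1, 0) ≠ 0 := by
  intro h0
  have := h.partialP_newP hj
  rw [h0, zero_mul] at this
  exact h.timeB_ne hj this.symm

/-- Since `newP` is free of `u_xx`, the `u_xx`-derivative of `D_x newP` is the `u_x`-derivative of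
`newP`, which is nonzero. -/
theorem partialQ_newQ_ne (h : IsAdapted J X U) (hj : j ∈ J) : partialQ (newQ X U) j ≠ 0 := by
  have h1 := fderiv_of_eqOn_mul h.isOpen hj (h.contDiffAt_newQ hj).diff
    (h.contDiffAt_liftX hj).totalDx.diff (fun i hi => h.totalDx_newP hi) (0, 0, 0, 0, 1)
  have h2 := partialQ_totalDx h.isOpen (h.contDiffAt_newP hj) (fun i hi => h.partialQ_newP hi) hj
  have h3 := partialQ_totalDx_lift h.isOpen (fun i hi => h.contDiffAt_X hi) hj
  rw [partialQ] at h2 h3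
  rw [h2, h3, mul_zero, add_zero] at h1
  intro h0
  rw [partialQ] at h0
  rw [h0, zero_mul] at h1
  exact h.partialP_newP_ne hj h1

theorem thirdB_ne (h : IsAdapted J X U) (hj : j ∈ J) : thirdB X U j ≠ 0 :=
  div_ne_zero (h.partialQ_newQ_ne hj) (h.Dx_ne j hj)

theorem eq_zero_of_jacobian_ne {q w : Total} (hq : jacobian X U q ≠ 0) (h1 : w.1 = 0)
    (h2 : fderiv ℝ X q w = 0) (h3 : fderiv ℝ U q w = 0) : w = 0 := by
  obtain ⟨t, x, y⟩ := w
  simp only at h1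
  subst h1
  have e : ((0, x, y) : Total) = x • (0, 1, 0) + y • (0, 0, 1) := by simp
  rw [e, map_add, map_smul, map_smul, smul_eq_mul, smul_eq_mul] at h2 h3
  rw [jacobian] at hq
  have ex : x * (fderiv ℝ X q (0, 1, 0) * fderiv ℝ U q (0, 0, 1)
    - fderiv ℝ X q (0, 0, 1) * fderiv ℝ U q (0, 1, 0)) = 0 := by
    linear_combination fderiv ℝ U q (0, 0, 1) * h2 - fderiv ℝ X q (0, 0, 1) * h3
  have ey : y * (fderiv ℝ X q (0, 1, 0) * fderiv ℝ U q (0, 0, 1)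
    - fderiv ℝ X q (0, 0, 1) * fderiv ℝ U q (0, 1, 0)) = 0 := by
    linear_combination fderiv ℝ X q (0, 1, 0) * h3 - fderiv ℝ U q (0, 1, 0) * h2
  rw [(mul_eq_zero.1 ex).resolve_right hq, (mul_eq_zero.1 ey).resolve_right hq]
  rfl

/-- The change of jet coordinates is block triangular: `(t, X, U)` determines the base components,
then `newP` the `u_x`-component, then `newQ` the last one, with nonzero diagonal entries. -/
theorem eq_zero_of_coordinates (h : IsAdapted J X U) (hj : j ∈ J) {w : Jet} (h1 : w.1 = 0)
    (h2 : fderiv ℝ (X ∘ toTotal) j w = 0) (h3 : fderiv ℝ (U ∘ toTotal) j w = 0)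
    (h4 : fderiv ℝ (newP X U) j w = 0) (h5 : fderiv ℝ (newQ X U) j w = 0) : w = 0 := by
  rw [fderiv_comp_toTotal (h.contDiffAt_X hj).diff] at h2
  rw [fderiv_comp_toTotal (h.contDiffAt_U hj).diff] at h3
  have h0 : toTotal w = 0 := eq_zero_of_jacobian_ne (h.jac _ ⟨j, hj, rfl⟩) h1 h2 h3
  obtain ⟨t, x, y, a, b⟩ := w
  simp only [toTotal, Prod.mk_eq_zero] at h0
  obtain ⟨rfl, rfl, rfl⟩ := h0
  have e : ((0, 0, 0, a, b) : Jet) = a • (0, 0, 0, 1, 0) + b • (0, 0, 0, 0, 1) := by simp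
  have hq := h.partialQ_newP hj
  rw [partialQ] at hq
  rw [e, map_add, map_smul, map_smul, hq, smul_zero, add_zero, smul_eq_mul] at h4
  have ha : a = 0 := (mul_eq_zero.1 h4).resolve_right (h.partialP_newP_ne hj)
  subst ha
  have hq' := h.partialQ_newQ_ne hj
  rw [partialQ] at hq'
  rw [e, zero_smul, zero_add, map_smul, smul_eq_mul] at h5
  rw [(mul_eq_zero.1 h5).resolve_right hq']
  rfl

end IsAdapted

end EvolEq
namespace EvolEq

namespace IsAdapted

variable {J : Set Jet} {X U : Total → ℝ} {u : Base → ℝ} {p : Base}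

/-! ### The transformed derivatives along a function -/

theorem hasDerivAt_newBase (h : IsAdapted J X U) (hu : ContDiffAt ℝ ∞ u p) (hp : jet u p ∈ J) :
    HasDerivAt (fun y => (((p.1, X (graphPt u (p.1, y))) : Base)))
      (0, totalDx (X ∘ toTotal) (jet u p)) p.2 := by
  refine (hasDerivAt_const _ _).prodMk ?_
  have h1 : ContDiffAt ℝ ∞ X (graphPt u p) := h.contDiffAt_X hp
  rw [totalDx_lift (h.contDiffAt_X hp).diff]
  exact HasFDerivAt.comp_hasDerivAt (x := p.2) (f := fun y => graphPt u (p.1, y)) (l := X)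
    h1.diff.hasFDerivAt (hasDerivAt_graphPt_snd hu)

theorem Dx_comp_newBase (h : IsAdapted J X U) (hu : ContDiffAt ℝ ∞ u p) (hp : jet u p ∈ J) {v : Base → ℝ}
    (hv : DifferentiableAt ℝ v (p.1, X (graphPt u p))) :
    Dx (fun q => v (q.1, X (graphPt u q))) p
      = Dx v (p.1, X (graphPt u p)) * totalDx (X ∘ toTotal) (jet u p) := by
  rw [Dx_comp (γ := fun q : Base => (q.1, X (graphPt u q))) hv (h.hasDerivAt_newBase hu hp),
    Dx_eq_fderiv hv]
  have : ((0, totalDx (X ∘ toTotal) (jet u p)) : Base)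
      = totalDx (X ∘ toTotal) (jet u p) • (0, 1) := by simp
  rw [this, map_smul, smul_eq_mul, mul_comm]

theorem Dt_comp_newBase (h : IsAdapted J X U) (hu : ContDiffAt ℝ ∞ u p) (hp : jet u p ∈ J) {v : Base → ℝ}
    (hv : DifferentiableAt ℝ v (p.1, X (graphPt u p))) :
    Dt (fun q => v (q.1, X (graphPt u q))) p
      = Dt v (p.1, X (graphPt u p))
        + Dx v (p.1, X (graphPt u p)) * fderiv ℝ X (graphPt u p) (1, 0, Dt u p) := by
  have h1 : ContDiffAt ℝ ∞ X (graphPt u p) := h.contDiffAt_X hp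
  have hd : HasDerivAt (fun s => (((s, X (graphPt u (s, p.2))) : Base)))
      (1, fderiv ℝ X (graphPt u p) (1, 0, Dt u p)) p.1 :=
    (hasDerivAt_id _).prodMk (HasFDerivAt.comp_hasDerivAt (x := p.1)
      (f := fun s => graphPt u (s, p.2)) (l := X) h1.diff.hasFDerivAt (hasDerivAt_graphPt_fst hu))
  rw [Dt_comp (γ := fun q : Base => (q.1, X (graphPt u q))) hv hd, Dx_eq_fderiv hv,
    Dt_eq_fderiv hv]
  have : ((1, fderiv ℝ X (graphPt u p) (1, 0, Dt u p)) : Base)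
      = (1, 0) + fderiv ℝ X (graphPt u p) (1, 0, Dt u p) • (0, 1) := by simp
  rw [this, map_add, map_smul, smul_eq_mul, mul_comm]

theorem Dx_comp_jet (hu : ContDiffAt ℝ ∞ u p) {A : Jet → ℝ}
    (hA : DifferentiableAt ℝ A (jet u p)) :
    Dx (fun q => A (jet u q)) p
      = totalDx A (jet u p) + Dx (Dx (Dx u)) p * partialQ A (jet u p) := by
  rw [Dx_comp hA (hasDerivAt_jet_snd hu), ← fderiv_jet_split]
  rfl

/-- The derivatives of the transformed function. -/
theorem transformed_derivatives (h : IsAdapted J X U) (hu : ContDiffAt ℝ ∞ u p) (hp : jet u p ∈ J) {v : Base → ℝ}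
    (hv : ContDiffAt ℝ ∞ v (p.1, X (graphPt u p)))
    (hvu : ∀ᶠ q in 𝓝 p, v (q.1, X (graphPt u q)) = U (graphPt u q)) :
    Dx v (p.1, X (graphPt u p)) = newP X U (jet u p) ∧
    Dx (Dx v) (p.1, X (graphPt u p)) = newQ X U (jet u p) ∧
    Dx (Dx (Dx v)) (p.1, X (graphPt u p))
      = thirdA X U (jet u p) + thirdB X U (jet u p) * Dx (Dx (Dx u)) p ∧
    Dt v (p.1, X (graphPt u p)) = timeA X U (jet u p) + timeB X U (jet u p) * Dt u p := by
  have hnear : ∀ᶠ q in 𝓝 p, jet u q ∈ J :=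
    hu.jet.continuousAt.eventually (h.isOpen.mem_nhds hp)
  have hsm : ∀ᶠ q in 𝓝 p, DifferentiableAt ℝ u q ∧ DifferentiableAt ℝ (Dx u) q ∧
      DifferentiableAt ℝ (Dx (Dx u)) q :=
    hu.eventually_diff.and (hu.Dx.eventually_diff.and hu.Dx.Dx.eventually_diff)
  have hφ : ContinuousAt (fun q : Base => (q.1, X (graphPt u q))) p :=
    continuousAt_fst.prodMk
      (ContinuousAt.comp (f := graphPt u) (g := X) (h.contDiffAt_X hp).continuousAt
        hu.graphPt.continuousAt)
  -- The conclusion holds in a neighbourhood so that it can be differentiated again. It covers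
  -- functions `A` free of `u_xx`, hence the first two derivatives; the third involves `u_xxx` and
  -- is computed separately.
  have step : ∀ {v : Base → ℝ} {A B : Jet → ℝ}, ContDiffAt ℝ ∞ v (p.1, X (graphPt u p)) →
      (∀ᶠ q in 𝓝 p, v (q.1, X (graphPt u q)) = A (jet u q)) →
      (∀ i ∈ J, ContDiffAt ℝ ∞ A i) → (∀ i ∈ J, partialQ A i = 0) →
      (∀ i ∈ J, totalDx A i = B i * totalDx (X ∘ toTotal) i) →
      ∀ᶠ q in 𝓝 p, Dx v (q.1, X (graphPt u q)) = B (jet u q) := by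
    intro v A B hv hvA hA hAq hAB
    filter_upwards [hvA.eventually_nhds, hnear, hsm, hφ.eventually hv.eventually_diff]
      with q h1 h2 ⟨h3, h3', h3''⟩ h4
    have hjet : HasDerivAt (fun y => jet u (q.1, y))
        (0, 1, Dx u q, Dx (Dx u) q, Dx (Dx (Dx u)) q) q.2 := by
      have e : ∀ {f : Base → ℝ}, DifferentiableAt ℝ f q →
          HasDerivAt (fun y => f (q.1, y)) (Dx f q) q.2 := fun hf => by
        rw [Dx_eq_fderiv hf]
        exact hasDerivAt_slice_snd hf
      exact (hasDerivAt_const _ _).prodMk ((hasDerivAt_id _).prodMk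
        ((e h3).prodMk ((e h3').prodMk (e h3''))))
    have hX : HasDerivAt (fun y => (((q.1, X (graphPt u (q.1, y))) : Base)))
        (0, totalDx (X ∘ toTotal) (jet u q)) q.2 := by
      refine (hasDerivAt_const _ _).prodMk ?_
      have := HasFDerivAt.comp_hasDerivAt (x := q.2) (f := fun y => jet u (q.1, y))
        (l := X ∘ toTotal) (h.contDiffAt_liftX h2).diff.hasFDerivAt hjet
      have e := fderiv_jet_split (X ∘ toTotal) (jet u q) (Dx (Dx (Dx u)) q)
      rw [h.partialQ_X h2, mul_zero, add_zero] at e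
      rw [← e]
      exact this
    have e1 := Dx_comp (γ := fun q : Base => (q.1, X (graphPt u q))) h4 hX
    have e2 := Dx_comp (γ := jet u) (hA _ h2).diff hjet
    have e3 := fderiv_jet_split A (jet u q) (Dx (Dx (Dx u)) q)
    rw [hAq _ h2, mul_zero, add_zero, hAB _ h2] at e3
    have e4 : fderiv ℝ A (jet u q) (0, 1, Dx u q, Dx (Dx u) q, Dx (Dx (Dx u)) q)
      = B (jet u q) * totalDx (X ∘ toTotal) (jet u q) := e3
    have e5 : ((0, totalDx (X ∘ toTotal) (jet u q)) : Base)
        = totalDx (X ∘ toTotal) (jet u q) • (0, 1) := by simp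
    rw [Dx_congr h1, e2, e4, e5, map_smul, smul_eq_mul, mul_comm] at e1
    rw [Dx_eq_fderiv h4]
    exact (mul_left_cancel₀ (h.Dx_ne _ h2) e1).symm
  have h1 := step (A := U ∘ toTotal) hv hvu (fun i hi => h.contDiffAt_liftU hi)
    (fun i hi => h.partialQ_U hi) (fun i hi => h.totalDx_U hi)
  have h2 := step hv.Dx h1 (fun i hi => h.contDiffAt_newP hi)
    (fun i hi => h.partialQ_newP hi) (fun i hi => h.totalDx_newP hi)
  refine ⟨h1.self_of_nhds, h2.self_of_nhds, ?_, ?_⟩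
  · have e1 := h.Dx_comp_newBase hu hp hv.Dx.Dx.diff
    rw [Dx_congr h2, Dx_comp_jet hu (h.contDiffAt_newQ hp).diff, h.totalDx_newQ hp,
      h.partialQ_newQ hp] at e1
    refine mul_right_cancel₀ (h.Dx_ne _ hp) ?_
    rw [← e1]
    ring
  · have e1 := h.Dt_comp_newBase hu hp hv.diff
    have hU : DifferentiableAt ℝ U (graphPt u p) := (h.contDiffAt_U hp).diff
    rw [Dt_congr hvu, Dt_comp hU (hasDerivAt_graphPt_fst hu), h1.self_of_nhds] at e1
    have e : ((1, 0, Dt u p) : Total) = (1, 0, 0) + Dt u p • (0, 0, 1) := by simp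
    rw [e, map_add, map_add, map_smul, map_smul, smul_eq_mul, smul_eq_mul] at e1
    rw [timeA, timeB, toTotal_jet]
    linear_combination -e1

/-- The transformation takes the equation to the one with coefficients `newF`, `newG`. -/
theorem solvesAt_iff (h : IsAdapted J X U) {F G : Jet → ℝ} (hp : jet u p ∈ J) :
    SolvesAt F G u p ↔
      timeA X U (jet u p) + timeB X U (jet u p) * Dt u p
        = newF F X U (jet u p)
          * (thirdA X U (jet u p) + thirdB X U (jet u p) * Dx (Dx (Dx u)) p)
          + newG F G X U (jet u p) := by
  have hB := h.thirdB_ne hp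
  have hT := h.timeB_ne hp
  have e : newF F X U (jet u p) * thirdB X U (jet u p) = F (jet u p) * timeB X U (jet u p) :=
    div_mul_cancel₀ _ hB
  rw [SolvesAt, newG]
  constructor
  · intro hs
    rw [hs]
    linear_combination -Dx (Dx (Dx u)) p * e
  · intro hs
    refine mul_left_cancel₀ hT ?_
    linear_combination hs + Dx (Dx (Dx u)) p * e

/-! ### The symmetry condition in the new coordinates -/

/-- The action of the prolonged field passes from a quantity `A` to its derivative `B + B' u_xxx`
with respect to the new `x`. Commuting the field with `D_x` costs the factor `D_x ξ`; because `V X =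
0`, the divisor `D_x X` picks up the same factor, and the two cancel in the quotient. -/
theorem prolong_step (h : IsAdapted J X U) (hu : ContDiff ℝ ∞ u) {V : Total → Total}
    (hV : ContDiffOn ℝ ∞ V (toTotal '' J)) (hτ : ∀ q ∈ toTotal '' J, (V q).1 = 0)
    (hVX : ∀ q ∈ toTotal '' J, fderiv ℝ X q (V q) = 0) {A B B' : Jet → ℝ} {C C' : Base → ℝ}
    (hA : ∀ i ∈ J, ContDiffAt ℝ ∞ A i) (hB : ∀ i ∈ J, ContDiffAt ℝ ∞ B i)
    (hB' : ∀ i ∈ J, ContDiffAt ℝ ∞ B' i)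
    (hAB : ∀ i ∈ J, totalDx A i = B i * totalDx (X ∘ toTotal) i)
    (hAB' : ∀ i ∈ J, partialQ A i = B' i * totalDx (X ∘ toTotal) i)
    (hC : ∀ q, jet u q ∈ J → fderiv ℝ A (jet u q) (prolongJet V u q) = C q)
    (hC' : ∀ q, jet u q ∈ J → Dx C q = C' q * totalDx (X ∘ toTotal) (jet u q))
    (hp : jet u p ∈ J) :
    fderiv ℝ B (jet u p) (prolongJet V u p)
      + Dx (Dx (Dx u)) p * fderiv ℝ B' (jet u p) (prolongJet V u p)
      + B' (jet u p) * prolongX 3 V u p = C' p := by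
  have hΩ := isOpen_image_toTotal h.isOpen
  have hup : ContDiffAt ℝ ∞ u p := hu.contDiffAt
  have hnear : ∀ᶠ q in 𝓝 p, jet u q ∈ J :=
    hup.jet.continuousAt.eventually (h.isOpen.mem_nhds hp)
  have hVp : ContDiffAt ℝ ∞ V (graphPt u p) := hV.contDiffAt (hΩ.mem_nhds ⟨_, hp, rfl⟩)
  have hτp : ∀ᶠ q in 𝓝 p, (V (graphPt u q)).1 = 0 :=
    hnear.mono fun q hq => hτ _ ⟨_, hq, rfl⟩
  have e1 := prolong_totalDx hup hVp hτp (hA _ hp) (hnear.mono hC)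
  -- The commutation applied to the invariant `X` gives the variation of `D_x X`, namely `-D_x ξ ·
  -- D_x X`.
  have e2 := prolong_totalDx hup hVp hτp (h.contDiffAt_liftX hp) (C := fun _ => 0)
    (hnear.mono fun q hq => by
      rw [fderiv_comp_toTotal (h.contDiffAt_X hq).diff]
      exact hVX _ ⟨_, hq, rfl⟩)
  have hz : Dx (fun _ => (0 : ℝ)) p = 0 := deriv_const _ _
  have hq0 : fderiv ℝ (partialQ (X ∘ toTotal)) (jet u p) = 0 :=
    fderiv_eq_zero_of_eqOn_zero h.isOpen (fun i hi => h.partialQ_X hi) hp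
  rw [hz, hq0, h.partialQ_X hp] at e2
  simp only [zero_apply, mul_zero, zero_mul, add_zero, zero_sub] at e2
  have hD := (h.contDiffAt_liftX hp).totalDx.diff
  rw [fderiv_of_eqOn_mul h.isOpen hp (hB _ hp).diff hD hAB,
    fderiv_of_eqOn_mul h.isOpen hp (hB' _ hp).diff hD hAB', hAB _ hp, hAB' _ hp, hC' _ hp, e2]
    at e1
  refine mul_right_cancel₀ (h.Dx_ne _ hp) ?_
  linear_combination e1

end IsAdapted

end EvolEq
namespace EvolEq

namespace IsAdapted

variable {J : Set Jet} {X U : Total → ℝ} {F G : Jet → ℝ} {j : Jet}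

theorem contDiffAt_newF (h : IsAdapted J X U) (hF : ContDiffAt ℝ ∞ F j) (hj : j ∈ J) :
    ContDiffAt ℝ ∞ (newF F X U) j :=
  (hF.mul (h.contDiffAt_timeB hj)).div (h.contDiffAt_thirdB hj) (h.thirdB_ne hj)

theorem contDiffAt_newG (h : IsAdapted J X U) (hF : ContDiffAt ℝ ∞ F j)
    (hG : ContDiffAt ℝ ∞ G j) (hj : j ∈ J) : ContDiffAt ℝ ∞ (newG F G X U) j :=
  ((h.contDiffAt_timeA hj).add ((h.contDiffAt_timeB hj).mul hG)).sub
    ((h.contDiffAt_newF hF hj).mul (h.contDiffAt_thirdA hj))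

theorem newF_ne (h : IsAdapted J X U) (hF : F j ≠ 0) (hj : j ∈ J) : newF F X U j ≠ 0 :=
  div_ne_zero (mul_ne_zero hF (h.timeB_ne hj)) (h.thirdB_ne hj)

theorem fderiv_fderiv_comp_toTotal {Z : Total → ℝ} (hZ : ContDiffAt ℝ ∞ Z (toTotal j))
    (v : Total) (w : Jet) : fderiv ℝ (fun i => fderiv ℝ Z (toTotal i) v) j w
      = fderiv ℝ (fderiv ℝ Z) (toTotal j) (toTotal w) v := by
  rw [← fderiv_clm_apply_const hZ]
  exact fderiv_comp_toTotal (Z := fun q => fderiv ℝ Z q v)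
    (hZ.fderiv_infty.clm_apply contDiffAt_const).diff w

/-- The effect of the prolongation of a symmetry on the new coordinates of the jet space. -/
theorem prolong_coordinates (h : IsAdapted J X U) (hF : ContDiffOn ℝ ∞ F J)
    (hG : ContDiffOn ℝ ∞ G J) {V : Total → Total} (hV : ContDiffOn ℝ ∞ V (toTotal '' J))
    (hsym : IsPointSymmetry J F G V) (hτ : ∀ q ∈ toTotal '' J, (V q).1 = 0)
    (hVX : ∀ q ∈ toTotal '' J, fderiv ℝ X q (V q) = 0) {a : ℝ} {k : Base → ℝ}
    (hk : ∀ q ∈ toTotal '' J, ContDiffAt ℝ ∞ k (q.1, X q))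
    (hVU : ∀ q ∈ toTotal '' J, fderiv ℝ U q (V q) = a * U q + k (q.1, X q))
    {u : Base → ℝ} {p : Base} (hu : ContDiff ℝ ∞ u) (hp : jet u p ∈ J)
    (hsol : SolvesAt F G u p) :
    (prolongJet V u p).1 = 0 ∧
    fderiv ℝ (X ∘ toTotal) (jet u p) (prolongJet V u p) = 0 ∧
    fderiv ℝ (U ∘ toTotal) (jet u p) (prolongJet V u p)
      = a * U (graphPt u p) + k (p.1, X (graphPt u p)) ∧
    fderiv ℝ (newP X U) (jet u p) (prolongJet V u p)
      = a * newP X U (jet u p) + Dx k (p.1, X (graphPt u p)) ∧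
    fderiv ℝ (newQ X U) (jet u p) (prolongJet V u p)
      = a * newQ X U (jet u p) + Dx (Dx k) (p.1, X (graphPt u p)) ∧
    fderiv ℝ (newF F X U) (jet u p) (prolongJet V u p)
        * (thirdA X U (jet u p) + thirdB X U (jet u p) * Dx (Dx (Dx u)) p)
      + fderiv ℝ (newG F G X U) (jet u p) (prolongJet V u p)
      = a * newG F G X U (jet u p) + Dt k (p.1, X (graphPt u p))
        - newF F X U (jet u p) * Dx (Dx (Dx k)) (p.1, X (graphPt u p)) := by
  have hΩ := isOpen_image_toTotal h.isOpen
  have hus : ∀ {q}, ContDiffAt ℝ ∞ u q := hu.contDiffAt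
  have hmem : ∀ {q}, jet u q ∈ J → graphPt u q ∈ toTotal '' J := fun hq => ⟨_, hq, rfl⟩
  let φ : Base → Base := fun q => (q.1, X (graphPt u q))
  have hφ : ∀ {q}, jet u q ∈ J → ContDiffAt ℝ ∞ φ q := fun hq =>
    contDiffAt_fst.prodMk ((h.contDiffAt_X hq).comp (f := graphPt u) _ hus.graphPt)
  have hkφ : ∀ {q} {κ : Base → ℝ}, jet u q ∈ J → ContDiffAt ℝ ∞ κ (φ q) →
      ContDiffAt ℝ ∞ (fun q => κ (φ q)) q := fun hq hκ => hκ.comp _ (hφ hq)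
  have hcomp : ∀ {q} {A : Jet → ℝ}, ContDiffAt ℝ ∞ A (jet u q) →
      ContDiffAt ℝ ∞ (fun q => A (jet u q)) q := fun hA => hA.comp _ hus.jet
  have hK : ∀ {q}, jet u q ∈ J → ContDiffAt ℝ ∞ k (φ q) := fun hq => hk _ (hmem hq)
  -- the recursion for the right-hand sides
  have hrec : ∀ {A B B' : Jet → ℝ} {κ : Base → ℝ} {q : Base}, jet u q ∈ J →
      ContDiffAt ℝ ∞ A (jet u q) → ContDiffAt ℝ ∞ κ (φ q) →
      totalDx A (jet u q) = B (jet u q) * totalDx (X ∘ toTotal) (jet u q) →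
      partialQ A (jet u q) = B' (jet u q) * totalDx (X ∘ toTotal) (jet u q) →
      Dx (fun q => a * A (jet u q) + κ (φ q)) q
        = (a * (B (jet u q) + B' (jet u q) * Dx (Dx (Dx u)) q) + Dx κ (φ q))
          * totalDx (X ∘ toTotal) (jet u q) := by
    intro A B B' κ q hq hA hκ h1 h2
    have e0 : Dx (fun _ : Base => a) q = 0 := deriv_const _ _
    rw [Dx_add (contDiffAt_const.mul (hcomp hA)) (hkφ hq hκ), Dx_mul contDiffAt_const (hcomp hA),
      e0, Dx_comp_jet hus hA.diff, h.Dx_comp_newBase hus hq hκ.diff, h1, h2]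
    simp only [φ]
    ring
  have c0 : ∀ q, jet u q ∈ J → fderiv ℝ (U ∘ toTotal) (jet u q) (prolongJet V u q)
      = a * (U ∘ toTotal) (jet u q) + k (φ q) := fun q hq => by
    rw [fderiv_comp_toTotal (h.contDiffAt_U hq).diff]
    exact hVU _ (hmem hq)
  have hz : ∀ i ∈ J, ContDiffAt ℝ ∞ (fun _ : Jet => (0 : ℝ)) i := fun _ _ => contDiffAt_const
  have c1 : ∀ q, jet u q ∈ J → fderiv ℝ (newP X U) (jet u q) (prolongJet V u q)
      = a * newP X U (jet u q) + Dx k (φ q) := fun q hq => by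
    have := h.prolong_step hu hV hτ hVX (A := U ∘ toTotal) (B := newP X U) (B' := fun _ => 0)
      (C' := fun q => a * (newP X U (jet u q) + 0 * Dx (Dx (Dx u)) q) + Dx k (φ q))
      (fun i hi => h.contDiffAt_liftU hi) (fun i hi => h.contDiffAt_newP hi) hz
      (fun i hi => h.totalDx_U hi) (fun i hi => by rw [h.partialQ_U hi, zero_mul]) c0
      (fun q hq => hrec (B := newP X U) (B' := fun _ => 0) hq (h.contDiffAt_liftU hq) (hK hq)
        (h.totalDx_U hq) (by rw [h.partialQ_U hq, zero_mul])) hq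
    simpa using this
  have c2 : ∀ q, jet u q ∈ J → fderiv ℝ (newQ X U) (jet u q) (prolongJet V u q)
      = a * newQ X U (jet u q) + Dx (Dx k) (φ q) := fun q hq => by
    have := h.prolong_step hu hV hτ hVX (A := newP X U) (B := newQ X U) (B' := fun _ => 0)
      (C' := fun q => a * (newQ X U (jet u q) + 0 * Dx (Dx (Dx u)) q) + Dx (Dx k) (φ q))
      (fun i hi => h.contDiffAt_newP hi) (fun i hi => h.contDiffAt_newQ hi) hz
      (fun i hi => h.totalDx_newP hi) (fun i hi => by rw [h.partialQ_newP hi, zero_mul]) c1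
      (fun q hq => hrec (B := newQ X U) (B' := fun _ => 0) hq (h.contDiffAt_newP hq) (hK hq).Dx
        (h.totalDx_newP hq) (by rw [h.partialQ_newP hq, zero_mul])) hq
    simpa using this
  have c3 := h.prolong_step hu hV hτ hVX (A := newQ X U) (B := thirdA X U) (B' := thirdB X U)
      (C' := fun q => a * (thirdA X U (jet u q) + thirdB X U (jet u q) * Dx (Dx (Dx u)) q)
        + Dx (Dx (Dx k)) (φ q))
      (fun i hi => h.contDiffAt_newQ hi) (fun i hi => h.contDiffAt_thirdA hi)
      (fun i hi => h.contDiffAt_thirdB hi)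
      (fun i hi => h.totalDx_newQ hi) (fun i hi => h.partialQ_newQ hi) c2
      (fun q hq => hrec hq (h.contDiffAt_newQ hq) (hK hq).Dx.Dx
        (h.totalDx_newQ hq) (h.partialQ_newQ hq)) hp
  have hVp : ContDiffAt ℝ ∞ V (graphPt u p) := hV.contDiffAt (hΩ.mem_nhds (hmem hp))
  have hnear : ∀ᶠ q in 𝓝 p, jet u q ∈ J :=
    hus.jet.continuousAt.eventually (h.isOpen.mem_nhds hp)
  have hτp : ∀ᶠ q in 𝓝 p, (V (graphPt u q)).1 = 0 := hnear.mono fun q hq => hτ _ (hmem hq)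
  have hXp : ContDiffAt ℝ ∞ X (graphPt u p) := h.contDiffAt_X hp
  have hUp : ContDiffAt ℝ ∞ U (graphPt u p) := h.contDiffAt_U hp
  -- the `t`-derivative
  have tX := prolong_totalDt hus hVp hτp hXp (C := fun _ => 0)
    (hnear.mono fun q hq => hVX _ (hmem hq))
  have tU := prolong_totalDt hus hVp hτp hUp (C := fun q => a * U (graphPt u q) + k (φ q))
    (hnear.mono fun q hq => hVU _ (hmem hq))
  have hU' : ContDiffAt ℝ ∞ (fun q => U (graphPt u q)) p := hUp.comp p hus.graphPt
  have e0 : Dt (fun _ : Base => a) p = 0 := deriv_const _ _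
  have e0' : Dt (fun _ : Base => (0 : ℝ)) p = 0 := deriv_const _ _
  rw [Dt_add (contDiffAt_const.mul hU') (hkφ hp (hK hp)), Dt_mul contDiffAt_const hU', e0,
    Dt_comp hUp.diff (hasDerivAt_graphPt_fst hus), h.Dt_comp_newBase hus hp (hK hp).diff] at tU
  rw [e0'] at tX
  have d1 := h.totalDx_U hp
  rw [totalDx_lift (h.contDiffAt_X hp).diff, totalDx_lift (h.contDiffAt_U hp).diff] at d1
  have d1' : fderiv ℝ U (graphPt u p) (0, 1, Dx u p)
    = newP X U (jet u p) * fderiv ℝ X (graphPt u p) (0, 1, Dx u p) := d1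
  have hsplit : ∀ l : Total →L[ℝ] ℝ, l (1, 0, Dt u p) = l (1, 0, 0) + Dt u p * l (0, 0, 1) := by
    intro l
    have : ((1, 0, Dt u p) : Total) = (1, 0, 0) + Dt u p • (0, 0, 1) := by simp
    rw [this, map_add, map_smul, smul_eq_mul]
  rw [hsplit] at tX tU
  rw [hsplit, hsplit (fderiv ℝ X (graphPt u p))] at tU
  have fA : ∀ v : Total, fderiv ℝ (fun i => fderiv ℝ U (toTotal i) v
      - newP X U i * fderiv ℝ X (toTotal i) v) (jet u p) (prolongJet V u p)
      = fderiv ℝ (fderiv ℝ U) (graphPt u p) (V (graphPt u p)) v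
        - (fderiv ℝ (newP X U) (jet u p) (prolongJet V u p) * fderiv ℝ X (graphPt u p) v
          + newP X U (jet u p) * fderiv ℝ (fderiv ℝ X) (graphPt u p) (V (graphPt u p)) v) := by
    intro v
    have hm := fderiv_of_eqOn_mul h.isOpen hp (h.contDiffAt_newP hp).diff
      (h.contDiffAt_fderiv_X hp v).diff (fun i _ => rfl) (prolongJet V u p)
    rw [fderiv_fun_sub (h.contDiffAt_fderiv_U hp v).diff
      ((h.contDiffAt_newP hp).mul (h.contDiffAt_fderiv_X hp v)).diff, sub_apply, hm,
      fderiv_fderiv_comp_toTotal (h.contDiffAt_X hp), fderiv_fderiv_comp_toTotal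
      (h.contDiffAt_U hp)]
    rfl
  have fA1 : fderiv ℝ (timeA X U) (jet u p) (prolongJet V u p) = _ := fA (1, 0, 0)
  have fB1 : fderiv ℝ (timeB X U) (jet u p) (prolongJet V u p) = _ := fA (0, 0, 1)
  rw [c1 p hp] at fA1 fB1
  -- the equation in the new variables
  have hFp : ContDiffAt ℝ ∞ F (jet u p) := hF.contDiffAt (h.isOpen.mem_nhds hp)
  have hGp : ContDiffAt ℝ ∞ G (jet u p) := hG.contDiffAt (h.isOpen.mem_nhds hp)
  have hnF := h.contDiffAt_newF hFp hp
  have m1 : ∀ i ∈ J, F i * timeB X U i = newF F X U i * thirdB X U i := fun i hi =>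
    (div_mul_cancel₀ _ (h.thirdB_ne hi)).symm
  have m2 := fderiv_of_eqOn_mul h.isOpen hp hnF.diff (h.contDiffAt_thirdB hp).diff m1
    (prolongJet V u p)
  rw [fderiv_of_eqOn_mul h.isOpen hp hFp.diff (h.contDiffAt_timeB hp).diff (fun i _ => rfl)] at m2
  have m3 : fderiv ℝ (newG F G X U) (jet u p) (prolongJet V u p)
      = fderiv ℝ (timeA X U) (jet u p) (prolongJet V u p)
        + (fderiv ℝ (timeB X U) (jet u p) (prolongJet V u p) * G (jet u p)
          + timeB X U (jet u p) * fderiv ℝ G (jet u p) (prolongJet V u p))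
        - (fderiv ℝ (newF F X U) (jet u p) (prolongJet V u p) * thirdA X U (jet u p)
          + newF F X U (jet u p) * fderiv ℝ (thirdA X U) (jet u p) (prolongJet V u p)) := by
    have a1 := fderiv_of_eqOn_mul h.isOpen hp (h.contDiffAt_timeB hp).diff hGp.diff
      (fun i _ => rfl) (prolongJet V u p)
    have a2 := fderiv_of_eqOn_mul h.isOpen hp hnF.diff (h.contDiffAt_thirdA hp).diff
      (fun i _ => rfl) (prolongJet V u p)
    rw [← a1, ← a2]
    have hs := fderiv_fun_sub (𝕜 := ℝ) (x := jet u p)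
      ((h.contDiffAt_timeA hp).add ((h.contDiffAt_timeB hp).mul hGp)).diff
      (hnF.mul (h.contDiffAt_thirdA hp)).diff
    have hs' : fderiv ℝ (newG F G X U) (jet u p) = _ := hs
    have ha := fderiv_fun_add (𝕜 := ℝ) (x := jet u p) (h.contDiffAt_timeA hp).diff
      ((h.contDiffAt_timeB hp).mul hGp).diff
    rw [hs', sub_apply]
    congr 1
    exact congrArg (fun l : Jet →L[ℝ] ℝ => l (prolongJet V u p)) ha
  have hs := hsym u p hu hp hsol
  have hsol' : Dt u p = F (jet u p) * Dx (Dx (Dx u)) p + G (jet u p) := hsol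
  have m1p := m1 _ hp
  have mG : newG F G X U (jet u p) = timeA X U (jet u p) + timeB X U (jet u p) * G (jet u p)
    - newF F X U (jet u p) * thirdA X U (jet u p) := rfl
  have tA : timeA X U (jet u p) = fderiv ℝ U (graphPt u p) (1, 0, 0)
    - newP X U (jet u p) * fderiv ℝ X (graphPt u p) (1, 0, 0) := rfl
  have tB : timeB X U (jet u p) = fderiv ℝ U (graphPt u p) (0, 0, 1)
    - newP X U (jet u p) * fderiv ℝ X (graphPt u p) (0, 0, 1) := rfl
  have hφp : φ p = (p.1, X (graphPt u p)) := rfl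
  rw [hφp] at c3 fA1 fB1
  refine ⟨hτ _ (hmem hp), ?_, c0 p hp, c1 p hp, c2 p hp, ?_⟩
  · rw [fderiv_comp_toTotal (h.contDiffAt_X hp).diff]
    exact hVX _ (hmem hp)
  -- prolongation of the new `t`-derivative
  have ht : fderiv ℝ (timeA X U) (jet u p) (prolongJet V u p)
      + fderiv ℝ (timeB X U) (jet u p) (prolongJet V u p) * Dt u p
      + timeB X U (jet u p) * prolongT V u p
      = a * (timeA X U (jet u p) + timeB X U (jet u p) * Dt u p)
        + Dt k (p.1, X (graphPt u p)) := by
    rw [fA1, fB1, tA, tB]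
    linear_combination tU - newP X U (jet u p) * tX
      - Dt (fun q => (V (graphPt u q)).2.1) p * d1'
  -- The variation of the new `t`-derivative minus `newF` times that of the new third derivative.
  -- The symmetry condition eliminates `prolongT`, the relation `F · timeB = newF · thirdB` and its
  -- derivative eliminate the old coefficient, and the equation eliminates `u_t`.
  rw [m3]
  linear_combination ht - newF F X U (jet u p) * c3 - timeB X U (jet u p) * hs
    - Dx (Dx (Dx u)) p * m2 + (a * Dx (Dx (Dx u)) p - prolongX 3 V u p) * m1p - a * mG
    + (a * timeB X U (jet u p)
      - fderiv ℝ (timeB X U) (jet u p) (prolongJet V u p)) * hsol'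

end IsAdapted

end EvolEq
namespace EvolEq

/-! ### Equations `v_t = F v_xxx + G` with the symmetries `∂_v`, `x ∂_v`, `(a v + k(t, x)) ∂_v` -/

section Target

theorem fderiv_comp_base {κ : Base → ℝ} {z : Jet} (hκ : DifferentiableAt ℝ κ (z.1, z.2.1))
    (w : Jet) :
    fderiv ℝ (fun y : Jet => κ (y.1, y.2.1)) z w = fderiv ℝ κ (z.1, z.2.1) (w.1, w.2.1) := by
  let l : Jet →L[ℝ] Base := (ContinuousLinearMap.fst ℝ ℝ _).prod
    ((ContinuousLinearMap.fst ℝ ℝ _).comp (ContinuousLinearMap.snd ℝ ℝ _))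
  have h : HasFDerivAt (fun y : Jet => κ (y.1, y.2.1)) ((fderiv ℝ κ (z.1, z.2.1)).comp l) z :=
    HasFDerivAt.comp (g := κ) (f := l) z hκ.hasFDerivAt l.hasFDerivAt
  rw [h.fderiv]
  rfl

/-- A function on a ball of the jet space depends on `(t, x)` only, if the other partial
derivatives vanish. -/
theorem eq_of_fibre_fderiv_eq_zero {H : Jet → ℝ} {z : Jet} {r : ℝ}
    (hd : ∀ y ∈ Metric.ball z r, DifferentiableAt ℝ H y)
    (h3 : ∀ y ∈ Metric.ball z r, fderiv ℝ H y (0, 0, 1, 0, 0) = 0)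
    (h4 : ∀ y ∈ Metric.ball z r, fderiv ℝ H y (0, 0, 0, 1, 0) = 0)
    (h5 : ∀ y ∈ Metric.ball z r, fderiv ℝ H y (0, 0, 0, 0, 1) = 0) :
    ∀ y ∈ Metric.ball z r, H y = H (y.1, y.2.1, z.2.2) := by
  intro y hy
  have hy' : ((y.1, y.2.1, z.2.2) : Jet) ∈ Metric.ball z r := by
    simp only [Metric.mem_ball, Prod.dist_eq, dist_self] at hy ⊢
    exact lt_of_le_of_lt (max_le_max le_rfl (max_le_max le_rfl (le_max_of_le_left dist_nonneg))) hy
  refine eq_of_fderiv_sub_eq_zero (convex_ball z r) hd hy' hy fun i hi => ?_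
  obtain ⟨y1, y2, y3, y4, y5⟩ := y
  obtain ⟨z1, z2, z3, z4, z5⟩ := z
  have : ((y1, y2, y3, y4, y5) : Jet) - (y1, y2, z3, z4, z5)
      = (y3 - z3) • (0, 0, 1, 0, 0) + (y4 - z4) • (0, 0, 0, 1, 0)
        + (y5 - z5) • (0, 0, 0, 0, 1) := by simp
  simp only
  rw [this, map_add, map_add, map_smul, map_smul, map_smul, h3 i hi, h4 i hi, h5 i hi]
  simp

/-- `(a v + k(t, x)) ∂_v` is a symmetry of `v_t = F v_xxx + G`, expressed on the jet space. -/
def IsAffineSymmetry (S : Set Jet) (F G : Jet → ℝ) (a : ℝ) (k : Base → ℝ) : Prop :=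
  ∀ z ∈ S,
    fderiv ℝ F z (0, 0, a * z.2.2.1 + k (z.1, z.2.1), a * z.2.2.2.1 + Dx k (z.1, z.2.1),
      a * z.2.2.2.2 + Dx (Dx k) (z.1, z.2.1)) = 0 ∧
    fderiv ℝ G z (0, 0, a * z.2.2.1 + k (z.1, z.2.1), a * z.2.2.2.1 + Dx k (z.1, z.2.1),
      a * z.2.2.2.2 + Dx (Dx k) (z.1, z.2.1))
      = a * G z + Dt k (z.1, z.2.1) - F z * Dx (Dx (Dx k)) (z.1, z.2.1)

variable {S : Set Jet} {F G : Jet → ℝ} {a : ℝ} {k : Base → ℝ}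

theorem IsAffineSymmetry.of_one (h : IsAffineSymmetry S F G 0 fun _ => 1) {z : Jet}
    (hz : z ∈ S) :
    fderiv ℝ F z (0, 0, 1, 0, 0) = 0 ∧ fderiv ℝ G z (0, 0, 1, 0, 0) = 0 := by
  have e1 : Dx (fun _ => (1 : ℝ)) = fun _ => 0 := Dx_eq_of_hasDerivAt fun _ _ => hasDerivAt_const _ _
  have e0 : Dx (fun _ => (0 : ℝ)) = fun _ => 0 := Dx_eq_of_hasDerivAt fun _ _ => hasDerivAt_const _ _
  have et : Dt (fun _ => (1 : ℝ)) = fun _ => 0 := Dt_eq_of_hasDerivAt fun _ _ => hasDerivAt_const _ _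
  have := h z hz
  simp only [e1, e0, et] at this
  simpa using this

/-- The symmetry `x ∂_v` prolongs to `x ∂_v + ∂_{v_x}`, and its first term already annihilates `F`
and `G`. -/
theorem IsAffineSymmetry.of_x (h1 : IsAffineSymmetry S F G 0 fun _ => 1)
    (h : IsAffineSymmetry S F G 0 fun q => q.2) {z : Jet} (hz : z ∈ S) :
    fderiv ℝ F z (0, 0, 0, 1, 0) = 0 ∧ fderiv ℝ G z (0, 0, 0, 1, 0) = 0 := by
  have ex : Dx (fun q : Base => q.2) = fun _ => 1 := Dx_eq_of_hasDerivAt fun _ _ => hasDerivAt_id _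
  have e1 : Dx (fun _ => (1 : ℝ)) = fun _ => 0 := Dx_eq_of_hasDerivAt fun _ _ => hasDerivAt_const _ _
  have e0 : Dx (fun _ => (0 : ℝ)) = fun _ => 0 := Dx_eq_of_hasDerivAt fun _ _ => hasDerivAt_const _ _
  have et : Dt (fun q : Base => q.2) = fun _ => 0 :=
    Dt_eq_of_hasDerivAt fun _ _ => hasDerivAt_const _ _
  have h2 := h z hz
  have h3 := h1.of_one hz
  have e : ((0, 0, 0 * z.2.2.1 + z.2.1, 0 * z.2.2.2.1 + 1, 0 * z.2.2.2.2 + 0) : Jet)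
      = z.2.1 • (0, 0, 1, 0, 0) + (0, 0, 0, 1, 0) := by simp
  simp only [ex, e1, e0, et] at h2
  rw [e, map_add, map_add, map_smul, map_smul, h3.1, h3.2] at h2
  simpa using h2

/-- Such an equation is linear near some point, unless the third symmetry is a combination of
the other two. -/
theorem linear_of_isAffineSymmetry (hS : IsOpen S) (hne : S.Nonempty)
    (hF : ContDiffOn ℝ ∞ F S) (hG : ContDiffOn ℝ ∞ G S)
    (hk : ∀ z ∈ S, ContDiffAt ℝ ∞ k (z.1, z.2.1))
    (h1 : IsAffineSymmetry S F G 0 fun _ => 1) (h2 : IsAffineSymmetry S F G 0 fun q => q.2)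
    (h3 : IsAffineSymmetry S F G a k) :
    (∃ z ∈ S, ∃ r > 0, Metric.ball z r ⊆ S ∧ ∃ f₁ f₂ f₅ : Base → ℝ,
      ContDiffOn ℝ ∞ f₁ (Metric.ball (z.1, z.2.1) r) ∧
      ContDiffOn ℝ ∞ f₂ (Metric.ball (z.1, z.2.1) r) ∧
      ContDiffOn ℝ ∞ f₅ (Metric.ball (z.1, z.2.1) r) ∧
      ∀ y ∈ Metric.ball z r, F y = f₁ (y.1, y.2.1) ∧
        G y = f₂ (y.1, y.2.1) * y.2.2.2.2 + f₅ (y.1, y.2.1)) ∨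
    (a = 0 ∧ ∃ β γ : ℝ, ∃ z ∈ S, ∃ r > 0, Metric.ball z r ⊆ S ∧
      ∀ y ∈ Metric.ball z r, k (y.1, y.2.1) = β * y.2.1 + γ) := by
  have hFz : ∀ z ∈ S, ContDiffAt ℝ ∞ F z := fun z hz => hF.contDiffAt (hS.mem_nhds hz)
  have hGz : ∀ z ∈ S, ContDiffAt ℝ ∞ G z := fun z hz => hG.contDiffAt (hS.mem_nhds hz)
  -- `M` is the `v_xx`-component of the third prolonged symmetry, the only one that still acts on
  -- `F` and `G`.
  let M : Jet → ℝ := fun z => a * z.2.2.2.2 + Dx (Dx k) (z.1, z.2.1)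
  have hproj : ContDiff ℝ ∞ fun z : Jet => ((z.1, z.2.1) : Base) := by fun_prop
  have hcomp : ∀ {κ : Base → ℝ} {z : Jet}, ContDiffAt ℝ ∞ κ (z.1, z.2.1) →
      ContDiffAt ℝ ∞ (fun y : Jet => κ (y.1, y.2.1)) z := fun {κ z} hκ =>
    ContDiffAt.comp (g := κ) (f := fun z : Jet => ((z.1, z.2.1) : Base)) z hκ hproj.contDiffAt
  have hMz : ∀ z ∈ S, ContDiffAt ℝ ∞ M z := fun z hz =>
    (ContDiff.contDiffAt (by fun_prop)).add (hcomp (hk z hz).Dx.Dx)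
  have h3' : ∀ z ∈ S, partialQ F z * M z = 0 ∧
      partialQ G z * M z
        = a * G z + Dt k (z.1, z.2.1) - F z * Dx (Dx (Dx k)) (z.1, z.2.1) := by
    intro z hz
    have e := h3 z hz
    have d : ∀ x y w : ℝ, ((0, 0, x, y, w) : Jet)
        = x • (0, 0, 1, 0, 0) + y • (0, 0, 0, 1, 0) + w • (0, 0, 0, 0, 1) := by simp
    rw [d] at e
    simp only [map_add, map_smul, (h1.of_one hz).1, (h1.of_one hz).2, (h1.of_x h2 hz).1,
      (h1.of_x h2 hz).2, smul_eq_mul, mul_zero, zero_add] at e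
    exact ⟨by rw [mul_comm]; exact e.1, by rw [mul_comm]; exact e.2⟩
  by_cases hM : ∃ z ∈ S, M z ≠ 0
  · left
    obtain ⟨z, hz, hMne⟩ := hM
    have hev : ∀ᶠ y in 𝓝 z, y ∈ S ∧ M y ≠ 0 :=
      Filter.Eventually.and (hS.mem_nhds hz) ((hMz z hz).continuousAt.eventually_ne hMne)
    obtain ⟨r, hr, hball⟩ := Metric.eventually_nhds_iff_ball.1 hev
    have hsub : Metric.ball z r ⊆ S := fun y hy => (hball y hy).1
    have hF5 : ∀ y ∈ Metric.ball z r, partialQ F y = 0 := fun y hy =>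
      (mul_eq_zero.1 (h3' y (hsub hy)).1).resolve_right (hball y hy).2
    have hgs : ∀ y ∈ S, ContDiffAt ℝ ∞ (partialQ G) y := fun y hy => (hGz y hy).partialQ
    have hsymm : ∀ y ∈ S, ∀ v : Jet, (∀ i ∈ S, fderiv ℝ G i v = 0) →
        fderiv ℝ (partialQ G) y v = 0 := by
      intro y hy v hv
      rw [fderiv_partialQ (hGz y hy), fderiv_fderiv_symm (hGz y hy),
        ← fderiv_clm_apply_const (hGz y hy), fderiv_eq_zero_of_eqOn_zero hS hv hy]
      rfl
    have g3 : ∀ y ∈ S, fderiv ℝ (partialQ G) y (0, 0, 1, 0, 0) = 0 := fun y hy =>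
      hsymm y hy _ fun i hi => (h1.of_one hi).2
    have g4 : ∀ y ∈ S, fderiv ℝ (partialQ G) y (0, 0, 0, 1, 0) = 0 := fun y hy =>
      hsymm y hy _ fun i hi => (h1.of_x h2 hi).2
    have hbase : ∀ {κ : Base → ℝ} {y : Jet}, ContDiffAt ℝ ∞ κ (y.1, y.2.1) →
        fderiv ℝ (fun y : Jet => κ (y.1, y.2.1)) y (0, 0, 0, 0, 1) = 0 := fun hκ => by
      rw [fderiv_comp_base hκ.diff]
      exact map_zero _
    let l₅ : Jet →L[ℝ] ℝ := (ContinuousLinearMap.snd ℝ ℝ ℝ).comp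
      ((ContinuousLinearMap.snd ℝ ℝ _).comp
      ((ContinuousLinearMap.snd ℝ ℝ _).comp (ContinuousLinearMap.snd ℝ ℝ _)))
    have hl₅ : ∀ y, HasFDerivAt (fun y : Jet => y.2.2.2.2) l₅ y := fun y => l₅.hasFDerivAt
    -- Differentiating `G_q M = a G + k_t - F k_xxx` in `q`, where `M_q = a` and `F_q = 0`, the
    -- terms `a G_q` cancel and `G_qq M = 0` remains.
    have g5 : ∀ y ∈ Metric.ball z r, fderiv ℝ (partialQ G) y (0, 0, 0, 0, 1) = 0 := by
      intro y hy
      have hyS := hsub hy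
      have hky := hk y hyS
      have e1 := fderiv_of_eqOn_mul hS hyS (hgs y hyS).diff (hMz y hyS).diff
        (fun i hi => ((h3' i hi).2).symm) (0, 0, 0, 0, 1)
      have eM : fderiv ℝ M y (0, 0, 0, 0, 1) = a := by
        have e2 : fderiv ℝ M y = fderiv ℝ (fun y : Jet => a * y.2.2.2.2) y
            + fderiv ℝ (fun y : Jet => Dx (Dx k) (y.1, y.2.1)) y :=
          fderiv_fun_add ((hl₅ y).const_mul a).differentiableAt (hcomp hky.Dx.Dx).diff
        rw [e2, add_apply, hbase hky.Dx.Dx, ((hl₅ y).const_mul a).fderiv]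
        simp [l₅]
      have eF := fderiv_of_eqOn_mul hS hyS (hFz y hyS).diff (hcomp hky.Dx.Dx.Dx).diff
        (fun i _ => rfl) (0, 0, 0, 0, 1)
      have eFy : fderiv ℝ F y (0, 0, 0, 0, 1) = 0 := hF5 y hy
      rw [hbase hky.Dx.Dx.Dx, eFy, zero_mul, mul_zero, add_zero] at eF
      have d1 : DifferentiableAt ℝ (fun y => a * G y) y := (hGz y hyS).diff.const_mul a
      have d2 : DifferentiableAt ℝ (fun y : Jet => Dt k (y.1, y.2.1)) y := (hcomp hky.Dt).diff
      have d3 : DifferentiableAt ℝ (fun y : Jet => F y * Dx (Dx (Dx k)) (y.1, y.2.1)) y :=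
        (hFz y hyS).diff.mul (hcomp hky.Dx.Dx.Dx).diff
      have d12 : DifferentiableAt ℝ (fun y : Jet => a * G y + Dt k (y.1, y.2.1)) y := d1.add d2
      rw [fderiv_fun_sub d12 d3, fderiv_fun_add d1 d2, fderiv_const_mul (hGz y hyS).diff, eM,
        sub_apply, add_apply, eF, hbase hky.Dt] at e1
      have e3 : fderiv ℝ (partialQ G) y (0, 0, 0, 0, 1) * M y = 0 := by
        have : (a • fderiv ℝ G y) (0, 0, 0, 0, 1) = a * partialQ G y := rfl
        rw [this] at e1
        linear_combination -e1
      exact (mul_eq_zero.1 e3).resolve_right (hball y hy).2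
    -- As `G_qq = 0`, the remainder after removing the part linear in `v_xx` depends on `(t, x)`
    -- only.
    let H : Jet → ℝ := fun y => G y - partialQ G y * y.2.2.2.2
    have hHs : ∀ y ∈ S, ContDiffAt ℝ ∞ H y := fun y hy =>
      (hGz y hy).sub ((hgs y hy).mul (ContDiff.contDiffAt (by fun_prop)))
    have hHd : ∀ y ∈ S, ∀ v : Jet, fderiv ℝ H y v = fderiv ℝ G y v
        - (fderiv ℝ (partialQ G) y v * y.2.2.2.2 + partialQ G y * v.2.2.2.2) := by
      intro y hy v
      have e1 := fderiv_of_eqOn_mul hS hy (hgs y hy).diff (hl₅ y).differentiableAt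
        (fun i _ => rfl) v
      rw [(hl₅ y).fderiv] at e1
      have e2 : fderiv ℝ H y = _ := fderiv_fun_sub (hGz y hy).diff
        ((hgs y hy).diff.mul (hl₅ y).differentiableAt)
      rw [e2, sub_apply, e1]
      rfl
    have iF := eq_of_fibre_fderiv_eq_zero (H := F) (z := z) (r := r)
      (fun y hy => (hFz y (hsub hy)).diff) (fun y hy => (h1.of_one (hsub hy)).1)
      (fun y hy => (h1.of_x h2 (hsub hy)).1) hF5
    have ig := eq_of_fibre_fderiv_eq_zero (H := partialQ G) (z := z) (r := r)
      (fun y hy => (hgs y (hsub hy)).diff) (fun y hy => g3 y (hsub hy))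
      (fun y hy => g4 y (hsub hy)) g5
    have iH := eq_of_fibre_fderiv_eq_zero (H := H) (z := z) (r := r)
      (fun y hy => (hHs y (hsub hy)).diff)
      (fun y hy => by
        rw [hHd y (hsub hy), g3 y (hsub hy), (h1.of_one (hsub hy)).2]
        simp)
      (fun y hy => by
        rw [hHd y (hsub hy), g4 y (hsub hy), (h1.of_x h2 (hsub hy)).2]
        simp)
      (fun y hy => by
        rw [hHd y (hsub hy), g5 y hy, partialQ]
        simp)
    have hmem : ∀ b ∈ Metric.ball ((z.1, z.2.1) : Base) r,
        ((b.1, b.2, z.2.2) : Jet) ∈ Metric.ball z r := by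
      intro b hb
      simp only [Metric.mem_ball, Prod.dist_eq, dist_self] at hb ⊢
      have h0 : (0 : ℝ) < r := hr
      simpa [max_lt_iff, h0] using hb
    have hsm : ∀ {A : Jet → ℝ}, (∀ y ∈ S, ContDiffAt ℝ ∞ A y) →
        ContDiffOn ℝ ∞ (fun b : Base => A (b.1, b.2, z.2.2))
          (Metric.ball ((z.1, z.2.1) : Base) r) := by
      intro A hA b hb
      have hi : ContDiff ℝ ∞ fun b : Base => ((b.1, b.2, z.2.2) : Jet) := by fun_prop
      exact (ContDiffAt.comp (g := A) (f := fun b : Base => ((b.1, b.2, z.2.2) : Jet)) b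
        (hA _ (hsub (hmem b hb))) hi.contDiffAt).contDiffWithinAt
    refine ⟨z, hz, r, hr, hsub, fun b => F (b.1, b.2, z.2.2),
      fun b => partialQ G (b.1, b.2, z.2.2), fun b => H (b.1, b.2, z.2.2), hsm hFz, hsm hgs,
      hsm hHs, fun y hy => ⟨iF y hy, ?_⟩⟩
    simp only
    rw [← ig y hy, ← iH y hy]
    simp only [H]
    ring
  · right
    push Not at hM
    obtain ⟨z, hz⟩ := hne
    obtain ⟨r, hr, hsub⟩ := Metric.isOpen_iff.1 hS z hz
    -- Moving `v_xx` by `r / 2` at fixed `(t, x)` changes `M = 0` by `a r / 2`.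
    have ha : a = 0 := by
      have hz' : ((z.1, z.2.1, z.2.2.1, z.2.2.2.1, z.2.2.2.2 + r / 2) : Jet) ∈ S := by
        refine hsub ?_
        simp only [Metric.mem_ball, Prod.dist_eq, dist_self, max_lt_iff, Real.dist_eq]
        refine ⟨hr, hr, hr, hr, ?_⟩
        rw [add_sub_cancel_left, abs_of_pos (by positivity)]
        linarith
      have e1 := hM z hz
      have e2 := hM _ hz'
      simp only [M] at e1 e2
      have : a * (r / 2) = 0 := by linear_combination e2 - e1
      exact (mul_eq_zero.1 this).resolve_right (by positivity)
    subst ha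
    refine ⟨rfl, ?_⟩
    let B : Set Base := Metric.ball (z.1, z.2.1) r
    have hBmem : ∀ b ∈ B, ((b.1, b.2, z.2.2) : Jet) ∈ S := by
      intro b hb
      refine hsub ?_
      simp only [B, Metric.mem_ball, Prod.dist_eq, dist_self] at hb ⊢
      have h0 : (0 : ℝ) < r := hr
      simpa [max_lt_iff, h0] using hb
    have hkB : ∀ b ∈ B, ContDiffAt ℝ ∞ k b := fun b hb => hk _ (hBmem b hb)
    have hBo : IsOpen B := Metric.isOpen_ball
    have kxx : ∀ b ∈ B, Dx (Dx k) b = 0 := fun b hb => by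
      have := hM _ (hBmem b hb)
      simpa [M] using this
    have hDz : ∀ {κ : Base → ℝ} {b : Base}, b ∈ B → (∀ b ∈ B, κ b = 0) → Dx κ b = 0 := by
      intro κ b hb hκ
      have : κ =ᶠ[𝓝 b] fun _ => 0 := by
        filter_upwards [hBo.mem_nhds hb] with c hc using hκ c hc
      rw [Dx_congr this]
      exact deriv_const _ _
    -- With `M = 0`, `a = 0` and `k_xx = 0` on an open set, the condition on `G` reduces to `k_t =
    -- 0`.
    have kt : ∀ b ∈ B, Dt k b = 0 := fun b hb => by
      have := (h3' _ (hBmem b hb)).2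
      simp only [M] at this
      rw [kxx b hb, hDz hb kxx] at this
      linarith
    have kxt : ∀ b ∈ B, Dt (Dx k) b = 0 := fun b hb => by
      rw [Dt_Dx_comm (hkB b hb), hDz hb kt]
    have hconst : ∀ {κ : Base → ℝ}, (∀ b ∈ B, ContDiffAt ℝ ∞ κ b) → (∀ b ∈ B, Dx κ b = 0) →
        (∀ b ∈ B, Dt κ b = 0) → ∀ b ∈ B, κ b = κ (z.1, z.2.1) := by
      intro κ hκ hx ht b hb
      refine eq_of_fderiv_sub_eq_zero (convex_ball _ _) (fun c hc => (hκ c hc).diff)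
        (Metric.mem_ball_self hr) hb fun c hc => ?_
      have e1 := hx c hc
      have e2 := ht c hc
      rw [Dx_eq_fderiv (hκ c hc).diff] at e1
      rw [Dt_eq_fderiv (hκ c hc).diff] at e2
      have : b - (z.1, z.2.1) = (b.1 - z.1) • ((1, 0) : Base) + (b.2 - z.2.1) • (0, 1) := by
        ext <;> simp
      rw [this, map_add, map_smul, map_smul, e1, e2]
      simp
    let β := Dx k (z.1, z.2.1)
    have kx : ∀ b ∈ B, Dx k b = β := hconst (fun b hb => (hkB b hb).Dx) kxx kxt
    have hlin : ∀ b : Base, ContDiffAt ℝ ∞ (fun b : Base => β * b.2) b := fun b =>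
      ContDiff.contDiffAt (by fun_prop)
    have ex : Dx (fun b : Base => β * b.2) = fun _ => β :=
      Dx_eq_of_hasDerivAt fun t x => by simpa using (hasDerivAt_id x).const_mul β
    have et : Dt (fun b : Base => β * b.2) = fun _ => 0 :=
      Dt_eq_of_hasDerivAt fun t x => hasDerivAt_const t (β * x)
    have hfin := hconst (κ := fun b => k b - β * b.2) (fun b hb => (hkB b hb).sub (hlin b))
      (fun b hb => by rw [Dx_sub (hkB b hb) (hlin b), kx b hb, ex, sub_self])
      (fun b hb => by rw [Dt_sub (hkB b hb) (hlin b), kt b hb, et, sub_self])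
    refine ⟨β, k (z.1, z.2.1) - β * z.2.1, z, hz, r, hr, hsub, fun y hy => ?_⟩
    have := hfin (y.1, y.2.1) (by
      simp only [B, Metric.mem_ball, Prod.dist_eq] at hy ⊢
      exact lt_of_le_of_lt (max_le_max le_rfl (le_max_left _ _)) hy)
    simp only at this
    linarith

end Target

end EvolEq
-- Linearization in coordinates adapted to three symmetries.
namespace EvolEq

namespace IsAdapted

variable {J : Set Jet} {X U : Total → ℝ} {F G : Jet → ℝ}

/-- The prolonged symmetry as a tangent vector at a point of the jet space. -/
theorem exists_prolongation (h : IsAdapted J X U) (hF : ContDiffOn ℝ ∞ F J)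
    (hG : ContDiffOn ℝ ∞ G J) {V : Total → Total} (hV : ContDiffOn ℝ ∞ V (toTotal '' J))
    (hsym : IsPointSymmetry J F G V) (hτ : ∀ q ∈ toTotal '' J, (V q).1 = 0)
    (hVX : ∀ q ∈ toTotal '' J, fderiv ℝ X q (V q) = 0) {a : ℝ} {k : Base → ℝ}
    (hk : ∀ q ∈ toTotal '' J, ContDiffAt ℝ ∞ k (q.1, X q))
    (hVU : ∀ q ∈ toTotal '' J, fderiv ℝ U q (V q) = a * U q + k (q.1, X q))
    {j : Jet} (hj : j ∈ J) :
    ∃ w : Jet, w.1 = 0 ∧ fderiv ℝ (X ∘ toTotal) j w = 0 ∧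
      fderiv ℝ (U ∘ toTotal) j w = a * U (toTotal j) + k (j.1, X (toTotal j)) ∧
      fderiv ℝ (newP X U) j w = a * newP X U j + Dx k (j.1, X (toTotal j)) ∧
      fderiv ℝ (newQ X U) j w = a * newQ X U j + Dx (Dx k) (j.1, X (toTotal j)) ∧
      fderiv ℝ (newF F X U) j w = 0 ∧
      fderiv ℝ (newG F G X U) j w = a * newG F G X U j + Dt k (j.1, X (toTotal j))
        - newF F X U j * Dx (Dx (Dx k)) (j.1, X (toTotal j)) := by
  -- Here `s` is the value of `u_xxx` in a test function that solves the equation at the point.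
  have key : ∀ s : ℝ, ∃ w : Jet, w.1 = 0 ∧ fderiv ℝ (X ∘ toTotal) j w = 0 ∧
      fderiv ℝ (U ∘ toTotal) j w = a * U (toTotal j) + k (j.1, X (toTotal j)) ∧
      fderiv ℝ (newP X U) j w = a * newP X U j + Dx k (j.1, X (toTotal j)) ∧
      fderiv ℝ (newQ X U) j w = a * newQ X U j + Dx (Dx k) (j.1, X (toTotal j)) ∧
      fderiv ℝ (newF F X U) j w * (thirdA X U j + thirdB X U j * s)
        + fderiv ℝ (newG F G X U) j w = a * newG F G X U j + Dt k (j.1, X (toTotal j))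
        - newF F X U j * Dx (Dx (Dx k)) (j.1, X (toTotal j)) := by
    intro s
    obtain ⟨u, p, hu, rfl, rfl, hut⟩ := exists_jet_eq j s (F j * s + G j)
    exact ⟨_, h.prolong_coordinates hF hG hV hsym hτ hVX hk hVU hu hj hut⟩
  obtain ⟨w, a1, a2, a3, a4, a5, a6⟩ := key 0
  obtain ⟨w', b1, b2, b3, b4, b5, b6⟩ := key 1
  -- The vector `w` is fixed by its new coordinates, which do not involve `s`. The last relation is
  -- thus affine in `s` for one fixed vector, so the coefficient of `s`, the derivative of `newF`,
  -- vanishes.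
  have hw : w' - w = 0 := h.eq_zero_of_coordinates hj
    (by rw [Prod.fst_sub, a1, b1, sub_zero]) (by rw [map_sub, a2, b2, sub_zero])
    (by rw [map_sub, a3, b3, sub_self]) (by rw [map_sub, a4, b4, sub_self])
    (by rw [map_sub, a5, b5, sub_self])
  rw [sub_eq_zero.1 hw] at b6
  have hz : fderiv ℝ (newF F X U) j w * thirdB X U j = 0 := by linear_combination b6 - a6
  have hz' := (mul_eq_zero.1 hz).resolve_right (h.thirdB_ne hj)
  rw [hz', zero_mul, zero_add] at a6
  exact ⟨w, a1, a2, a3, a4, a5, hz', a6⟩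

/-- An equation is linearized by coordinates in which it has the symmetries `∂_u`, `x ∂_u` and
`(a u + k(t, x)) ∂_u`, unless the third one is a combination of the other two. -/
theorem linearizable (h : IsAdapted J X U) (hne : J.Nonempty) (hF : ContDiffOn ℝ ∞ F J)
    (hG : ContDiffOn ℝ ∞ G J) (hF0 : ∀ j ∈ J, F j ≠ 0)
    (hinj : Set.InjOn (fun q : Total => ((q.1, X q, U q) : Total)) (toTotal '' J))
    {V₁ V₂ V₃ : Total → Total} (hV₁ : ContDiffOn ℝ ∞ V₁ (toTotal '' J))
    (hV₂ : ContDiffOn ℝ ∞ V₂ (toTotal '' J)) (hV₃ : ContDiffOn ℝ ∞ V₃ (toTotal '' J))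
    (hs₁ : IsPointSymmetry J F G V₁) (hs₂ : IsPointSymmetry J F G V₂)
    (hs₃ : IsPointSymmetry J F G V₃)
    (hτ₁ : ∀ q ∈ toTotal '' J, (V₁ q).1 = 0) (hτ₂ : ∀ q ∈ toTotal '' J, (V₂ q).1 = 0)
    (hτ₃ : ∀ q ∈ toTotal '' J, (V₃ q).1 = 0)
    (hX₁ : ∀ q ∈ toTotal '' J, fderiv ℝ X q (V₁ q) = 0)
    (hX₂ : ∀ q ∈ toTotal '' J, fderiv ℝ X q (V₂ q) = 0)
    (hX₃ : ∀ q ∈ toTotal '' J, fderiv ℝ X q (V₃ q) = 0)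
    {a : ℝ} {k : Base → ℝ} (hk : ∀ q ∈ toTotal '' J, ContDiffAt ℝ ∞ k (q.1, X q))
    (hU₁ : ∀ q ∈ toTotal '' J, fderiv ℝ U q (V₁ q) = 1)
    (hU₂ : ∀ q ∈ toTotal '' J, fderiv ℝ U q (V₂ q) = X q)
    (hU₃ : ∀ q ∈ toTotal '' J, fderiv ℝ U q (V₃ q) = a * U q + k (q.1, X q)) :
    (∃ j ∈ J, LinearizableAt J F G j) ∨
    (a = 0 ∧ ∃ β γ : ℝ, ∃ N ⊆ J, IsOpen N ∧ N.Nonempty ∧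
      ∀ q ∈ toTotal '' N, k (q.1, X q) = β * X q + γ) := by
  -- The transformation prolonged to the jet space. Pulled back by its local inverse, `newF` and
  -- `newG` become the coefficients of the transformed equation.
  let Ψ : Jet → Jet := fun j => (j.1, X (toTotal j), U (toTotal j), newP X U j, newQ X U j)
  have hΨs : ContDiffOn ℝ ∞ Ψ J := fun j hj =>
    (contDiffAt_fst.prodMk ((h.contDiffAt_liftX hj).prodMk ((h.contDiffAt_liftU hj).prodMk
      ((h.contDiffAt_newP hj).prodMk (h.contDiffAt_newQ hj))))).contDiffWithinAt
  have hΨd : ∀ j ∈ J, ∀ w, fderiv ℝ Ψ j w = (w.1, fderiv ℝ (X ∘ toTotal) j w,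
      fderiv ℝ (U ∘ toTotal) j w, fderiv ℝ (newP X U) j w, fderiv ℝ (newQ X U) j w) := by
    intro j hj w
    have hd : HasFDerivAt Ψ ((ContinuousLinearMap.fst ℝ ℝ _).prod
        ((fderiv ℝ (X ∘ toTotal) j).prod ((fderiv ℝ (U ∘ toTotal) j).prod
          ((fderiv ℝ (newP X U) j).prod (fderiv ℝ (newQ X U) j))))) j :=
      (ContinuousLinearMap.fst ℝ ℝ (ℝ × ℝ × ℝ × ℝ)).hasFDerivAt.prodMk
        ((h.contDiffAt_liftX hj).diff.hasFDerivAt.prodMk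
        ((h.contDiffAt_liftU hj).diff.hasFDerivAt.prodMk
        ((h.contDiffAt_newP hj).diff.hasFDerivAt.prodMk
        (h.contDiffAt_newQ hj).diff.hasFDerivAt)))
    rw [hd.fderiv]
    rfl
  obtain ⟨j₀, hj₀⟩ := hne
  obtain ⟨e, hje, heJ, heΨ, hesm⟩ := exists_smooth_local_inverse h.isOpen hΨs
    (fun j hj w hw => by
      rw [hΨd j hj] at hw
      simp only [Prod.mk_eq_zero] at hw
      exact h.eq_zero_of_coordinates hj hw.1 hw.2.1 hw.2.2.1 hw.2.2.2.1 hw.2.2.2.2) hj₀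
  have hFJ : ∀ j ∈ J, ContDiffAt ℝ ∞ F j := fun j hj => hF.contDiffAt (h.isOpen.mem_nhds hj)
  have hGJ : ∀ j ∈ J, ContDiffAt ℝ ∞ G j := fun j hj => hG.contDiffAt (h.isOpen.mem_nhds hj)
  have hmemJ : ∀ z ∈ e.target, e.symm z ∈ J := fun z hz => heJ (e.map_target hz)
  have hpull : ∀ {A : Jet → ℝ}, (∀ j ∈ J, ContDiffAt ℝ ∞ A j) →
      ContDiffOn ℝ ∞ (fun z => A (e.symm z)) e.target := fun {A} hA z hz =>
    (ContDiffAt.comp (g := A) (f := e.symm) z (hA _ (hmemJ z hz))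
      (hesm.contDiffAt (e.open_target.mem_nhds hz))).contDiffWithinAt
  have hpulld : ∀ {A : Jet → ℝ}, (∀ j ∈ J, ContDiffAt ℝ ∞ A j) → ∀ z ∈ e.target, ∀ w,
      fderiv ℝ (fun z => A (e.symm z)) z (fderiv ℝ Ψ (e.symm z) w)
        = fderiv ℝ A (e.symm z) w := fun hA z hz w =>
    fderiv_comp_symm heΨ hesm hz (hΨs.contDiffAt (h.isOpen.mem_nhds (hmemJ z hz))).diff
      (hA _ (hmemJ z hz)).diff w
  have hcoord : ∀ z ∈ e.target, z.1 = (e.symm z).1 ∧ z.2.1 = X (toTotal (e.symm z)) ∧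
      z.2.2.1 = U (toTotal (e.symm z)) ∧ z.2.2.2.1 = newP X U (e.symm z) ∧
      z.2.2.2.2 = newQ X U (e.symm z) := by
    intro z hz
    have hc : Ψ (e.symm z) = z := by rw [← heΨ, e.right_inv hz]
    simp only [Ψ, Prod.ext_iff] at hc
    exact ⟨hc.1.symm, hc.2.1.symm, hc.2.2.1.symm, hc.2.2.2.1.symm, hc.2.2.2.2.symm⟩
  have haff : ∀ {V : Total → Total} {b : ℝ} {κ : Base → ℝ},
      ContDiffOn ℝ ∞ V (toTotal '' J) → IsPointSymmetry J F G V →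
      (∀ q ∈ toTotal '' J, (V q).1 = 0) → (∀ q ∈ toTotal '' J, fderiv ℝ X q (V q) = 0) →
      (∀ q ∈ toTotal '' J, ContDiffAt ℝ ∞ κ (q.1, X q)) →
      (∀ q ∈ toTotal '' J, fderiv ℝ U q (V q) = b * U q + κ (q.1, X q)) →
      IsAffineSymmetry e.target (fun z => newF F X U (e.symm z))
        (fun z => newG F G X U (e.symm z)) b κ := by
    intro V b κ hV hs hτ hX hκ hU z hz
    have hj := hmemJ z hz
    obtain ⟨w, a1, a2, a3, a4, a5, a6, a7⟩ :=
      h.exists_prolongation hF hG hV hs hτ hX hκ hU hj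
    have hw : fderiv ℝ Ψ (e.symm z) w = (0, 0, b * z.2.2.1 + κ (z.1, z.2.1),
        b * z.2.2.2.1 + Dx κ (z.1, z.2.1), b * z.2.2.2.2 + Dx (Dx κ) (z.1, z.2.1)) := by
      rw [hΨd _ hj, a1, a2, a3, a4, a5]
      obtain ⟨c1, c2, c3, c4, c5⟩ := hcoord z hz
      rw [c1, c2, c3, c4, c5]
    rw [← hw, hpulld (fun j hj => h.contDiffAt_newF (hFJ j hj) hj) z hz,
      hpulld (fun j hj => h.contDiffAt_newG (hFJ j hj) (hGJ j hj) hj) z hz, a6, a7]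
    obtain ⟨c1, c2, -⟩ := hcoord z hz
    rw [c1, c2]
    exact ⟨rfl, rfl⟩
  have hsub : ∀ z r, Metric.ball z r ⊆ e.target →
      IsOpen (e.source ∩ e ⁻¹' Metric.ball z r) := fun z r _ =>
    e.isOpen_inter_preimage Metric.isOpen_ball
  rcases linear_of_isAffineSymmetry e.open_target ⟨e j₀, e.map_source hje⟩
      (hpull fun j hj => h.contDiffAt_newF (hFJ j hj) hj)
      (hpull fun j hj => h.contDiffAt_newG (hFJ j hj) (hGJ j hj) hj)
      (k := k) (a := a)
      (fun z hz => by
        have := hk _ ⟨_, hmemJ z hz, rfl⟩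
        obtain ⟨c1, c2, -⟩ := hcoord z hz
        rw [c1, c2]
        exact this)
      (haff hV₁ hs₁ hτ₁ hX₁ (fun _ _ => contDiffAt_const)
        (fun q hq => by rw [hU₁ q hq]; ring))
      (haff hV₂ hs₂ hτ₂ hX₂ (fun _ _ => contDiffAt_snd)
        (fun q hq => by rw [hU₂ q hq]; ring))
      (haff hV₃ hs₃ hτ₃ hX₃ hk hU₃) with
    ⟨z, hz, r, hr, hzr, f₁, f₂, f₅, s1, s2, s5, hf⟩ | ⟨ha, β, γ, z, hz, r, hr, hzr, hf⟩
  · left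
    let N : Set Jet := e.source ∩ e ⁻¹' Metric.ball z r
    have hNJ : N ⊆ J := fun i hi => heJ hi.1
    have hNo : IsOpen N := hsub z r hzr
    have hTN : toTotal '' N ⊆ toTotal '' J := Set.image_mono hNJ
    have hball : ∀ i ∈ N, Ψ i ∈ Metric.ball z r := fun i hi => by
      rw [← heΨ]
      exact hi.2
    have hDsub : (fun q : Total => (((fun t => t) q.1, X q) : Base)) '' (toTotal '' N)
        ⊆ Metric.ball (z.1, z.2.1) r := by
      rintro _ ⟨_, ⟨i, hi, rfl⟩, rfl⟩
      have := hball i hi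
      simp only [Metric.mem_ball, Prod.dist_eq, max_lt_iff] at this ⊢
      exact ⟨this.1, this.2.1⟩
    have hfN : ∀ i ∈ N, newF F X U i = f₁ (i.1, X (toTotal i)) ∧
        newG F G X U i = f₂ (i.1, X (toTotal i)) * newQ X U i + f₅ (i.1, X (toTotal i)) := by
      intro i hi
      have := hf _ (hball i hi)
      have hi' : e.symm (Ψ i) = i := by rw [← heΨ, e.left_inv hi.1]
      simp only [hi'] at this
      exact this
    -- Time is left unchanged, and the coefficients `f₃` and `f₄` are zero because `newG` is free of
    -- `U` and `U_X`.
    refine ⟨e.symm z, hmemJ z hz, toTotal '' N, fun t => t, X, U, N, f₁, f₂, fun _ => 0,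
      fun _ => 0, f₅, _, ⟨isOpen_image_toTotal hNo, contDiff_id.contDiffOn, h.smoothX.mono hTN,
        h.smoothU.mono hTN, fun q _ => by simp, fun q hq => h.jac q (hTN hq), hinj.mono hTN⟩,
      hNo, ⟨e.map_target hz, ?_⟩, hNJ, fun i hi => ⟨i, hi, rfl⟩, ?_, rfl, s1.mono hDsub,
      s2.mono hDsub, contDiffOn_const, contDiffOn_const, s5.mono hDsub, ?_, ?_⟩
    · show e (e.symm z) ∈ Metric.ball z r
      rw [e.right_inv hz]
      exact Metric.mem_ball_self hr
    · intro i hi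
      have := h.Dx_ne i (hNJ hi)
      rw [totalDx_lift (h.contDiffAt_X (hNJ hi)).diff] at this
      have e1 : ((0, 1, i.2.2.2.1) : Total) = (0, 1, 0) + i.2.2.2.1 • (0, 0, 1) := by simp
      rwa [e1, map_add, map_smul, smul_eq_mul] at this
    · rintro _ ⟨_, ⟨i, hi, rfl⟩, rfl⟩
      have := h.newF_ne (hF0 i (hNJ hi)) (hNJ hi)
      rw [(hfN i hi).1] at this
      exact this
    · intro u v p hp hu hv hm
      obtain ⟨v1, v2, v3, vt⟩ := h.transformed_derivatives hu (hNJ hp) hv hm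
      rw [h.solvesAt_iff (hNJ hp), (hfN _ hp).1, (hfN _ hp).2, SolvesLinearAt, vt, v3, v2]
      have e1 : ((jet u p).1, X (toTotal (jet u p))) = ((p.1, X (graphPt u p)) : Base) := rfl
      rw [e1]
      simp only [zero_mul, add_zero]
      rw [add_assoc]
  · right
    refine ⟨ha, β, γ, e.source ∩ e ⁻¹' Metric.ball z r, fun i hi => heJ hi.1, hsub z r hzr,
      ⟨e.symm z, e.map_target hz, ?_⟩, ?_⟩
    · show e (e.symm z) ∈ Metric.ball z r
      rw [e.right_inv hz]
      exact Metric.mem_ball_self hr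
    · rintro _ ⟨i, hi, rfl⟩
      have h2 : Ψ i ∈ Metric.ball z r := by
        rw [← heΨ]
        exact hi.2
      exact hf _ h2

end IsAdapted

end EvolEq
-- Straightening a vertical vector field.
namespace EvolEq

/-- A vertical vector field `V` with a nondegenerate invariant `h` is `∂_u` in suitable local
coordinates `(t, h, U)`. -/
theorem exists_straightening {Ω : Set Total} (hΩ : IsOpen Ω) {q₀ : Total} (hq₀ : q₀ ∈ Ω)
    {V : Total → Total} (hV : ContDiffOn ℝ ∞ V Ω) (hτ : ∀ q ∈ Ω, (V q).1 = 0)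
    (hV0 : V q₀ ≠ 0) {f : Total → ℝ} (hf : ContDiffOn ℝ ∞ f Ω)
    (hfV : ∀ q ∈ Ω, fderiv ℝ f q (V q) = 0) (hf0 : ∃ x y, fderiv ℝ f q₀ (0, x, y) ≠ 0) :
    ∃ (Ω' : Set Total) (U : Total → ℝ), Ω' ⊆ Ω ∧ IsOpen Ω' ∧ q₀ ∈ Ω' ∧ ContDiffOn ℝ ∞ U Ω' ∧
      (∀ q ∈ Ω', fderiv ℝ U q (V q) = 1) ∧ (∀ q ∈ Ω', jacobian f U q ≠ 0) ∧
      Set.InjOn (fun q : Total => ((q.1, f q, U q) : Total)) Ω' ∧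
      ∀ (g : Total → ℝ) (a : ℝ), ContDiffOn ℝ ∞ g Ω → (∀ q ∈ Ω, fderiv ℝ g q (V q) = a) →
        ∃ k : Base → ℝ, ∀ q ∈ Ω', ContDiffAt ℝ ∞ k (q.1, f q) ∧
          g q = a * U q + k (q.1, f q) := by
  set ξ := (V q₀).2.1 with hξ
  set η := (V q₀).2.2 with hη
  have hpos : ξ ^ 2 + η ^ 2 ≠ 0 := by
    intro h0
    have h1 : ξ = 0 := by nlinarith [sq_nonneg ξ, sq_nonneg η]
    have h2 : η = 0 := by nlinarith [sq_nonneg ξ, sq_nonneg η]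
    exact hV0 (Prod.ext (hτ _ hq₀) (Prod.ext h1 h2))
  -- The linear coordinate in the direction `V q₀`: it increases along `V` near `q₀`, and together
  -- with `t` and `f` it forms a coordinate system.
  let l : Total →L[ℝ] ℝ := ξ • (ContinuousLinearMap.fst ℝ ℝ ℝ).comp (ContinuousLinearMap.snd ℝ ℝ _)
    + η • (ContinuousLinearMap.snd ℝ ℝ ℝ).comp (ContinuousLinearMap.snd ℝ ℝ _)
  have hl : ∀ w : Total, l w = ξ * w.2.1 + η * w.2.2 := fun w => by simp [l]
  have hfat : ∀ q ∈ Ω, ContDiffAt ℝ ∞ f q := fun q hq => hf.contDiffAt (hΩ.mem_nhds hq)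
  have hVat : ∀ q ∈ Ω, ContDiffAt ℝ ∞ V q := fun q hq => hV.contDiffAt (hΩ.mem_nhds hq)
  have hdecomp : ∀ x y : ℝ, ((0, x, y) : Total) = ((ξ * x + η * y) / (ξ ^ 2 + η ^ 2)) • (0, ξ, η)
      + ((-η * x + ξ * y) / (ξ ^ 2 + η ^ 2)) • (0, -η, ξ) := by
    intro x y
    ext
    · simp
    · simp only [Prod.snd_add, Prod.fst_add, Prod.smul_snd, Prod.smul_fst, smul_eq_mul]
      field_simp
      ring
    · simp only [Prod.snd_add, Prod.smul_snd, smul_eq_mul]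
      field_simp
      ring
  have hV₀eq : V q₀ = (0, ξ, η) := Prod.ext (hτ _ hq₀) (Prod.ext rfl rfl)
  have hf1 : fderiv ℝ f q₀ (0, -η, ξ) ≠ 0 := by
    obtain ⟨x, y, hxy⟩ := hf0
    intro h0
    rw [hdecomp, map_add, map_smul, map_smul, h0, ← hV₀eq, hfV _ hq₀] at hxy
    simp at hxy
  have hl0 : l (V q₀) ≠ 0 := by
    rw [hl, ← hξ, ← hη]
    intro h0
    exact hpos (by linarith)
  have hev : ∀ᶠ q in 𝓝 q₀, q ∈ Ω ∧ l (V q) ≠ 0 ∧ fderiv ℝ f q (0, -η, ξ) ≠ 0 := by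
    refine Filter.Eventually.and (hΩ.mem_nhds hq₀) (Filter.Eventually.and ?_ ?_)
    · exact (l.continuous.continuousAt.comp (hVat _ hq₀).continuousAt).eventually_ne hl0
    · exact ((hfat _ hq₀).fderiv_infty.clm_apply
        (contDiffAt_const (c := ((0, -η, ξ) : Total)))).continuousAt.eventually_ne hf1
  obtain ⟨r, hr, hball⟩ := Metric.eventually_nhds_iff_ball.1 hev
  let Θ : Total → Total := fun q => (q.1, f q, l q)
  have hΘs : ContDiffOn ℝ ∞ Θ (Metric.ball q₀ r) := fun q hq =>
    (contDiffAt_fst.prodMk ((hfat q (hball q hq).1).prodMk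
      l.contDiff.contDiffAt)).contDiffWithinAt
  have hΘd : ∀ q ∈ Ω, ∀ w, fderiv ℝ Θ q w = (w.1, fderiv ℝ f q w, l w) := by
    intro q hq w
    have hd : HasFDerivAt Θ ((ContinuousLinearMap.fst ℝ ℝ _).prod ((fderiv ℝ f q).prod l)) q :=
      (ContinuousLinearMap.fst ℝ ℝ (ℝ × ℝ)).hasFDerivAt.prodMk
        ((hfat q hq).diff.hasFDerivAt.prodMk l.hasFDerivAt)
    rw [hd.fderiv]
    rfl
  obtain ⟨e, he0, heB, heΘ, hes⟩ := exists_smooth_local_inverse Metric.isOpen_ball hΘs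
    (fun q hq w hw => by
      rw [hΘd q (hball q hq).1] at hw
      simp only [Prod.mk_eq_zero] at hw
      obtain ⟨h1, h2, h3⟩ := hw
      obtain ⟨t, x, y⟩ := w
      simp only at h1
      subst h1
      rw [hl] at h3
      simp only at h3
      rw [hdecomp, h3, zero_div, zero_smul, zero_add, map_smul, smul_eq_mul] at h2
      rw [hdecomp, h3, (mul_eq_zero.1 h2).resolve_right (hball q hq).2.2]
      simp) (Metric.mem_ball_self hr)
  have hmem : ∀ z ∈ e.target, e.symm z ∈ Metric.ball q₀ r := fun z hz => heB (e.map_target hz)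
  -- In the coordinates `(t, f, l)` the field is `l(V) ∂_l`, so `V U = 1` is solved by a primitive
  -- of `1 / l(V)` in the last variable; no flow is needed.
  have hb : ContDiffOn ℝ ∞ (fun z => (l (V (e.symm z)))⁻¹) e.target := fun z hz => by
    have h1 := hmem z hz
    have h2 : ContDiffAt ℝ ∞ (fun z => V (e.symm z)) z :=
      ContDiffAt.comp (g := V) (f := e.symm) z (hVat _ (hball _ h1).1)
        (hes.contDiffAt (e.open_target.mem_nhds hz))
    exact ((l.contDiff.contDiffAt.comp z h2).inv (hball _ h1).2.1).contDiffWithinAt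
  obtain ⟨P, s', hs'o, hs'0, hs't, hPs, hPd⟩ :=
    exists_smooth_primitive e.open_target hb (e.map_source he0)
  let U : Total → ℝ := fun q => P (Θ q)
  let Ω₂ : Set Total := e.source ∩ e ⁻¹' s'
  have hΩ₂o : IsOpen Ω₂ := e.isOpen_inter_preimage hs'o
  have hΩ₂ball : Ω₂ ⊆ Metric.ball q₀ r := fun q hq => heB hq.1
  have hΩ₂ : Ω₂ ⊆ Ω := fun q hq => (hball q (hΩ₂ball hq)).1
  have hΘat : ∀ q ∈ Ω₂, ContDiffAt ℝ ∞ Θ q := fun q hq =>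
    hΘs.contDiffAt (Metric.isOpen_ball.mem_nhds (hΩ₂ball hq))
  have hUat : ∀ q ∈ Ω₂, ContDiffAt ℝ ∞ U q := fun q hq =>
    hPs.contDiffAt.comp q (hΘat q hq)
  have hUV : ∀ q ∈ Ω₂, fderiv ℝ U q (V q) = 1 := by
    intro q hq
    have h1 : fderiv ℝ U q = (fderiv ℝ P (Θ q)).comp (fderiv ℝ Θ q) :=
      fderiv_comp q (hPs.contDiffAt (x := Θ q)).diff (hΘat q hq).diff
    have h2 : Θ q ∈ s' := by
      rw [← heΘ]
      exact hq.2
    have h3 : ((0, 0, l (V q)) : Total) = l (V q) • (0, 0, 1) := by simp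
    rw [h1, ContinuousLinearMap.comp_apply, hΘd q (hΩ₂ hq), hτ q (hΩ₂ hq), hfV q (hΩ₂ hq), h3,
      map_smul, hPd _ h2, ← heΘ, e.left_inv hq.1, smul_eq_mul]
    exact mul_inv_cancel₀ (hball q (hΩ₂ball hq)).2.1
  have hjac : ∀ q ∈ Ω₂, jacobian f U q ≠ 0 := by
    intro q hq hj
    have h1 := hUV q hq
    have h2 := hfV q (hΩ₂ hq)
    have hVq : V q = (V q).2.1 • (0, 1, 0) + (V q).2.2 • (0, 0, 1) := by
      ext
      · simp [hτ q (hΩ₂ hq)]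
      · simp
      · simp
    rw [hVq, map_add, map_smul, map_smul, smul_eq_mul, smul_eq_mul] at h1 h2
    rw [jacobian] at hj
    have fx : fderiv ℝ f q (0, 1, 0) = 0 := by
      linear_combination (-fderiv ℝ f q (0, 1, 0)) * h1 + fderiv ℝ U q (0, 1, 0) * h2
        + (V q).2.2 * hj
    have fu : fderiv ℝ f q (0, 0, 1) = 0 := by
      linear_combination (-fderiv ℝ f q (0, 0, 1)) * h1 + fderiv ℝ U q (0, 0, 1) * h2
        - (V q).2.1 * hj
    refine (hball q (hΩ₂ball hq)).2.2 ?_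
    have : ((0, -η, ξ) : Total) = (-η) • (0, 1, 0) + ξ • (0, 0, 1) := by simp
    rw [this, map_add, map_smul, map_smul, fx, fu]
    simp
  let Φ : Total → Total := fun q => (q.1, f q, U q)
  have hΦs : ContDiffOn ℝ ∞ Φ Ω₂ := fun q hq =>
    (contDiffAt_fst.prodMk ((hfat q (hΩ₂ hq)).prodMk (hUat q hq))).contDiffWithinAt
  have hΦd : ∀ q ∈ Ω₂, ∀ w, fderiv ℝ Φ q w = (w.1, fderiv ℝ f q w, fderiv ℝ U q w) := by
    intro q hq w
    have hd : HasFDerivAt Φ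
        ((ContinuousLinearMap.fst ℝ ℝ _).prod ((fderiv ℝ f q).prod (fderiv ℝ U q))) q :=
      (ContinuousLinearMap.fst ℝ ℝ (ℝ × ℝ)).hasFDerivAt.prodMk
        ((hfat q (hΩ₂ hq)).diff.hasFDerivAt.prodMk (hUat q hq).diff.hasFDerivAt)
    rw [hd.fderiv]
    rfl
  obtain ⟨e', he0', heB', heΦ, hes'⟩ := exists_smooth_local_inverse hΩ₂o hΦs
    (fun q hq w hw => by
      rw [hΦd q hq] at hw
      simp only [Prod.mk_eq_zero] at hw
      exact IsAdapted.eq_zero_of_jacobian_ne (hjac q hq) hw.1 hw.2.1 hw.2.2)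
    (show q₀ ∈ Ω₂ from ⟨he0, hs'0⟩)
  -- The image of the domain in the coordinates `(t, f, U)` is kept inside a ball, so that a
  -- function constant along `U` descends to one of `(t, f)`.
  obtain ⟨δ, hδ, hδt⟩ := Metric.isOpen_iff.1 e'.open_target _ (e'.map_source he0')
  refine ⟨e'.source ∩ e' ⁻¹' Metric.ball (e' q₀) δ, U, fun q hq => hΩ₂ (heB' hq.1),
    e'.isOpen_inter_preimage Metric.isOpen_ball, ⟨he0', Metric.mem_ball_self hδ⟩,
    fun q hq => (hUat q (heB' hq.1)).contDiffWithinAt, fun q hq => hUV q (heB' hq.1),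
    fun q hq => hjac q (heB' hq.1), ?_, ?_⟩
  · intro q hq q' hq' hqq
    refine e'.injOn hq.1 hq'.1 ?_
    rw [heΦ, heΦ]
    exact hqq
  · intro g a hg hgV
    -- This difference is annihilated by `V = ∂_U`; its value at the fixed height `U q₀` defines
    -- `k`.
    let κ : Total → ℝ := fun q => g q - a * U q
    have hκat : ∀ q ∈ Ω₂, ContDiffAt ℝ ∞ κ q := fun q hq =>
      (hg.contDiffAt (hΩ.mem_nhds (hΩ₂ hq))).sub (contDiffAt_const.mul (hUat q hq))
    have hκV : ∀ q ∈ Ω₂, fderiv ℝ κ q (V q) = 0 := by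
      intro q hq
      have h1 : fderiv ℝ κ q = fderiv ℝ g q - fderiv ℝ (fun q => a * U q) q :=
        fderiv_fun_sub (hg.contDiffAt (hΩ.mem_nhds (hΩ₂ hq))).diff ((hUat q hq).diff.const_mul a)
      rw [h1, fderiv_const_mul (hUat q hq).diff, sub_apply, hgV q (hΩ₂ hq)]
      have h2 : (a • fderiv ℝ U q) (V q) = a * fderiv ℝ U q (V q) := rfl
      rw [h2, hUV q hq, mul_one, sub_self]
    have hmem' : ∀ z ∈ e'.target, e'.symm z ∈ Ω₂ := fun z hz => heB' (e'.map_target hz)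
    have hpull : ∀ z ∈ e'.target, ContDiffAt ℝ ∞ (fun z => κ (e'.symm z)) z := fun z hz =>
      ContDiffAt.comp (g := κ) (f := e'.symm) z (hκat _ (hmem' z hz))
        (hes'.contDiffAt (e'.open_target.mem_nhds hz))
    have hpull0 : ∀ z ∈ e'.target, fderiv ℝ (fun z => κ (e'.symm z)) z (0, 0, 1) = 0 := by
      intro z hz
      have hq := hmem' z hz
      have h1 := fderiv_comp_symm heΦ hes' hz (hΦs.contDiffAt (hΩ₂o.mem_nhds hq)).diff
        (hκat _ hq).diff (V (e'.symm z))
      rwa [hΦd _ hq, hτ _ (hΩ₂ hq), hfV _ (hΩ₂ hq), hUV _ hq, hκV _ hq] at h1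
    refine ⟨fun b => κ (e'.symm (b.1, b.2, U q₀)), fun q hq => ?_⟩
    have hz : ((q.1, f q, U q) : Total) ∈ Metric.ball (e' q₀) δ := by
      have : Φ q ∈ Metric.ball (e' q₀) δ := by
        rw [← heΦ]
        exact hq.2
      exact this
    have hz' : ((q.1, f q, U q₀) : Total) ∈ Metric.ball (e' q₀) δ := by
      rw [heΦ] at hz ⊢
      have hδ' : (0 : ℝ) < δ := hδ
      simp only [Metric.mem_ball, Prod.dist_eq, max_lt_iff, Φ, dist_self] at hz ⊢
      exact ⟨hz.1, hz.2.1, hδ'⟩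
    constructor
    · have hi : ContDiff ℝ ∞ fun b : Base => ((b.1, b.2, U q₀) : Total) := by fun_prop
      exact ContDiffAt.comp (g := fun z => κ (e'.symm z))
        (f := fun b : Base => ((b.1, b.2, U q₀) : Total)) (q.1, f q) (hpull _ (hδt hz'))
        hi.contDiffAt
    · have h1 := eq_of_fderiv_sub_eq_zero (g := fun z => κ (e'.symm z))
        (convex_ball (e' q₀) δ) (fun y hy => (hpull y (hδt hy)).diff) hz' hz (fun y hy => by
          have : ((q.1, f q, U q) : Total) - (q.1, f q, U q₀) = (U q - U q₀) • (0, 0, 1) := by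
            simp
          rw [this, map_smul, hpull0 y (hδt hy), smul_zero])
      have h2 : e'.symm (q.1, f q, U q) = q := by
        have : e' q = (q.1, f q, U q) := heΦ q
        rw [← this, e'.left_inv hq.1]
      simp only [h2] at h1
      simp only [κ] at h1 ⊢
      rw [← h1]
      ring

end EvolEq
-- Equations with a Lie algebra of point symmetries.
namespace EvolEq

variable {L : Type*} [LieRing L] [LieAlgebra ℝ L]

/-- An evolution equation on a nonempty open set together with a Lie algebra of point symmetries. -/
structure SymmetricEquation (J : Set Jet) (F G : Jet → ℝ) (ρ : L →ₗ[ℝ] (Total → Total)) :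
    Prop where
  isOpen : IsOpen J
  nonempty : J.Nonempty
  smoothF : ContDiffOn ℝ ∞ F J
  smoothG : ContDiffOn ℝ ∞ G J
  F_ne : ∀ j ∈ J, F j ≠ 0
  realization : IsRealization (toTotal '' J) ρ
  symm : ∀ e, IsPointSymmetry J F G (ρ e)

theorem IsPointSymmetry.mono {J J' : Set Jet} {F G : Jet → ℝ} {V : Total → Total}
    (h : IsPointSymmetry J F G V) (hJ : J' ⊆ J) : IsPointSymmetry J' F G V :=
  fun u p hu hj => h u p hu (hJ hj)

theorem LinearizableAt.mono {J J' : Set Jet} {F G : Jet → ℝ} {j : Jet}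
    (h : LinearizableAt J' F G j) (hJ : J' ⊆ J) : LinearizableAt J F G j := by
  obtain ⟨W, T, X, U, N, f₁, f₂, f₃, f₄, f₅, D, h1, h2, h3, h4, h5⟩ := h
  exact ⟨W, T, X, U, N, f₁, f₂, f₃, f₄, f₅, D, h1, h2, h3, h4.trans hJ, h5⟩

theorem IsRankOne.mono {Ω Ω' : Set Total} {ρ : L →ₗ[ℝ] (Total → Total)} (h : IsRankOne Ω ρ)
    (hΩ : Ω' ⊆ Ω) : IsRankOne Ω' ρ := fun q hq => h q (hΩ hq)

/-- A function with vanishing derivative on a convex set is constant. -/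
theorem exists_eq_const {Ω : Set Total} (hc : Convex ℝ Ω) {α : Total → ℝ}
    (hα : ∀ q ∈ Ω, DifferentiableAt ℝ α q) (h1 : ∀ q ∈ Ω, fderiv ℝ α q (1, 0, 0) = 0)
    (h2 : ∀ q ∈ Ω, ∀ a b, fderiv ℝ α q (0, a, b) = 0) : ∃ c, ∀ q ∈ Ω, α q = c := by
  rcases Ω.eq_empty_or_nonempty with rfl | ⟨q₀, hq₀⟩
  · exact ⟨0, by simp⟩
  refine ⟨α q₀, fun q hq => eq_of_fderiv_sub_eq_zero hc hα hq₀ hq fun y hy => ?_⟩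
  have : q - q₀ = (q - q₀).1 • ((1, 0, 0) : Total) + (0, (q - q₀).2.1, (q - q₀).2.2) := by
    ext <;> simp
  rw [this, map_add, map_smul, h1 y hy, h2 y hy, smul_zero, add_zero]

namespace SymmetricEquation

variable {J : Set Jet} {F G : Jet → ℝ} {ρ : L →ₗ[ℝ] (Total → Total)}

theorem isOpen_total (S : SymmetricEquation J F G ρ) : IsOpen (toTotal '' J) :=
  isOpen_image_toTotal S.isOpen

theorem nonempty_total (S : SymmetricEquation J F G ρ) : (toTotal '' J).Nonempty :=
  S.nonempty.image _

theorem smooth (S : SymmetricEquation J F G ρ) (e : L) : ContDiffOn ℝ ∞ (ρ e) (toTotal '' J) :=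
  S.realization.smooth e

theorem contDiffAt (S : SymmetricEquation J F G ρ) (e : L) {q : Total} (hq : q ∈ toTotal '' J) :
    ContDiffAt ℝ ∞ (ρ e) q := (S.smooth e).contDiffAt (S.isOpen_total.mem_nhds hq)

theorem mono (S : SymmetricEquation J F G ρ) {J' : Set Jet} (hJ : J' ⊆ J) (ho : IsOpen J')
    (hne : J'.Nonempty) : SymmetricEquation J' F G ρ where
  isOpen := ho
  nonempty := hne
  smoothF := S.smoothF.mono hJ
  smoothG := S.smoothG.mono hJ
  F_ne j hj := S.F_ne j (hJ hj)
  realization :=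
    { smooth := fun e => (S.smooth e).mono (Set.image_mono hJ)
      bracket := fun e f q hq => S.realization.bracket e f q (Set.image_mono hJ hq)
      faithful := fun W hW => S.realization.faithful W (hW.trans (Set.image_mono hJ)) }
  symm e := (S.symm e).mono hJ

/-- One may shrink the domain to a convex neighbourhood of a given point. -/
theorem exists_convex (S : SymmetricEquation J F G ρ) {q : Total} (hq : q ∈ toTotal '' J)
    {p : Total → Prop} (hp : ∀ᶠ y in 𝓝 q, p y) :
    ∃ J' ⊆ J, SymmetricEquation J' F G ρ ∧ Convex ℝ (toTotal '' J') ∧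
      (∀ y ∈ toTotal '' J', p y) ∧ q ∈ toTotal '' J' := by
  obtain ⟨j, hj, rfl⟩ := hq
  have h1 : ∀ᶠ i in 𝓝 j, i ∈ J ∧ p (toTotal i) :=
    (S.isOpen.eventually_mem hj).and (contDiff_toTotal.continuous.continuousAt.eventually hp)
  obtain ⟨r, hr, hb⟩ := Metric.eventually_nhds_iff_ball.1 h1
  refine ⟨Metric.ball j r, fun i hi => (hb i hi).1,
    S.mono (fun i hi => (hb i hi).1) Metric.isOpen_ball ⟨j, Metric.mem_ball_self hr⟩,
    ?_, ?_, ⟨j, Metric.mem_ball_self hr, rfl⟩⟩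
  · exact (convex_ball j r).linear_image (toTotalL : Jet →ₗ[ℝ] Total)
  · rintro _ ⟨i, hi, rfl⟩
    exact (hb i hi).2

theorem eq_of_eqOn (S : SymmetricEquation J F G ρ) {e f : L}
    (h : ∀ q ∈ toTotal '' J, ρ e q = ρ f q) : e = f := by
  refine sub_eq_zero.1 (S.realization.faithful _ subset_rfl S.isOpen_total S.nonempty_total _
    fun q hq => ?_)
  rw [map_sub, Pi.sub_apply, h q hq, sub_self]

theorem exists_ne_zero (S : SymmetricEquation J F G ρ) {e : L} (he : e ≠ 0) :
    ∃ q ∈ toTotal '' J, ρ e q ≠ 0 := by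
  by_contra! h
  exact he (S.eq_of_eqOn fun q hq => by simp [h q hq])

theorem fderiv_fst (S : SymmetricEquation J F G ρ) (e : L) :
    ∀ q ∈ toTotal '' J, ∀ a b, fderiv ℝ (fun q => (ρ e q).1) q (0, a, b) = 0 :=
  fderiv_fst_eq_zero_of_isPointSymmetry S.isOpen S.F_ne (S.smooth e) (S.symm e)

/-- The commutator of a vector field with a combination of vector fields. -/
theorem bracket_combination (S : SymmetricEquation J F G ρ) {e f f₁ f₂ : L} {α β : Total → ℝ}
    {q : Total} (hq : q ∈ toTotal '' J)
    (hα : ContDiffOn ℝ ∞ α (toTotal '' J)) (hβ : ContDiffOn ℝ ∞ β (toTotal '' J))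
    (h : ∀ q ∈ toTotal '' J, ρ f q = α q • ρ f₁ q + β q • ρ f₂ q) :
    ρ ⁅e, f⁆ q = fderiv ℝ α q (ρ e q) • ρ f₁ q + α q • ρ ⁅e, f₁⁆ q
      + (fderiv ℝ β q (ρ e q) • ρ f₂ q + β q • ρ ⁅e, f₂⁆ q) := by
  have hN := S.isOpen_total.mem_nhds hq
  have ha := (hα.contDiffAt hN).diff
  have hb := (hβ.contDiffAt hN).diff
  have h1 := (S.contDiffAt f₁ hq).diff
  have h2 := (S.contDiffAt f₂ hq).diff
  have heq : ρ f =ᶠ[𝓝 q] fun q => α q • ρ f₁ q + β q • ρ f₂ q :=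
    Filter.eventuallyEq_of_mem hN h
  rw [S.realization.bracket _ _ q hq, S.realization.bracket _ _ q hq,
    S.realization.bracket _ _ q hq]
  simp only [VectorField.lieBracket]
  rw [heq.fderiv_eq, heq.eq_of_nhds, fderiv_fun_add (ha.fun_smul h1) (hb.fun_smul h2), fderiv_fun_smul ha h1,
    fderiv_fun_smul hb h2]
  simp only [_root_.add_apply, _root_.smul_apply,
    ContinuousLinearMap.smulRight_apply, map_add, map_smul]
  module

theorem bracket_smul (S : SymmetricEquation J F G ρ) {e f f₁ : L} {α : Total → ℝ}
    {q : Total} (hq : q ∈ toTotal '' J) (hα : ContDiffOn ℝ ∞ α (toTotal '' J))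
    (h : ∀ q ∈ toTotal '' J, ρ f q = α q • ρ f₁ q) :
    ρ ⁅e, f⁆ q = fderiv ℝ α q (ρ e q) • ρ f₁ q + α q • ρ ⁅e, f₁⁆ q := by
  have := S.bracket_combination (e := e) (f := f) (f₁ := f₁) (f₂ := 0) (β := fun _ => 0) hq hα
    contDiffOn_const (fun q hq => by simpa using h q hq)
  simpa using this

/-- Two independent symmetries span every symmetry that is a combination of them with coefficients
depending on `t` only. -/
theorem exists_eq_combination (S : SymmetricEquation J F G ρ) (hc : Convex ℝ (toTotal '' J))
    {e f₁ f₂ : L} {α β : Total → ℝ}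
    (hα : ContDiffOn ℝ ∞ α (toTotal '' J)) (hβ : ContDiffOn ℝ ∞ β (toTotal '' J))
    (h : ∀ q ∈ toTotal '' J, ρ e q = α q • ρ f₁ q + β q • ρ f₂ q)
    (hαx : ∀ q ∈ toTotal '' J, ∀ a b, fderiv ℝ α q (0, a, b) = 0)
    (hβx : ∀ q ∈ toTotal '' J, ∀ a b, fderiv ℝ β q (0, a, b) = 0)
    (hind : ∀ q ∈ toTotal '' J, ∀ a b : ℝ, a • ρ f₁ q + b • ρ f₂ q = 0 → a = 0 ∧ b = 0) :
    ∃ a b : ℝ, e = a • f₁ + b • f₂ := by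
  have key := deriv_coeff_eq_zero_of_isPointSymmetry S.isOpen S.F_ne (S.smooth f₁) (S.smooth f₂)
    hα hβ (S.symm e) (S.symm f₁) (S.symm f₂) h hαx hβx
  have hd : ∀ {γ : Total → ℝ}, ContDiffOn ℝ ∞ γ (toTotal '' J) → ∀ q ∈ toTotal '' J,
      DifferentiableAt ℝ γ q := fun hγ q hq => (hγ.contDiffAt (S.isOpen_total.mem_nhds hq)).diff
  obtain ⟨a, ha⟩ := exists_eq_const hc (hd hα) (fun q hq => (hind q hq _ _ (key q hq)).1) hαx
  obtain ⟨b, hb⟩ := exists_eq_const hc (hd hβ) (fun q hq => (hind q hq _ _ (key q hq)).2) hβx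
  refine ⟨a, b, S.eq_of_eqOn fun q hq => ?_⟩
  rw [h q hq, ha q hq, hb q hq]
  simp

/-- If the coefficient depends on `t` only, then `α_t ρ f = 0`, and as `ρ f` has no zeros the
coefficient is constant. -/
theorem exists_eq_smul (S : SymmetricEquation J F G ρ) (hc : Convex ℝ (toTotal '' J))
    {e f : L} {α : Total → ℝ} (hα : ContDiffOn ℝ ∞ α (toTotal '' J))
    (h : ∀ q ∈ toTotal '' J, ρ e q = α q • ρ f q)
    (hαx : ∀ q ∈ toTotal '' J, ∀ a b, fderiv ℝ α q (0, a, b) = 0)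
    (hne : ∀ q ∈ toTotal '' J, ρ f q ≠ 0) : ∃ a : ℝ, e = a • f := by
  have key := deriv_coeff_eq_zero_of_isPointSymmetry S.isOpen S.F_ne (S.smooth f) (S.smooth f)
    hα (contDiffOn_const (c := (0 : ℝ))) (S.symm e) (S.symm f) (S.symm f)
    (fun q hq => by simpa using h q hq) hαx (fun q _ a b => by simp)
  have hd : ∀ q ∈ toTotal '' J, DifferentiableAt ℝ α q :=
    fun q hq => (hα.contDiffAt (S.isOpen_total.mem_nhds hq)).diff
  obtain ⟨a, ha⟩ := exists_eq_const hc hd (fun q hq => by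
    have := key q hq
    simp only [fderiv_fun_const, Pi.zero_apply, _root_.zero_apply, zero_smul, add_zero]
      at this
    exact (smul_eq_zero.1 this).resolve_right (hne q hq)) hαx
  exact ⟨a, S.eq_of_eqOn fun q hq => by rw [h q hq, ha q hq]; simp⟩

end SymmetricEquation
end EvolEq
-- Three proportional vertical symmetries linearize the equation.
namespace EvolEq

variable {L : Type*} [LieRing L] [LieAlgebra ℝ L]

namespace SymmetricEquation

variable {J : Set Jet} {F G : Jet → ℝ} {ρ : L →ₗ[ℝ] (Total → Total)}

/-- The coefficient of a vector field proportional to a nowhere zero one is smooth. -/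
theorem exists_coeff (S : SymmetricEquation J F G ρ) {e f : L}
    (hne : ∀ q ∈ toTotal '' J, ρ e q ≠ 0)
    (h : ∀ q ∈ toTotal '' J, ∃ c : ℝ, ρ f q = c • ρ e q) :
    ∃ α : Total → ℝ, ContDiffOn ℝ ∞ α (toTotal '' J) ∧
      ∀ q ∈ toTotal '' J, ρ f q = α q • ρ e q := by
  have hpos : ∀ q ∈ toTotal '' J,
      (ρ e q).1 ^ 2 + (ρ e q).2.1 ^ 2 + (ρ e q).2.2 ^ 2 ≠ 0 := by
    intro q hq h0
    refine hne q hq ?_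
    have h1 := sq_nonneg (ρ e q).1
    have h2 := sq_nonneg (ρ e q).2.1
    have h3 := sq_nonneg (ρ e q).2.2
    ext
    · exact pow_eq_zero_iff two_ne_zero |>.1 (by linarith)
    · exact pow_eq_zero_iff two_ne_zero |>.1 (by linarith)
    · exact pow_eq_zero_iff two_ne_zero |>.1 (by linarith)
  -- The coefficient is written as `⟨e, f⟩ / ⟨e, e⟩`, which is visibly smooth.
  refine ⟨fun q => ((ρ e q).1 * (ρ f q).1 + (ρ e q).2.1 * (ρ f q).2.1
    + (ρ e q).2.2 * (ρ f q).2.2) / ((ρ e q).1 ^ 2 + (ρ e q).2.1 ^ 2 + (ρ e q).2.2 ^ 2), ?_, ?_⟩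
  · have he := S.smooth e
    have hf := S.smooth f
    exact (((he.fst.mul hf.fst).add (he.snd.fst.mul hf.snd.fst)).add
      (he.snd.snd.mul hf.snd.snd)).div
      (((he.fst.pow 2).add (he.snd.fst.pow 2)).add (he.snd.snd.pow 2)) hpos
  · intro q hq
    obtain ⟨c, hc⟩ := h q hq
    have hp := hpos q hq
    simp only [hc, Prod.smul_fst, Prod.smul_snd, smul_eq_mul]
    congr 1
    rw [eq_div_iff hp]
    ring

/-- Three independent proportional vertical symmetries with the commutators
`[e₁, e₂] = 0` and `[e₁, e₃] = a e₁` linearize the equation. -/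
theorem exists_linearizableAt (S : SymmetricEquation J F G ρ) {e₁ e₂ e₃ : L} {a : ℝ}
    (h₁ : e₁ ≠ 0) (h₂ : ∀ c : ℝ, e₂ ≠ c • e₁) (h₃ : ∀ β γ : ℝ, e₃ ≠ β • e₂ + γ • e₁)
    (hτ₁ : ∀ q ∈ toTotal '' J, (ρ e₁ q).1 = 0)
    (hp₂ : ∀ q ∈ toTotal '' J, ρ e₁ q ≠ 0 → ∃ c : ℝ, ρ e₂ q = c • ρ e₁ q)
    (hp₃ : ∀ q ∈ toTotal '' J, ρ e₁ q ≠ 0 → ∃ c : ℝ, ρ e₃ q = c • ρ e₁ q)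
    (h₁₂ : ⁅e₁, e₂⁆ = 0) (h₁₃ : ⁅e₁, e₃⁆ = a • e₁) :
    ∃ j ∈ J, LinearizableAt J F G j := by
  obtain ⟨q₀, hq₀, hV₀⟩ := S.exists_ne_zero h₁
  obtain ⟨J₁, hJ₁, S₁, hc₁, hne, -⟩ :=
    S.exists_convex hq₀ ((S.contDiffAt e₁ hq₀).continuousAt.eventually_ne hV₀)
  have hΩ₁ := Set.image_mono (f := toTotal) hJ₁
  obtain ⟨f₂, hf₂, hV₂⟩ := S₁.exists_coeff hne fun q hq => hp₂ q (hΩ₁ hq) (hne q hq)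
  obtain ⟨f₃, hf₃, hV₃⟩ := S₁.exists_coeff hne fun q hq => hp₃ q (hΩ₁ hq) (hne q hq)
  -- Since `[e₁, φ e₁] = e₁(φ) e₁`, the commutators prescribe the derivatives of the ratios along
  -- `e₁`.
  have hd₂ : ∀ q ∈ toTotal '' J₁, fderiv ℝ f₂ q (ρ e₁ q) = 0 := by
    intro q hq
    have := S₁.bracket_smul (e := e₁) hq hf₂ hV₂
    rw [h₁₂, lie_self, map_zero, Pi.zero_apply, smul_zero, add_zero] at this
    exact (smul_eq_zero.1 this.symm).resolve_right (hne q hq)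
  have hd₃ : ∀ q ∈ toTotal '' J₁, fderiv ℝ f₃ q (ρ e₁ q) = a := by
    intro q hq
    have := S₁.bracket_smul (e := e₁) hq hf₃ hV₃
    rw [h₁₃, lie_self, map_zero, Pi.zero_apply, smul_zero, add_zero, map_smul, Pi.smul_apply]
      at this
    exact (smul_left_injective ℝ (hne q hq) this).symm
  -- Otherwise the ratio of `e₂` to `e₁` would depend on `t` only, hence be constant.
  obtain ⟨q₁, hq₁, hxy⟩ : ∃ q ∈ toTotal '' J₁, ∃ x y, fderiv ℝ f₂ q (0, x, y) ≠ 0 := by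
    by_contra! hcon
    obtain ⟨c, hc⟩ := S₁.exists_eq_smul hc₁ hf₂ hV₂ hcon hne
    exact h₂ c hc
  obtain ⟨Ω', U, hΩ', hoΩ', hq₁', hU, hU₁, hjac, hinj, hfun⟩ :=
    exists_straightening S₁.isOpen_total hq₁ (S₁.smooth e₁) (fun q hq => hτ₁ q (hΩ₁ hq))
      (hne q₁ hq₁) hf₂ hd₂ hxy
  obtain ⟨k, hk⟩ := hfun f₃ a hf₃ hd₃
  obtain ⟨j₁, hj₁, rfl⟩ := hq₁
  have hdf : ∀ q ∈ toTotal '' J₁, ContDiffAt ℝ ∞ f₂ q := fun q hq =>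
    hf₂.contDiffAt (S₁.isOpen_total.mem_nhds hq)
  set J₂ := J₁ ∩ toTotal ⁻¹' Ω' with hJ₂
  have hoJ₂ : IsOpen J₂ := S₁.isOpen.inter (hoΩ'.preimage contDiff_toTotal.continuous)
  have hlift : ∀ i ∈ J₂, totalDx (f₂ ∘ toTotal) i = fderiv ℝ f₂ (toTotal i) (0, 1, i.2.2.2.1) :=
    fun i hi => IsAdapted.totalDx_lift (hdf _ ⟨i, hi.1, rfl⟩).diff
  -- `D_x f₂ = f₂_x + u_x f₂_u` vanishes on the whole fibre over `q₁` only if both partial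
  -- derivatives vanish there, so some jet allows `f₂` as the new `x`.
  obtain ⟨j₂, hj₂, hD⟩ : ∃ i ∈ J₂, totalDx (f₂ ∘ toTotal) i ≠ 0 := by
    by_contra! hcon
    obtain ⟨x, y, hxy⟩ := hxy
    have hw : ((0, - fderiv ℝ f₂ (toTotal j₁) (0, 0, 1), fderiv ℝ f₂ (toTotal j₁) (0, 1, 0)) :
        Total) = 0 := by
      refine eq_zero_of_characteristic_eq_zero hoJ₂ ⟨hj₁, hq₁'⟩ fun i hi hij r => ?_
      have h0 := hcon i hi
      have hv : ((0, 1, i.2.2.2.1) : Total)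
          = (0, 1, 0) + i.2.2.2.1 • ((0, 0, 1) : Total) := by ext <;> simp
      rw [hlift i hi, hij, hv, map_add, map_smul, smul_eq_mul] at h0
      simp only
      linarith
    have hv : ((0, x, y) : Total) = x • ((0, 1, 0) : Total) + y • ((0, 0, 1) : Total) := by
      ext <;> simp
    have hx : fderiv ℝ f₂ (toTotal j₁) (0, 1, 0) = 0 := congrArg (fun w : Total => w.2.2) hw
    have hy : fderiv ℝ f₂ (toTotal j₁) (0, 0, 1) = 0 :=
      neg_eq_zero.1 (congrArg (fun w : Total => w.2.1) hw)
    exact hxy (by rw [hv, map_add, map_smul, map_smul, hx, hy]; simp)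
  set J₃ := {i ∈ J₂ | totalDx (f₂ ∘ toTotal) i ≠ 0} with hJ₃
  have hJ₃₂ : J₃ ⊆ J₂ := fun i hi => hi.1
  have hJ₃₁ : J₃ ⊆ J₁ := fun i hi => hi.1.1
  have hoJ₃ : IsOpen J₃ := by
    refine isOpen_iff_mem_nhds.2 fun i hi => ?_
    have hc : ContinuousAt (totalDx (f₂ ∘ toTotal)) i :=
      (ContDiffAt.totalDx ((hdf _ ⟨i, hi.1.1, rfl⟩).comp i contDiff_toTotal.contDiffAt)).continuousAt
    exact (hoJ₂.eventually_mem hi.1).and (hc.eventually_ne hi.2)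
  have S₃ := S₁.mono hJ₃₁ hoJ₃ ⟨j₂, hj₂, hD⟩
  have hΩ₃ : toTotal '' J₃ ⊆ Ω' := by
    rintro _ ⟨i, hi, rfl⟩
    exact hi.1.2
  have hΩ₃₁ : toTotal '' J₃ ⊆ toTotal '' J₁ := Set.image_mono hJ₃₁
  have hA : IsAdapted J₃ f₂ U :=
    { isOpen := hoJ₃
      smoothX := hf₂.mono hΩ₃₁
      smoothU := hU.mono hΩ₃
      Dx_ne := fun i hi => hi.2
      jac := fun q hq => hjac q (hΩ₃ hq) }
  have hvert : ∀ (f : L) (φ : Total → ℝ), (∀ q ∈ toTotal '' J₁, ρ f q = φ q • ρ e₁ q) →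
      ∀ q ∈ toTotal '' J₃, (ρ f q).1 = 0 := fun f φ h q hq => by
    rw [h q (hΩ₃₁ hq), Prod.smul_fst, hτ₁ q (hΩ₁ (hΩ₃₁ hq)), smul_zero]
  rcases hA.linearizable S₃.nonempty S₃.smoothF S₃.smoothG S₃.F_ne (hinj.mono hΩ₃)
    (S₃.smooth e₁) (S₃.smooth e₂) (S₃.smooth e₃) (S₃.symm e₁) (S₃.symm e₂) (S₃.symm e₃)
    (fun q hq => hτ₁ q (hΩ₁ (hΩ₃₁ hq))) (hvert e₂ f₂ hV₂) (hvert e₃ f₃ hV₃)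
    (fun q hq => hd₂ q (hΩ₃₁ hq))
    (fun q hq => by rw [hV₂ q (hΩ₃₁ hq), map_smul, hd₂ q (hΩ₃₁ hq), smul_zero])
    (fun q hq => by rw [hV₃ q (hΩ₃₁ hq), map_smul, hd₂ q (hΩ₃₁ hq), smul_zero])
    (a := a) (k := k) (fun q hq => (hk q (hΩ₃ hq)).1) (fun q hq => hU₁ q (hΩ₃ hq))
    (fun q hq => by rw [hV₂ q (hΩ₃₁ hq), map_smul, hU₁ q (hΩ₃ hq), smul_eq_mul, mul_one])
    (fun q hq => by
      rw [hV₃ q (hΩ₃₁ hq), map_smul, hU₁ q (hΩ₃ hq), smul_eq_mul, mul_one, (hk q (hΩ₃ hq)).2])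
    with ⟨j, hj, hlin⟩ | ⟨rfl, β, γ, N, hN, hoN, hNne, hβγ⟩
  · exact ⟨j, hJ₁ (hJ₃₁ hj), hlin.mono (hJ₃₁.trans hJ₁)⟩
  · refine absurd ((S₃.mono hN hoN hNne).eq_of_eqOn fun q hq => ?_) (h₃ β γ)
    have hq₃ := Set.image_mono (f := toTotal) hN hq
    rw [map_add, map_smul, map_smul, Pi.add_apply, Pi.smul_apply, Pi.smul_apply,
      hV₃ q (hΩ₃₁ hq₃), hV₂ q (hΩ₃₁ hq₃), (hk q (hΩ₃ hq₃)).2, hβγ q hq]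
    module

end SymmetricEquation
end EvolEq
-- Solvable algebras of dimension three and rank one.
namespace EvolEq

variable {L : Type*} [LieRing L] [LieAlgebra ℝ L]

theorem exists_ne_smul (h : 1 < Module.rank ℝ L) (e : L) : ∃ f : L, ∀ c : ℝ, f ≠ c • e := by
  by_contra! hcon
  have h1 : (⊤ : Submodule ℝ L) ≤ Submodule.span ℝ {e} := fun f _ => by
    obtain ⟨c, hc⟩ := hcon f
    exact Submodule.mem_span_singleton.2 ⟨c, hc.symm⟩
  have h2 := (rank_top ℝ L).symm.trans_le ((Submodule.rank_mono h1).trans (rank_span_le {e}))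
  rw [Cardinal.mk_singleton] at h2
  exact absurd h (not_lt.2 h2)

theorem exists_ne_combination_two (h : 2 < Module.rank ℝ L) (e f : L) :
    ∃ g : L, ∀ β γ : ℝ, g ≠ β • f + γ • e := by
  classical
  by_contra! hcon
  have h1 : (⊤ : Submodule ℝ L) ≤ Submodule.span ℝ ({f, e} : Finset L) := fun g _ => by
    obtain ⟨b, c, hc⟩ := hcon g
    simpa using Submodule.mem_span_pair.2 ⟨b, c, hc.symm⟩
  have h2 := (rank_top ℝ L).symm.trans_le ((Submodule.rank_mono h1).trans (rank_span_finset_le _))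
  have h3 : (({f, e} : Finset L).card : Cardinal) ≤ 2 := by exact_mod_cast Finset.card_le_two
  exact absurd h (not_lt.2 (h2.trans h3))

/-- The structure of three-dimensional solvable Lie algebras needed below. -/
theorem exists_basis_of_isSolvable [LieAlgebra.IsSolvable L] (h : Module.finrank ℝ L = 3) :
    ∃ (e₁ e₂ e₃ : L) (a b : ℝ), e₁ ≠ 0 ∧ (∀ c : ℝ, e₂ ≠ c • e₁) ∧
      (∀ β γ : ℝ, e₃ ≠ β • e₂ + γ • e₁) ∧ ⁅e₁, e₂⁆ = 0 ∧ ⁅e₁, e₃⁆ = a • e₁ + b • e₂ ∧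
      (b = 0 ∨ ∃ c d : ℝ, ⁅e₂, e₃⁆ = c • e₁ + d • e₂) := by
  have hfin : Module.Finite ℝ L := Module.finite_of_finrank_pos (by omega)
  have hrank : Module.rank ℝ L = 3 := by rw [← Module.finrank_eq_rank, h]; rfl
  have hr2 : 2 < Module.rank ℝ L := by rw [hrank]; norm_num
  have hr1 : 1 < Module.rank ℝ L := by rw [hrank]; norm_num
  have hnt : Nontrivial L := Module.nontrivial_of_finrank_pos (R := ℝ) (by omega)
  -- The last nonzero term of the derived series: a nonzero abelian ideal.
  set I := LieAlgebra.derivedAbelianOfIdeal (⊤ : LieIdeal ℝ L) with hI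
  have hIbot : I ≠ ⊥ := by
    rw [hI, Ne, LieAlgebra.abelian_of_solvable_ideal_eq_bot_iff]
    exact top_ne_bot
  have hab : IsLieAbelian I := LieAlgebra.abelian_derivedAbelianOfIdeal _
  have habel : ∀ x ∈ I, ∀ y ∈ I, ⁅x, y⁆ = 0 := fun x hx y hy =>
    congrArg Subtype.val (trivial_lie_zero I I ⟨x, hx⟩ ⟨y, hy⟩)
  have hideal : ∀ x ∈ I, ∀ y, ⁅x, y⁆ ∈ I := fun x hx y => lie_mem_left ℝ L I x y hx
  obtain ⟨e₁, he₁, hne⟩ : ∃ e ∈ I, e ≠ 0 := by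
    by_contra! hcon
    exact hIbot ((LieSubmodule.eq_bot_iff I).2 hcon)
  -- If `I` is a line, bracketing with `e₁` maps the algebra into that line, so some element
  -- independent of `e₁` commutes with it.
  by_cases hA : ∀ f ∈ I, ∃ c : ℝ, f = c • e₁
  · obtain ⟨f, hf⟩ := exists_ne_smul hr1 e₁
    obtain ⟨g, hg⟩ := exists_ne_combination_two hr2 e₁ f
    obtain ⟨c, hc⟩ := hA _ (hideal e₁ he₁ f)
    obtain ⟨d, hd⟩ := hA _ (hideal e₁ he₁ g)
    by_cases hc0 : c = 0
    · exact ⟨e₁, f, g, d, 0, hne, hf, hg, by rw [hc, hc0, zero_smul], by rw [hd]; simp, Or.inl rfl⟩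
    -- The multiple of `f` is chosen to cancel `[e₁, g] = d e₁` by means of `[e₁, f] = c e₁`.
    · refine ⟨e₁, g - (d / c) • f, f, c, 0, hne, fun s hs => ?_, fun β γ hs => ?_, ?_, ?_,
        Or.inl rfl⟩
      · exact hg (d / c) s (by rw [← hs]; abel)
      · by_cases hβ : β = 0
        · exact hf γ (by rw [hs, hβ, zero_smul, zero_add])
        · refine hg (d / c + β⁻¹) (- β⁻¹ * γ) ?_
          have h1 : β⁻¹ • f = (g - (d / c) • f) + (β⁻¹ * γ) • e₁ := by
            conv_lhs => rw [hs]
            rw [smul_add, smul_smul, smul_smul, inv_mul_cancel₀ hβ, one_smul]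
          rw [add_smul, h1]
          module
      · rw [lie_sub, lie_smul, hc, hd, smul_smul, div_mul_cancel₀ _ hc0, sub_self]
      · rw [hc]; simp
  · push Not at hA
    obtain ⟨e₂, he₂, h₂⟩ := hA
    -- If `I` has three independent elements, they all commute. Otherwise `I` is spanned by `e₁,
    -- e₂`, and brackets with an outside `e₃` stay in this span; this is the only case in which `b`
    -- may be nonzero.
    by_cases hB : ∃ e₃ ∈ I, ∀ β γ : ℝ, e₃ ≠ β • e₂ + γ • e₁
    · obtain ⟨e₃, he₃, h₃⟩ := hB
      exact ⟨e₁, e₂, e₃, 0, 0, hne, h₂, h₃, habel _ he₁ _ he₂, by simp [habel _ he₁ _ he₃],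
        Or.inl rfl⟩
    · push Not at hB
      obtain ⟨e₃, h₃⟩ := exists_ne_combination_two hr2 e₁ e₂
      obtain ⟨b, a, hab'⟩ := hB _ (hideal e₁ he₁ e₃)
      obtain ⟨d, c, hcd⟩ := hB _ (hideal e₂ he₂ e₃)
      exact ⟨e₁, e₂, e₃, a, b, hne, h₂, h₃, habel _ he₁ _ he₂, by rw [hab', add_comm],
        Or.inr ⟨c, d, by rw [hcd, add_comm]⟩⟩

theorem IsRankOne.exists_eq_smul {Ω : Set Total} {ρ : L →ₗ[ℝ] (Total → Total)}
    (h : IsRankOne Ω ρ) {q : Total} (hq : q ∈ Ω) {e : L} (he : ρ e q ≠ 0) (f : L) :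
    ∃ c : ℝ, ρ f q = c • ρ e q := by
  obtain ⟨v, hv⟩ := finrank_le_one_iff.1 (h q hq)
  have hmem : ∀ g : L, ρ g q ∈ Submodule.span ℝ (Set.range fun e => ρ e q) := fun g =>
    Submodule.subset_span ⟨g, rfl⟩
  obtain ⟨a, ha⟩ := hv ⟨_, hmem e⟩
  obtain ⟨b, hb⟩ := hv ⟨_, hmem f⟩
  have ha' : a • (v : Total) = ρ e q := congrArg Subtype.val ha
  have hb' : b • (v : Total) = ρ f q := congrArg Subtype.val hb
  have ha0 : a ≠ 0 := by
    rintro rfl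
    exact he (by rw [← ha', zero_smul])
  exact ⟨b / a, by rw [← ha', ← hb', smul_smul, div_mul_cancel₀ _ ha0]⟩

namespace SymmetricEquation

variable {J : Set Jet} {F G : Jet → ℝ} {ρ : L →ₗ[ℝ] (Total → Total)}

/-- If some field had a nonzero `t`-component, every other field would be a multiple of it near that
point, with coefficient the quotient of the `t`-components. This depends on `t` only, hence is
constant, and the algebra would be one-dimensional. -/
theorem fst_eq_zero_of_isRankOne (S : SymmetricEquation J F G ρ)
    (hr : IsRankOne (toTotal '' J) ρ) (hL : 1 < Module.rank ℝ L) (e : L) :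
    ∀ q ∈ toTotal '' J, (ρ e q).1 = 0 := by
  by_contra! hcon
  obtain ⟨q₀, hq₀, h0⟩ := hcon
  obtain ⟨J₁, hJ₁, S₁, hc₁, hne, -⟩ :=
    S.exists_convex hq₀ ((S.contDiffAt e hq₀).fst.continuousAt.eventually_ne h0)
  have hne' : ∀ q ∈ toTotal '' J₁, ρ e q ≠ 0 := fun q hq h => hne q hq (by rw [h]; rfl)
  obtain ⟨f, hf⟩ := exists_ne_smul hL e
  obtain ⟨α, hα, hV⟩ := S₁.exists_coeff hne' fun q hq =>
    (hr.mono (Set.image_mono hJ₁)).exists_eq_smul hq (hne' q hq) f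
  obtain ⟨c, hc⟩ := S₁.exists_eq_smul hc₁ hα hV (fun q hq a b => by
    have h1 := fderiv_of_eqOn_mul (A := fun q => (ρ f q).1) (B := α) (D := fun q => (ρ e q).1)
      S₁.isOpen_total hq (hα.contDiffAt (S₁.isOpen_total.mem_nhds hq)).diff
      (S₁.contDiffAt e hq).fst.diff (fun i hi => by simp [hV i hi]) (0, a, b)
    rw [S₁.fderiv_fst f q hq, S₁.fderiv_fst e q hq, mul_zero, add_zero] at h1
    exact (mul_eq_zero.1 h1.symm).resolve_right (hne q hq)) hne'
  exact hf c hc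

/-- Let `e₂ = h e₁` and `e₃ = f e₁`. The commutators give `e₁ f = a + b h` and `e₂ f = c + d h`,
while `e₂ f = h · e₁ f`; hence `b h² + (a - d) h = c`. For `b ≠ 0` this quadratic equation with
constant coefficients forces `h` to be constant: a double root is explicit, and for a nonzero
discriminant one differentiates. But `e₂` is not a constant multiple of `e₁`. -/
theorem structure_constant_eq_zero (S : SymmetricEquation J F G ρ)
    {e₁ e₂ e₃ : L} {a b c d : ℝ} (h₁ : e₁ ≠ 0) (h₂ : ∀ c : ℝ, e₂ ≠ c • e₁)
    (hr : IsRankOne (toTotal '' J) ρ) (h₁₂ : ⁅e₁, e₂⁆ = 0)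
    (h₁₃ : ⁅e₁, e₃⁆ = a • e₁ + b • e₂) (h₂₃ : ⁅e₂, e₃⁆ = c • e₁ + d • e₂) : b = 0 := by
  obtain ⟨q₀, hq₀, hV₀⟩ := S.exists_ne_zero h₁
  obtain ⟨J₁, hJ₁, S₁, hc₁, hne, -⟩ :=
    S.exists_convex hq₀ ((S.contDiffAt e₁ hq₀).continuousAt.eventually_ne hV₀)
  have hr₁ := hr.mono (Set.image_mono (f := toTotal) hJ₁)
  obtain ⟨h, hh, hV₂⟩ := S₁.exists_coeff hne fun q hq => hr₁.exists_eq_smul hq (hne q hq) e₂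
  obtain ⟨f, hf, hV₃⟩ := S₁.exists_coeff hne fun q hq => hr₁.exists_eq_smul hq (hne q hq) e₃
  have h₂₁ : ⁅e₂, e₁⁆ = 0 := by rw [← lie_skew, h₁₂, neg_zero]
  have hquad : ∀ q ∈ toTotal '' J₁, c = (b * h q + (a - d)) * h q := by
    intro q hq
    have k₁ := S₁.bracket_smul (e := e₁) hq hf hV₃
    have k₂ := S₁.bracket_smul (e := e₂) hq hf hV₃
    rw [h₁₃, lie_self, map_zero, Pi.zero_apply, smul_zero, add_zero, map_add, Pi.add_apply,
      map_smul, map_smul, Pi.smul_apply, Pi.smul_apply, hV₂ q hq, smul_smul, ← add_smul] at k₁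
    rw [h₂₃, h₂₁, map_zero, Pi.zero_apply, smul_zero, add_zero, map_add, Pi.add_apply,
      map_smul, map_smul, Pi.smul_apply, Pi.smul_apply, hV₂ q hq, smul_smul, ← add_smul,
      map_smul, smul_eq_mul] at k₂
    have m₁ := smul_left_injective ℝ (hne q hq) k₁
    have m₂ := smul_left_injective ℝ (hne q hq) k₂
    rw [← m₁] at m₂
    linarith
  by_contra hb
  by_cases hK : (a - d) ^ 2 + 4 * b * c = 0
  · refine h₂ ((d - a) / (2 * b)) (S₁.eq_of_eqOn fun q hq => ?_)
    have h1 : (2 * b * h q + (a - d)) ^ 2 = 0 := by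
      rw [← hK]
      have := hquad q hq
      linear_combination (-4 * b) * this
    have h2 : h q = (d - a) / (2 * b) := by
      rw [eq_div_iff (by simpa using hb)]
      have := pow_eq_zero_iff two_ne_zero |>.1 h1
      linarith
    rw [hV₂ q hq, h2, map_smul, Pi.smul_apply]
  · obtain ⟨s, hs⟩ := S₁.exists_eq_smul hc₁ hh hV₂ (fun q hq x y => by
      have hd : DifferentiableAt ℝ h q := (hh.contDiffAt (S₁.isOpen_total.mem_nhds hq)).diff
      have h1 := fderiv_of_eqOn_mul (A := fun _ => c) (B := fun q => b * h q + (a - d)) (D := h)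
        S₁.isOpen_total hq ((hd.const_mul b).add_const _) hd hquad (0, x, y)
      rw [fderiv_add_const, fderiv_const_mul hd] at h1
      simp only [fderiv_fun_const, Pi.zero_apply, _root_.zero_apply, _root_.smul_apply,
        smul_eq_mul] at h1
      have h2 : (2 * b * h q + (a - d)) * fderiv ℝ h q (0, x, y) = 0 := by linarith
      refine (mul_eq_zero.1 h2).resolve_left fun h0 => hK ?_
      have := hquad q hq
      linear_combination (2 * b * h q + (a - d)) * h0 + 4 * b * this) hne
    exact h₂ s hs

theorem exists_linearizableAt_of_isSolvable (S : SymmetricEquation J F G ρ)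
    [LieAlgebra.IsSolvable L] (hL : Module.finrank ℝ L = 3)
    (hr : IsRankOne (toTotal '' J) ρ) : ∃ j ∈ J, LinearizableAt J F G j := by
  obtain ⟨e₁, e₂, e₃, a, b, h₁, h₂, h₃, h₁₂, h₁₃, h₂₃⟩ := exists_basis_of_isSolvable hL
  have hb : b = 0 := by
    rcases h₂₃ with h | ⟨c, d, h⟩
    · exact h
    · exact S.structure_constant_eq_zero h₁ h₂ hr h₁₂ h₁₃ h
  have hfin : Module.Finite ℝ L := Module.finite_of_finrank_pos (by omega)
  have hrank : 1 < Module.rank ℝ L := by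
    rw [← Module.finrank_eq_rank, hL]
    norm_num
  refine S.exists_linearizableAt (a := a) h₁ h₂ h₃ (S.fst_eq_zero_of_isRankOne hr hrank e₁)
    (fun q hq h => hr.exists_eq_smul hq h e₂) (fun q hq h => hr.exists_eq_smul hq h e₃) h₁₂ ?_
  rw [h₁₃, hb, zero_smul, add_zero]

end SymmetricEquation
end EvolEq
-- Abelian algebras of dimension at least four.
namespace EvolEq

variable {L : Type*} [LieRing L] [LieAlgebra ℝ L]

theorem exists_ne_combination_three (h : 3 < Module.rank ℝ L) (e f g : L) :
    ∃ k : L, ∀ α β γ : ℝ, k ≠ α • g + β • f + γ • e := by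
  classical
  by_contra! hcon
  have h1 : (⊤ : Submodule ℝ L) ≤ Submodule.span ℝ ({g, f, e} : Finset L) := fun k _ => by
    obtain ⟨a, b, c, hc⟩ := hcon k
    simpa using Submodule.mem_span_triple.2 ⟨a, b, c, hc.symm⟩
  have h2 := (rank_top ℝ L).symm.trans_le ((Submodule.rank_mono h1).trans (rank_span_finset_le _))
  have h3 : (({g, f, e} : Finset L).card : Cardinal) ≤ 3 := by exact_mod_cast Finset.card_le_three
  exact absurd h (not_lt.2 (h2.trans h3))

namespace SymmetricEquation

variable {J : Set Jet} {F G : Jet → ℝ} {ρ : L →ₗ[ℝ] (Total → Total)}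

/-- The components in the direction of `t` of commuting symmetries are proportional. -/
theorem exists_fst_eq_mul (S : SymmetricEquation J F G ρ) (hc : Convex ℝ (toTotal '' J)) {e f : L}
    (hne : ∀ q ∈ toTotal '' J, (ρ e q).1 ≠ 0) (hef : ⁅e, f⁆ = 0) :
    ∃ c : ℝ, ∀ q ∈ toTotal '' J, (ρ f q).1 = c * (ρ e q).1 := by
  have hd : ∀ g : L, ∀ q ∈ toTotal '' J, DifferentiableAt ℝ (fun q => (ρ g q).1) q :=
    fun g q hq => (S.contDiffAt g hq).fst.diff
  have hα : ContDiffOn ℝ ∞ (fun q => (ρ f q).1 / (ρ e q).1) (toTotal '' J) :=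
    (S.smooth f).fst.div (S.smooth e).fst hne
  have hαd : ∀ q ∈ toTotal '' J, DifferentiableAt ℝ (fun q => (ρ f q).1 / (ρ e q).1) q :=
    fun q hq => (hα.contDiffAt (S.isOpen_total.mem_nhds hq)).diff
  have hmul : ∀ q ∈ toTotal '' J, (ρ f q).1 = (ρ f q).1 / (ρ e q).1 * (ρ e q).1 :=
    fun q hq => (div_mul_cancel₀ _ (hne q hq)).symm
  have hder := fun q hq => fderiv_of_eqOn_mul S.isOpen_total hq (hαd q hq) (hd e q hq) hmul
  have hsplit : ∀ g : L, ∀ q ∈ toTotal '' J, ∀ v : Total,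
      (fderiv ℝ (ρ g) q v).1 = v.1 * fderiv ℝ (fun q => (ρ g q).1) q (1, 0, 0) := by
    intro g q hq v
    have h1 : (fderiv ℝ (ρ g) q v).1 = fderiv ℝ (fun q => (ρ g q).1) q v := by
      rw [((S.contDiffAt g hq).diff.hasFDerivAt.fst).fderiv]
      rfl
    have h2 : v = v.1 • ((1, 0, 0) : Total) + (0, v.2.1, v.2.2) := by ext <;> simp
    rw [h1]
    conv_lhs => rw [h2]
    rw [map_add, map_smul, S.fderiv_fst g q hq, add_zero, smul_eq_mul]
  -- Because the `t`-components depend on `t` only, the `t`-component of the bracket is a Wronskian,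
  -- equal to `τ_e²` times the `t`-derivative of `τ_f / τ_e`.
  have hα₁ : ∀ q ∈ toTotal '' J,
      fderiv ℝ (fun q => (ρ f q).1 / (ρ e q).1) q (1, 0, 0) = 0 := by
    intro q hq
    have h1 := congrArg Prod.fst (S.realization.bracket e f q hq)
    rw [hef, map_zero, VectorField.lieBracket, Prod.fst_sub, hsplit f q hq, hsplit e q hq,
      hder q hq] at h1
    simp only [Pi.zero_apply, Prod.fst_zero] at h1
    have h2 := hmul q hq
    have h3 : (ρ e q).1 * (ρ e q).1 *
        fderiv ℝ (fun q => (ρ f q).1 / (ρ e q).1) q (1, 0, 0) = 0 := by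
      linear_combination -h1 + fderiv ℝ (fun q => (ρ e q).1) q (1, 0, 0) * h2
    exact (mul_eq_zero.1 h3).resolve_left (mul_ne_zero (hne q hq) (hne q hq))
  have hα₂ : ∀ q ∈ toTotal '' J, ∀ a b,
      fderiv ℝ (fun q => (ρ f q).1 / (ρ e q).1) q (0, a, b) = 0 := by
    intro q hq a b
    have h1 := hder q hq (0, a, b)
    rw [S.fderiv_fst f q hq, S.fderiv_fst e q hq, mul_zero, add_zero] at h1
    exact (mul_eq_zero.1 h1.symm).resolve_right (hne q hq)
  obtain ⟨c, hc⟩ := exists_eq_const hc hαd hα₁ hα₂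
  exact ⟨c, fun q hq => by rw [← hc q hq]; exact hmul q hq⟩

/-- An abelian symmetry algebra of dimension at least four contains, locally, three independent
vertical fields. -/
theorem exists_vertical (S : SymmetricEquation J F G ρ) (hab : IsLieAbelian L)
    (hL : 4 ≤ Module.rank ℝ L) :
    ∃ J' ⊆ J, SymmetricEquation J' F G ρ ∧ ∀ e₁ e₂ : L, ∃ e₃ : L,
      (∀ q ∈ toTotal '' J', (ρ e₃ q).1 = 0) ∧ ∀ β γ : ℝ, e₃ ≠ β • e₂ + γ • e₁ := by
  have hr3 : 3 < Module.rank ℝ L := lt_of_lt_of_le (by norm_num) hL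
  have hr2 : 2 < Module.rank ℝ L := lt_of_lt_of_le (by norm_num) hL
  by_cases h : ∀ e : L, ∀ q ∈ toTotal '' J, (ρ e q).1 = 0
  · refine ⟨J, subset_rfl, S, fun e₁ e₂ => ?_⟩
    obtain ⟨e₃, h₃⟩ := exists_ne_combination_two hr2 e₁ e₂
    exact ⟨e₃, h e₃, h₃⟩
  · push Not at h
    obtain ⟨e₀, q₀, hq₀, h0⟩ := h
    -- Where `e₀` has a nonzero `t`-component, subtracting a constant multiple of it makes any field
    -- vertical. Choosing that field independent of `e₀` as well as of the two given ones keeps the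
    -- result independent of the latter; this uses the fourth dimension.
    obtain ⟨J₁, hJ₁, S₁, hc₁, hne, -⟩ :=
      S.exists_convex hq₀ ((S.contDiffAt e₀ hq₀).fst.continuousAt.eventually_ne h0)
    refine ⟨J₁, hJ₁, S₁, fun e₁ e₂ => ?_⟩
    obtain ⟨f, hf⟩ := exists_ne_combination_three hr3 e₁ e₂ e₀
    obtain ⟨c, hc⟩ := S₁.exists_fst_eq_mul hc₁ hne (trivial_lie_zero L L e₀ f)
    refine ⟨f - c • e₀, fun q hq => ?_, fun β γ hs => hf c β γ ?_⟩
    · rw [map_sub, map_smul, Pi.sub_apply, Pi.smul_apply, Prod.fst_sub, Prod.smul_fst, hc q hq,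
        smul_eq_mul, sub_self]
    · rw [add_assoc, ← hs, add_sub_cancel]

/-- Vertical vector fields of an abelian symmetry algebra are proportional if there are at least
three independent ones. -/
theorem exists_eq_smul_of_isLieAbelian (S : SymmetricEquation J F G ρ) (hab : IsLieAbelian L)
    {e f : L} (he : ∀ q ∈ toTotal '' J, (ρ e q).1 = 0) (hf : ∀ q ∈ toTotal '' J, (ρ f q).1 = 0)
    (h : ∃ g : L, (∀ q ∈ toTotal '' J, (ρ g q).1 = 0) ∧ ∀ β γ : ℝ, g ≠ β • f + γ • e)
    {q : Total} (hq : q ∈ toTotal '' J) (hV : ρ e q ≠ 0) : ∃ c : ℝ, ρ f q = c • ρ e q := by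
  obtain ⟨g, hg, hgn⟩ := h
  let D : Total → ℝ := fun q => (ρ e q).2.1 * (ρ f q).2.2 - (ρ e q).2.2 * (ρ f q).2.1
  by_cases hD : D q = 0
  · simp only [D] at hD
    by_cases hξ : (ρ e q).2.1 = 0
    · have hη : (ρ e q).2.2 ≠ 0 := fun h0 => hV (Prod.ext (he q hq) (Prod.ext hξ h0))
      rw [hξ, zero_mul, zero_sub, neg_eq_zero] at hD
      refine ⟨(ρ f q).2.2 / (ρ e q).2.2, ?_⟩
      ext
      · simp [he q hq, hf q hq]
      · simp [hξ, (mul_eq_zero.1 hD).resolve_left hη]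
      · simp [div_mul_cancel₀ _ hη]
    · refine ⟨(ρ f q).2.1 / (ρ e q).2.1, ?_⟩
      ext
      · simp [he q hq, hf q hq]
      · simp [div_mul_cancel₀ _ hξ]
      · simp only [Prod.smul_snd, smul_eq_mul]
        field_simp
        linarith
  exfalso
  have hDs : ContDiffOn ℝ ∞ D (toTotal '' J) :=
    ((S.smooth e).snd.fst.mul (S.smooth f).snd.snd).sub
      ((S.smooth e).snd.snd.mul (S.smooth f).snd.fst)
  obtain ⟨J₁, hJ₁, S₁, hc₁, hne, -⟩ := S.exists_convex hq
    ((hDs.contDiffAt (S.isOpen_total.mem_nhds hq)).continuousAt.eventually_ne hD)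
  have hΩ := Set.image_mono (f := toTotal) hJ₁
  have sm := S₁.smooth
  have hDs₁ := hDs.mono hΩ
  -- Where the determinant `D` is nonzero, Cramer's rule expresses the third vertical field through
  -- `e` and `f`.
  let α : Total → ℝ := fun q =>
    ((ρ g q).2.1 * (ρ f q).2.2 - (ρ g q).2.2 * (ρ f q).2.1) / D q
  let β : Total → ℝ := fun q =>
    ((ρ e q).2.1 * (ρ g q).2.2 - (ρ e q).2.2 * (ρ g q).2.1) / D q
  have hα : ContDiffOn ℝ ∞ α (toTotal '' J₁) :=
    (((sm g).snd.fst.mul (sm f).snd.snd).sub ((sm g).snd.snd.mul (sm f).snd.fst)).div hDs₁ hne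
  have hβ : ContDiffOn ℝ ∞ β (toTotal '' J₁) :=
    (((sm e).snd.fst.mul (sm g).snd.snd).sub ((sm e).snd.snd.mul (sm g).snd.fst)).div hDs₁ hne
  have cramer : ∀ q ∈ toTotal '' J₁, ∀ v : Total, v.1 = 0 →
      v = ((v.2.1 * (ρ f q).2.2 - v.2.2 * (ρ f q).2.1) / D q) • ρ e q
        + (((ρ e q).2.1 * v.2.2 - (ρ e q).2.2 * v.2.1) / D q) • ρ f q := by
    intro q hq v hv
    have hDq := hne q hq
    ext
    · simp [he q (hΩ hq), hf q (hΩ hq), hv]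
    · simp only [Prod.snd_add, Prod.fst_add, Prod.smul_snd, Prod.smul_fst, smul_eq_mul]
      field_simp
      simp only [D]
      ring
    · simp only [Prod.snd_add, Prod.smul_snd, smul_eq_mul]
      field_simp
      simp only [D]
      ring
  have hcomb : ∀ q ∈ toTotal '' J₁, ρ g q = α q • ρ e q + β q • ρ f q :=
    fun q hq => cramer q hq _ (hg q (hΩ hq))
  have hind : ∀ q ∈ toTotal '' J₁, ∀ a b : ℝ, a • ρ e q + b • ρ f q = 0 → a = 0 ∧ b = 0 := by
    intro q hq a b hab
    have h1 := congrArg (fun v : Total => v.2.1) hab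
    have h2 := congrArg (fun v : Total => v.2.2) hab
    simp only [Prod.snd_add, Prod.fst_add, Prod.smul_snd, Prod.smul_fst, smul_eq_mul,
      Prod.snd_zero, Prod.fst_zero] at h1 h2
    constructor
    · have : a * D q = 0 := by
        simp only [D]
        linear_combination (ρ f q).2.2 * h1 - (ρ f q).2.1 * h2
      exact (mul_eq_zero.1 this).resolve_right (hne q hq)
    · have : b * D q = 0 := by
        simp only [D]
        linear_combination (ρ e q).2.1 * h2 - (ρ e q).2.2 * h1
      exact (mul_eq_zero.1 this).resolve_right (hne q hq)
  -- As all brackets vanish, the coefficients are invariant under every field of the algebra.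
  -- Invariance under `e` and `f`, which span the vertical directions, leaves only a dependence on
  -- `t`.
  have hder : ∀ k : L, ∀ q ∈ toTotal '' J₁,
      fderiv ℝ α q (ρ k q) = 0 ∧ fderiv ℝ β q (ρ k q) = 0 := by
    intro k q hq
    have := S₁.bracket_combination (e := k) hq hα hβ hcomb
    simp only [trivial_lie_zero L L, map_zero, Pi.zero_apply, smul_zero, add_zero] at this
    exact hind q hq _ _ this.symm
  obtain ⟨a, b, hab⟩ := S₁.exists_eq_combination hc₁ hα hβ hcomb
    (fun q hq x y => by
      rw [cramer q hq (0, x, y) rfl, map_add, map_smul, map_smul, (hder e q hq).1,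
        (hder f q hq).1]
      simp)
    (fun q hq x y => by
      rw [cramer q hq (0, x, y) rfl, map_add, map_smul, map_smul, (hder e q hq).2,
        (hder f q hq).2]
      simp) hind
  exact hgn b a (by rw [hab, add_comm])

theorem exists_linearizableAt_of_isLieAbelian (S : SymmetricEquation J F G ρ)
    (hab : IsLieAbelian L) (hL : 4 ≤ Module.rank ℝ L) : ∃ j ∈ J, LinearizableAt J F G j := by
  obtain ⟨J₁, hJ₁, S₁, hex⟩ := S.exists_vertical hab hL
  -- Independence from `0, 0` means that `e₁` is nonzero, and independence from `e₁, 0` that `e₂` is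
  -- not a multiple of `e₁`.
  obtain ⟨e₁, hτ₁, h₁⟩ := hex 0 0
  obtain ⟨e₂, hτ₂, h₂⟩ := hex e₁ 0
  obtain ⟨e₃, hτ₃, h₃⟩ := hex e₁ e₂
  obtain ⟨j, hj, hlin⟩ := S₁.exists_linearizableAt (e₁ := e₁) (e₂ := e₂) (e₃ := e₃) (a := 0)
    (fun h => h₁ 0 0 (by simp [h])) (fun c h => h₂ 0 c (by simp [h])) h₃ hτ₁
    (fun q hq h => S₁.exists_eq_smul_of_isLieAbelian hab hτ₁ hτ₂ (hex _ _) hq h)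
    (fun q hq h => S₁.exists_eq_smul_of_isLieAbelian hab hτ₁ hτ₃ (hex _ _) hq h)
    (trivial_lie_zero L L _ _) (by rw [trivial_lie_zero L L, zero_smul])
  exact ⟨j, hJ₁ hj, hlin.mono hJ₁⟩

end SymmetricEquation

/-! ### Linearizability at generic points. -/

theorem isOpen_setOf_linearizableAt {J : Set Jet} {F G : Jet → ℝ} :
    IsOpen {j ∈ J | LinearizableAt J F G j} := by
  refine isOpen_iff_mem_nhds.2 fun j hj => ?_
  obtain ⟨-, W, T, X, U, N, f₁, f₂, f₃, f₄, f₅, D, h1, h2, h3, h4, h5⟩ := hj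
  -- The transformation and the linear equation found for `j` serve every point of `N`.
  exact Filter.mem_of_superset (h2.mem_nhds h3) fun i hi =>
    ⟨h4 hi, W, T, X, U, N, f₁, f₂, f₃, f₄, f₅, D, h1, h2, hi, h4, h5⟩

end EvolEq

theorem mainTheorem1 {L : Type*} [LieRing L] [LieAlgebra ℝ L]
    (J : Set EvolEq.Jet) (hJ : IsOpen J) (F G : EvolEq.Jet → ℝ)
    (hF : ContDiffOn ℝ ∞ F J) (hG : ContDiffOn ℝ ∞ G J) (hF0 : ∀ j ∈ J, F j ≠ 0)
    (ρ : L →ₗ[ℝ] (EvolEq.Total → EvolEq.Total))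
    (hρ : EvolEq.IsRealization (EvolEq.toTotal '' J) ρ)
    (hsym : ∀ e, EvolEq.IsPointSymmetry J F G (ρ e))
    (hL : (LieAlgebra.IsSolvable L ∧ Module.finrank ℝ L = 3 ∧
        EvolEq.IsRankOne (EvolEq.toTotal '' J) ρ) ∨
      (IsLieAbelian L ∧ 4 ≤ Module.rank ℝ L)) :
    ∃ J₀ ⊆ J, IsOpen J₀ ∧ J ⊆ closure J₀ ∧
      ∀ j ∈ J₀, EvolEq.LinearizableAt J F G j := by
  refine ⟨{j ∈ J | EvolEq.LinearizableAt J F G j}, fun j hj => hj.1,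
    EvolEq.isOpen_setOf_linearizableAt, fun j hj => mem_closure_iff.2 fun O hO hjO => ?_,
    fun j hj => hj.2⟩
  have S : EvolEq.SymmetricEquation J F G ρ := ⟨hJ, ⟨j, hj⟩, hF, hG, hF0, hρ, hsym⟩
  have hsub : J ∩ O ⊆ J := Set.inter_subset_left
  have S' := S.mono hsub (hJ.inter hO) ⟨j, hj, hjO⟩
  -- Density: all hypotheses pass to the equation restricted to `J ∩ O`, faithfulness being required
  -- on every open subset, so each such piece contains a linearizable point.
  obtain ⟨i, hi, hlin⟩ : ∃ i ∈ J ∩ O, EvolEq.LinearizableAt (J ∩ O) F G i := by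
    rcases hL with ⟨hs, hdim, hr⟩ | ⟨hab, hdim⟩
    · exact S'.exists_linearizableAt_of_isSolvable hdim (hr.mono (Set.image_mono hsub))
    · exact S'.exists_linearizableAt_of_isLieAbelian hab hdim
  exact ⟨i, hi.2, hi.1, hlin.mono hsub⟩
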